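/- An instance of the single-machine weighted flow time problem is a finite set $Q$ of jobs; each job $q$ has a processing time $p_q>0$, a weight $w_q>0$ and a release time $r_q\ge 0$. At every point in time the machine processes at most one job, which must be released and not yet completed; preemption is allowed, and every job must eventually be completed. If $q$ is completed at time $c_q$, the cost of the schedule is the total weighted flow time $\sum_{q\in Q} w_q\,(c_q-r_q)$. Let $$P=\max_{q,q'\in Q}\frac{p_q}{p_{q'}},\qquad D=\max_{q,q'\in Q}\frac{w_q/p_q}{w_{q'}/p_{q'}},\qquad W=\max_{q,q'\in Q}\frac{w_q}{w_{q'}}$$ be the maximum ratios of processing times, of densities and of weights. Fix a constant $\rho>1$. In the semiclairvoyant model $\mathrm{SC}[\rho]$, a deterministic online algorithm decides at each time $t$ which job to process, knowing only which jobs were released up to time $t$, the release time $r_q$, the weight $w_q$ and the class $\lfloor\log_\rho p_q\rfloor$ (but not the processing time $p_q$) of each of them, and which of them have been completed up to time $t$ and when. The algorithm is $\alpha$-competitive, where $\alpha$ may depend on the instance, if on every instance its total weighted flow time is at most $\alpha$ times that of every feasible schedule of the instance (in particular, of an optimal offline schedule). Theorem. For every $\rho>1$ there are a constant $C=C(\rho)>0$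 and deterministic online algorithms in the model $\mathrm{SC}[\rho]$, which do not know $P$, $D$ or $W$ in advance, as follows: 1. an algorithm that is $C\,(1+\log P)$-competitive; 2. an algorithm that is $C\,(1+\log D)$-competitive; 3. an algorithm that is $C\,(1+\log W)$-competitive. -/

import Mathlib

namespace FlowTime

/-- An input of the single-machine weighted flow time problem: a finite set of jobs (named by
natural numbers), each with a processing time, a weight and a release time. Values of the three
functions outside `jobs` play no role. -/
structure Instance where
  jobs : Finset ℕ
  proc : ℕ → ℝ
  weight : ℕ → ℝ
  release : ℕ → ℝ
  proc_pos : ∀ q ∈ jobs, 0 < proc q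
  weight_pos : ∀ q ∈ jobs, 0 < weight q
  release_nonneg : ∀ q ∈ jobs, 0 ≤ release q

/-- The largest ratio `f q / f q'` over jobs `q, q'` in `s` (a maximum when `s` is nonempty). -/
noncomputable def maxRatio (s : Finset ℕ) (f : ℕ → ℝ) : ℝ :=
  sSup {x : ℝ | ∃ q ∈ s, ∃ q' ∈ s, x = f q / f q'}

/-- `P`: the maximum ratio of processing times. -/
noncomputable def Instance.P (I : Instance) : ℝ := maxRatio I.jobs I.proc

/-- `D`: the maximum ratio of densities, the density of a job being its weight divided by its
processing time. -/
noncomputable def Instance.D (I : Instance) : ℝ :=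
  maxRatio I.jobs fun q => I.weight q / I.proc q

/-- `W`: the maximum ratio of weights. -/
noncomputable def Instance.W (I : Instance) : ℝ := maxRatio I.jobs I.weight

/-- Given which job (if any) the machine runs at each time, the total time spent on job `q`
during `[0, t)`. -/
noncomputable def elapsed (run : ℝ → Option ℕ) (q : ℕ) (t : ℝ) : ℝ :=
  (MeasureTheory.volume {s : ℝ | 0 ≤ s ∧ s < t ∧ run s = some q}).toReal

/-- A feasible preemptive schedule on a single machine: at each time at most one job is run, only
jobs that are pending (released and not yet completed) are run, and every job is eventually
completed. -/
structure Schedule (I : Instance) where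
  run : ℝ → Option ℕ
  measurableSet_run : ∀ q, MeasurableSet {s : ℝ | run s = some q}
  pending : ∀ t q, run t = some q →
    q ∈ I.jobs ∧ I.release q ≤ t ∧ elapsed run q t < I.proc q
  completes : ∀ q ∈ I.jobs, ∃ t, I.proc q ≤ elapsed run q t

/-- The completion time of `q`: the first time at which `q` has been processed for its whole
processing time. -/
noncomputable def Schedule.completion {I : Instance} (S : Schedule I) (q : ℕ) : ℝ :=
  sInf {t : ℝ | 0 ≤ t ∧ I.proc q ≤ elapsed S.run q t}

/-- Total weighted flow time. -/
noncomputable def Schedule.flowTime {I : Instance} (S : Schedule I) : ℝ :=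
  ∑ q ∈ I.jobs, I.weight q * (S.completion q - I.release q)

/-- The class `⌊log_ρ p⌋` of a job with processing time `p`. -/
noncomputable def jobClass (ρ p : ℝ) : ℤ := ⌊Real.logb ρ p⌋

/-- What a semiclairvoyant algorithm knows about a released job: its release time, its weight, its
class (but not its processing time) and, once the job is completed, its completion time. -/
structure JobInfo where
  release : ℝ
  weight : ℝ
  cls : ℤ
  completedAt : Option ℝ

/-- The information available at a given time, job by job; `none` for jobs not yet released. -/
abbrev History : Type := ℕ → Option JobInfo

open Classical in
/-- The information revealed up to and including time `t` in the model `SC[ρ]` when the schedule `S`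
is executed on the instance `I`. -/
noncomputable def history (ρ : ℝ) {I : Instance} (S : Schedule I) (t : ℝ) : History := fun q =>
  if q ∈ I.jobs ∧ I.release q ≤ t then
    some
      { release := I.release q
        weight := I.weight q
        cls := jobClass ρ (I.proc q)
        completedAt := if S.completion q ≤ t then some (S.completion q) else none }
  else none

/-- A deterministic online algorithm in the semiclairvoyant model `SC[ρ]`: a rule `decide` that
chooses which job to run at time `t` from the information revealed up to time `t` alone, and that
produces a feasible schedule `sched I` on every instance `I`. (The schedule is determined by the
rule: two schedules that obey the same rule on `I` agree up to the first time at which their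
completions differ, hence always.) -/
structure SemiclairvoyantAlgorithm (ρ : ℝ) where
  decide : ℝ → History → Option ℕ
  sched : (I : Instance) → Schedule I
  obeys : ∀ (I : Instance) (t : ℝ), 0 ≤ t → (sched I).run t = decide t (history ρ (sched I) t)

/-- The algorithm's weighted flow time is at most `ratio I` times that of every (offline) feasible
schedule of `I`, and so at most `ratio I` times the optimum, for every instance `I`. -/
def SemiclairvoyantAlgorithm.IsCompetitive {ρ : ℝ} (A : SemiclairvoyantAlgorithm ρ)
    (ratio : Instance → ℝ) : Prop :=
  ∀ (I : Instance) (S : Schedule I), (A.sched I).flowTime ≤ ratio I * S.flowTime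

end FlowTime

/-! Flow time is the integral over time of the pending weight (`Schedule.flowTime_eq_integral`), so
it suffices to compare, at each time t, the load of the algorithm A with the load of an arbitrary
schedule S. The comparisons rest on one fact: while A works on a set of jobs, S cannot gain on A
there, because both machines have speed one.

Density bins (P and D). One rule serves both bounds. A bin collects the jobs of one density class;
levels measure weight on the scale B = ρ ^ b, with B large. The rule runs a bin of largest score,
which is the larger of the level of the bin's pending weight and two more than the highest level of
its jobs, truncated at a cap. Ties go to the denser bin. Inside a bin the highest level comes first,
then first come first served, so at most one pending job per bin and level has been started. Let
S.load t < B ^ y. Suppose that some bins of cap at least y + 2 have much weight in jobs of level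
below y; let K be the sparsest of them and J the jobs of level at least y together with those of bin
K or denser. When A last neglected J, it ran a small job of a sparser bin. If the score there was at
least y + 2, that bin was heavy and has since lost at most one job, against the choice of K.
Otherwise all of J had small volume in A at that time, so S cannot be far ahead on J at time t. As S
has little of J left, so has A, and bin K is light after all (`swt_lt`). The same look at the last
moment of neglect shows that A has no job of level y or more (`no_large`). The bins of smaller cap
add up to O(B ^ y) as a geometric series (`low_le`). Hence the load is O(1 + number of high bins)
times B ^ y. That number is O(1 + log D) trivially, and O(1 + log P) because the cap and `no_large`
confine the density class from both sides.

Slots (W). A row is a weight class. The uninterrupted pending jobs of a row occupy slots 1, 2, ...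
in decreasing order of processing class; an interrupted job keeps the slot it had. The rule runs a
job that maximizes ρ ^ row times slot. Fix t, let O be the jobs pending in S at t, and at time s
grant each row the slots for which this product is at most c times the weight of O released so far,
where c ≥ ρ. The invariant `Inv` says that the work A has outside the granted slots is at most the
work S has on the released jobs not in O. Time preserves it, since A works outside whenever
something pending is there. Releases preserve it, since a new job not in O pushes at most its own
size outside, and a new job of O opens c slots in its row. At time t the work of S on jobs not in O
is zero, so all jobs of A sit in granted slots, each slot holding at most two; a row then weighs
O(S.load t), and there are O(1 + log W) rows. -/

open MeasureTheory Set

/-! ### Processing time spent on jobs -/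

namespace FlowTime

/-- The runs of a machine that are used here: measurable ones. -/
def MeasRun (run : ℝ → Option ℕ) : Prop := ∀ q, MeasurableSet {s : ℝ | run s = some q}

theorem measurableSet_slice {run : ℝ → Option ℕ} (h : MeasRun run) (q : ℕ) (a b : ℝ) :
    MeasurableSet {s : ℝ | a ≤ s ∧ s < b ∧ run s = some q} := by
  have : {s : ℝ | a ≤ s ∧ s < b ∧ run s = some q} = Ico a b ∩ {s | run s = some q} := by
    ext s; simp [and_assoc]
  rw [this]; exact measurableSet_Ico.inter (h q)

theorem volume_slice_lt_top (_run : ℝ → Option ℕ) (P : ℝ → Prop) (a b : ℝ) :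
    volume {s : ℝ | a ≤ s ∧ s < b ∧ P s} < ⊤ :=
  lt_of_le_of_lt (measure_mono (t := Ico a b) fun s hs => ⟨hs.1, hs.2.1⟩) (by simp)

theorem elapsed_nonneg (run : ℝ → Option ℕ) (q : ℕ) (t : ℝ) : 0 ≤ elapsed run q t :=
  ENNReal.toReal_nonneg

theorem elapsed_eq_zero_of_nonpos (run : ℝ → Option ℕ) (q : ℕ) {t : ℝ} (ht : t ≤ 0) :
    elapsed run q t = 0 := by
  have : {s : ℝ | 0 ≤ s ∧ s < t ∧ run s = some q} = ∅ := by
    ext s; simp; intro h1 h2; linarith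
  simp [elapsed, this]

/-- The work done on the jobs of `J` during `[a, b)`. -/
theorem sum_elapsed_sub {run : ℝ → Option ℕ} (h : MeasRun run) (J : Finset ℕ) {a b : ℝ}
    (ha : 0 ≤ a) (hab : a ≤ b) :
    ∑ q ∈ J, (elapsed run q b - elapsed run q a) =
      (volume {s : ℝ | a ≤ s ∧ s < b ∧ ∃ q ∈ J, run s = some q}).toReal := by
  have h1 : ∀ q, elapsed run q b - elapsed run q a =
      (volume {s : ℝ | a ≤ s ∧ s < b ∧ run s = some q}).toReal := by
    intro q
    have hu : {s : ℝ | 0 ≤ s ∧ s < b ∧ run s = some q} =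
        {s : ℝ | 0 ≤ s ∧ s < a ∧ run s = some q} ∪ {s : ℝ | a ≤ s ∧ s < b ∧ run s = some q} := by
      ext s; simp only [mem_ofPred_eq, mem_union]
      constructor
      · rintro ⟨h1, h2, h3⟩
        rcases lt_or_ge s a with h | h
        · exact Or.inl ⟨h1, h, h3⟩
        · exact Or.inr ⟨h, h2, h3⟩
      · rintro (⟨h1, h2, h3⟩ | ⟨h1, h2, h3⟩)
        · exact ⟨h1, by linarith, h3⟩
        · exact ⟨by linarith, h2, h3⟩
    have hd : Disjoint {s : ℝ | 0 ≤ s ∧ s < a ∧ run s = some q}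
        {s : ℝ | a ≤ s ∧ s < b ∧ run s = some q} := by
      rw [Set.disjoint_left]; rintro s ⟨_, h2, _⟩ ⟨h3, _, _⟩; linarith
    unfold elapsed
    rw [hu, measure_union hd (measurableSet_slice h q a b),
      ENNReal.toReal_add (volume_slice_lt_top run _ _ _).ne (volume_slice_lt_top run _ _ _).ne]
    ring
  rw [Finset.sum_congr rfl fun q _ => h1 q]
  have hU : {s : ℝ | a ≤ s ∧ s < b ∧ ∃ q ∈ J, run s = some q} =
      ⋃ q ∈ J, {s : ℝ | a ≤ s ∧ s < b ∧ run s = some q} := by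
    ext s; simp only [mem_ofPred_eq, mem_iUnion]; aesop
  rw [hU, measure_biUnion_finset _ fun q _ => measurableSet_slice h q a b,
    ENNReal.toReal_sum fun q _ => (volume_slice_lt_top run _ _ _).ne]
  intro q _ q' _ hqq'
  simp only [Function.onFun]
  rw [Set.disjoint_left]; rintro s ⟨_, _, h2⟩ ⟨_, _, h3⟩
  rw [h2] at h3; exact hqq' (Option.some.inj h3)

theorem sum_elapsed_sub_le {run : ℝ → Option ℕ} (h : MeasRun run) (J : Finset ℕ) {a b : ℝ}
    (ha : 0 ≤ a) (hab : a ≤ b) :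
    ∑ q ∈ J, (elapsed run q b - elapsed run q a) ≤ b - a := by
  rw [sum_elapsed_sub h J ha hab]
  calc _ ≤ (volume (Ico a b)).toReal := by
        refine ENNReal.toReal_mono (by simp) (measure_mono fun s hs => ⟨hs.1, hs.2.1⟩)
    _ = b - a := by simp [hab]

theorem sum_elapsed_sub_eq {run : ℝ → Option ℕ} (h : MeasRun run) (J : Finset ℕ) {a b : ℝ}
    (ha : 0 ≤ a) (hab : a ≤ b) (hr : ∀ s, a < s → s < b → ∃ q ∈ J, run s = some q) :
    ∑ q ∈ J, (elapsed run q b - elapsed run q a) = b - a := by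
  refine le_antisymm (sum_elapsed_sub_le h J ha hab) ?_
  rw [sum_elapsed_sub h J ha hab]
  calc b - a = (volume (Ioo a b)).toReal := by simp [hab]
    _ ≤ _ := ENNReal.toReal_mono (volume_slice_lt_top run _ _ _).ne
        (measure_mono fun s hs => ⟨hs.1.le, hs.2, hr s hs.1 hs.2⟩)

theorem elapsed_mono {run : ℝ → Option ℕ} (q : ℕ) {a b : ℝ} (hab : a ≤ b) :
    elapsed run q a ≤ elapsed run q b :=
  ENNReal.toReal_mono (volume_slice_lt_top run _ _ _).ne
    (measure_mono fun _ hs => ⟨hs.1, by linarith [hs.2.1], hs.2.2⟩)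

theorem elapsed_sub_le {run : ℝ → Option ℕ} (h : MeasRun run) (q : ℕ) {a b : ℝ}
    (hab : a ≤ b) : elapsed run q b - elapsed run q a ≤ b - a := by
  rcases le_or_gt 0 a with ha | ha
  · simpa using sum_elapsed_sub_le h {q} ha hab
  · rw [elapsed_eq_zero_of_nonpos run q ha.le]
    rcases le_or_gt b 0 with hb | hb
    · rw [elapsed_eq_zero_of_nonpos run q hb]; linarith
    · have := sum_elapsed_sub_le h {q} le_rfl hb.le
      simp only [Finset.sum_singleton, elapsed_eq_zero_of_nonpos run q le_rfl] at this
      linarith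

theorem continuous_elapsed {run : ℝ → Option ℕ} (h : MeasRun run) (q : ℕ) :
    Continuous (elapsed run q) := by
  refine (LipschitzWith.of_dist_le_mul (K := 1) fun x y => ?_).continuous
  rw [Real.dist_eq, Real.dist_eq, NNReal.coe_one, one_mul]
  rcases le_total x y with hxy | hxy
  · rw [abs_sub_comm, abs_of_nonneg (sub_nonneg.2 (elapsed_mono q hxy)), abs_sub_comm x,
      abs_of_nonneg (sub_nonneg.2 hxy)]
    exact elapsed_sub_le h q hxy
  · rw [abs_of_nonneg (sub_nonneg.2 (elapsed_mono q hxy)), abs_of_nonneg (sub_nonneg.2 hxy)]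
    exact elapsed_sub_le h q hxy

/-! ### Completion times, pending weight, and flow time as an integral -/

namespace Schedule

variable {I : Instance} (S : Schedule I)

theorem measRun : MeasRun S.run := S.measurableSet_run

/-- Elapsed time is continuous and a finished job is never run, so the value stops growing when it
reaches the processing time. -/
theorem elapsed_le (q : ℕ) (hq : q ∈ I.jobs) (t : ℝ) : elapsed S.run q t ≤ I.proc q := by
  by_contra hlt
  push Not at hlt
  have ht0 : 0 < t := by
    by_contra h
    rw [elapsed_eq_zero_of_nonpos _ _ (not_lt.1 h)] at hlt
    linarith [I.proc_pos q hq]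
  have hc := continuous_elapsed S.measRun q
  obtain ⟨c, hc1, hc2⟩ := intermediate_value_Icc ht0.le hc.continuousOn
    (show I.proc q ∈ Icc (elapsed S.run q 0) (elapsed S.run q t) from
      ⟨by rw [elapsed_eq_zero_of_nonpos _ _ le_rfl]; exact (I.proc_pos q hq).le, hlt.le⟩)
  have key : elapsed S.run q t = elapsed S.run q c := by
    unfold elapsed
    congr 2
    ext s; simp only [mem_ofPred_eq]
    constructor
    · rintro ⟨h1, h2, h3⟩
      refine ⟨h1, ?_, h3⟩
      by_contra hcs
      have := (S.pending s q h3).2.2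
      have h4 := elapsed_mono (run := S.run) q (not_lt.1 hcs)
      linarith
    · rintro ⟨h1, h2, h3⟩; exact ⟨h1, by linarith [hc1.2], h3⟩
  linarith

theorem completion_mem (q : ℕ) (hq : q ∈ I.jobs) :
    0 ≤ S.completion q ∧ I.proc q ≤ elapsed S.run q (S.completion q) := by
  obtain ⟨t, ht⟩ := S.completes q hq
  have hcl : IsClosed {t : ℝ | 0 ≤ t ∧ I.proc q ≤ elapsed S.run q t} :=
    (isClosed_le continuous_const continuous_id).inter
      (isClosed_le continuous_const (continuous_elapsed S.measRun q))
  have hne : {t : ℝ | 0 ≤ t ∧ I.proc q ≤ elapsed S.run q t}.Nonempty :=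
    ⟨max 0 t, le_max_left _ _, ht.trans (elapsed_mono q (le_max_right _ _))⟩
  exact hcl.csInf_mem hne ⟨0, fun x hx => hx.1⟩

theorem completion_le_iff (q : ℕ) (hq : q ∈ I.jobs) (t : ℝ) :
    S.completion q ≤ t ↔ I.proc q ≤ elapsed S.run q t := by
  constructor
  · intro h; exact (S.completion_mem q hq).2.trans (elapsed_mono q h)
  · intro h
    have ht : 0 ≤ t := by
      by_contra h0
      rw [elapsed_eq_zero_of_nonpos _ _ (not_le.1 h0).le] at h
      linarith [I.proc_pos q hq]
    exact csInf_le ⟨0, fun x hx => hx.1⟩ ⟨ht, h⟩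

theorem elapsed_eq_zero_of_le_release (q : ℕ) {t : ℝ} (h : t ≤ I.release q) :
    elapsed S.run q t = 0 := by
  have : {s : ℝ | 0 ≤ s ∧ s < t ∧ S.run s = some q} = ∅ := by
    ext s; simp only [mem_ofPred_eq, mem_empty_iff_false, iff_false]
    rintro ⟨_, h2, h3⟩
    linarith [(S.pending s q h3).2.1]
  simp [elapsed, this]

theorem release_lt_completion (q : ℕ) (hq : q ∈ I.jobs) : I.release q < S.completion q := by
  by_contra h
  have := (S.completion_mem q hq).2
  rw [S.elapsed_eq_zero_of_le_release q (not_lt.1 h)] at this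
  linarith [I.proc_pos q hq]

open Classical in
/-- The jobs that are released and not completed at time `t`. -/
noncomputable def alive (t : ℝ) : Finset ℕ :=
  I.jobs.filter fun q => I.release q ≤ t ∧ elapsed S.run q t < I.proc q

theorem mem_alive {t : ℝ} {q : ℕ} :
    q ∈ S.alive t ↔ q ∈ I.jobs ∧ I.release q ≤ t ∧ elapsed S.run q t < I.proc q := by
  simp [alive]

/-- Total weight of the pending jobs. -/
noncomputable def load (t : ℝ) : ℝ := ∑ q ∈ S.alive t, I.weight q

theorem load_eq (t : ℝ) : S.load t =
    ∑ q ∈ I.jobs, (Ico (I.release q) (S.completion q)).indicator (fun _ => I.weight q) t := by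
  classical
  unfold load alive
  rw [Finset.sum_filter]
  refine Finset.sum_congr rfl fun q hq => ?_
  by_cases h : I.release q ≤ t ∧ elapsed S.run q t < I.proc q
  · rw [if_pos h, indicator_of_mem]
    exact ⟨h.1, not_le.1 fun hc => absurd ((S.completion_le_iff q hq t).1 hc) (not_le.2 h.2)⟩
  · rw [if_neg h, indicator_of_notMem]
    rintro ⟨h1, h2⟩
    exact h ⟨h1, not_le.1 fun hc => absurd ((S.completion_le_iff q hq t).2 hc) (not_le.2 h2)⟩

theorem integrable_load : Integrable S.load := by
  have : S.load = fun t => ∑ q ∈ I.jobs,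
      (Ico (I.release q) (S.completion q)).indicator (fun _ => I.weight q) t := by
    ext t; exact S.load_eq t
  rw [this]
  refine integrable_finsetSum _ fun q _ => ?_
  exact (integrable_indicator_iff measurableSet_Ico).2 (integrableOn_const (by simp))

/-- Each job contributes the integral of its weight over the interval from release to completion. -/
theorem flowTime_eq_integral : S.flowTime = ∫ t, S.load t := by
  simp_rw [S.load_eq]
  rw [integral_finsetSum]
  · unfold flowTime
    refine Finset.sum_congr rfl fun q hq => ?_
    rw [integral_indicator measurableSet_Ico]
    simp [measureReal_def, (S.release_lt_completion q hq).le, mul_comm]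
  · intro q _
    exact (integrable_indicator_iff measurableSet_Ico).2 (integrableOn_const (by simp))

/-- Local competitiveness implies competitiveness. -/
theorem flowTime_le_of_load_le (A : Schedule I) {R : ℝ} (h : ∀ t, 0 ≤ t → A.load t ≤ R * S.load t) :
    A.flowTime ≤ R * S.flowTime := by
  rw [A.flowTime_eq_integral, S.flowTime_eq_integral, ← integral_const_mul]
  refine integral_mono A.integrable_load (S.integrable_load.const_mul R) fun t => ?_
  rcases le_or_gt 0 t with ht | ht
  · exact h t ht
  · have hz : ∀ T : Schedule I, T.load t = 0 := by
      intro T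
      refine Finset.sum_eq_zero fun q hq => ?_
      have := T.mem_alive.1 hq
      linarith [I.release_nonneg q this.1]
    simp [hz]

end Schedule
end FlowTime

/-! ### The schedule determined by a rule -/

namespace FlowTime

open Classical in
/-- The information revealed by an arbitrary run, up to time `t`. -/
noncomputable def runHistory (ρ : ℝ) (I : Instance) (run : ℝ → Option ℕ) (t : ℝ) : History :=
  fun q =>
    if q ∈ I.jobs ∧ I.release q ≤ t then
      some
        { release := I.release q
          weight := I.weight q
          cls := jobClass ρ (I.proc q)
          completedAt := if I.proc q ≤ elapsed run q t then
            some (sInf {u | 0 ≤ u ∧ u ≤ t ∧ I.proc q ≤ elapsed run q u}) else none }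
    else none

/-- `runHistory` takes its infimum over times up to `t` only, so it does not depend on the future
and makes sense for a run still under construction. On a schedule it reveals the same, since the
completion time is attained. -/
theorem Schedule.history_eq (ρ : ℝ) {I : Instance} (S : Schedule I) (t : ℝ) :
    history ρ S t = runHistory ρ I S.run t := by
  classical
  funext q
  unfold history runHistory
  by_cases hq : q ∈ I.jobs ∧ I.release q ≤ t
  · rw [if_pos hq, if_pos hq]
    by_cases hc : S.completion q ≤ t
    · rw [if_pos hc, if_pos ((S.completion_le_iff q hq.1 t).1 hc)]
      congr 3
      have hm := S.completion_mem q hq.1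
      refine le_antisymm (le_csInf ⟨S.completion q, hm.1, hc, hm.2⟩ fun u hu =>
        (S.completion_le_iff q hq.1 u).2 hu.2.2) (csInf_le ⟨0, fun u hu => hu.1⟩ ⟨hm.1, hc, hm.2⟩)
    · rw [if_neg hc, if_neg fun h => hc ((S.completion_le_iff q hq.1 t).2 h)]
  · rw [if_neg hq, if_neg hq]

theorem elapsed_congr {r r' : ℝ → Option ℕ} {T : ℝ} (h : ∀ s, 0 ≤ s → s < T → r s = r' s)
    (q : ℕ) {t : ℝ} (ht : t ≤ T) : elapsed r q t = elapsed r' q t := by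
  unfold elapsed
  congr 2
  ext s
  simp only [mem_ofPred_eq]
  constructor <;> rintro ⟨h1, h2, h3⟩ <;> refine ⟨h1, h2, ?_⟩
  · rw [← h s h1 (by linarith)]; exact h3
  · rw [h s h1 (by linarith)]; exact h3

/-- Two runs that agree before `T` have the same history at `T`, and it stays the same as long as
nothing is released or completed. -/
theorem runHistory_congr (ρ : ℝ) {I : Instance} {r r' : ℝ → Option ℕ} {T s : ℝ} (hTs : T ≤ s)
    (h : ∀ u, 0 ≤ u → u < T → r u = r' u)
    (hrel : ∀ q ∈ I.jobs, I.release q ≤ s → I.release q ≤ T)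
    (hcomp : ∀ q ∈ I.jobs, elapsed r' q T < I.proc q → elapsed r' q s < I.proc q) :
    runHistory ρ I r' s = runHistory ρ I r T := by
  classical
  funext q
  unfold runHistory
  by_cases hq : q ∈ I.jobs ∧ I.release q ≤ T
  · rw [if_pos hq, if_pos ⟨hq.1, hq.2.trans hTs⟩, elapsed_congr h q le_rfl]
    by_cases hc : I.proc q ≤ elapsed r' q T
    · have hcs := hc.trans (elapsed_mono q hTs)
      rw [if_pos hc, if_pos hcs]
      congr 3
      have hT : 0 ≤ T := by
        by_contra h0
        rw [elapsed_eq_zero_of_nonpos _ _ (not_le.1 h0).le] at hc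
        linarith [I.proc_pos q hq.1]
      have hne : {u | 0 ≤ u ∧ u ≤ T ∧ I.proc q ≤ elapsed r q u}.Nonempty :=
        ⟨T, hT, le_rfl, by rw [elapsed_congr h q le_rfl]; exact hc⟩
      refine le_antisymm (le_csInf hne fun u hu => csInf_le ⟨0, fun u hu => hu.1⟩
        ⟨hu.1, hu.2.1.trans hTs, by rw [← elapsed_congr h q hu.2.1]; exact hu.2.2⟩) ?_
      refine le_csInf ⟨s, hT.trans hTs, le_rfl, hcs⟩ fun u hu => ?_
      rcases le_total u T with huT | huT
      · exact csInf_le ⟨0, fun u hu => hu.1⟩ ⟨hu.1, huT, by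
          rw [elapsed_congr h q huT]; exact hu.2.2⟩
      · refine le_trans (csInf_le ⟨0, fun u hu => hu.1⟩ ⟨hT, le_rfl, ?_⟩) huT
        rw [elapsed_congr h q le_rfl]; exact hc
    · rw [if_neg hc, if_neg (not_le.2 (hcomp q hq.1 (not_le.1 hc)))]
  · rw [if_neg hq, if_neg fun h' => hq ⟨h'.1, hrel q h'.1 h'.2⟩]

/-- Job `q` is released and not completed, according to the history `h`. -/
def Pending (h : History) (q : ℕ) : Prop := ∃ i, h q = some i ∧ i.completedAt = none

theorem pending_runHistory {ρ : ℝ} {I : Instance} {r : ℝ → Option ℕ} {t : ℝ} {q : ℕ} :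
    Pending (runHistory ρ I r t) q ↔ q ∈ I.jobs ∧ I.release q ≤ t ∧ elapsed r q t < I.proc q := by
  classical
  unfold Pending runHistory
  by_cases hq : q ∈ I.jobs ∧ I.release q ≤ t
  · simp only [if_pos hq, Option.some.injEq, exists_eq_left']
    by_cases hc : I.proc q ≤ elapsed r q t
    · simp [hc, not_lt.2 hc]
    · simp [hc, hq.1, hq.2, not_le.1 hc]
  · simp only [if_neg hq]
    constructor
    · rintro ⟨i, hi, _⟩; exact absurd hi (by simp)
    · rintro ⟨h1, h2, _⟩; exact absurd ⟨h1, h2⟩ hq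

/-- A rule for choosing the job to run that never chooses a job that is not pending, and never
idles when there is a pending job. -/
structure Rule where
  dec : History → Option ℕ
  pending : ∀ h q, dec h = some q → Pending h q
  busy : ∀ h : History, {q | h q ≠ none}.Finite → (∃ q, Pending h q) → dec h ≠ none

theorem finite_runHistory (ρ : ℝ) (I : Instance) (r : ℝ → Option ℕ) (t : ℝ) :
    {q | runHistory ρ I r t q ≠ none}.Finite := by
  classical
  refine I.jobs.finite_toSet.subset fun q hq => ?_
  by_contra h
  refine hq ?_
  unfold runHistory
  rw [if_neg fun h' => h h'.1]

/-- The run `r` follows the rule up to time `T`. -/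
structure Rule.Good (R : Rule) (ρ : ℝ) (I : Instance) (T : ℝ) (r : ℝ → Option ℕ) : Prop where
  nonneg : 0 ≤ T
  meas : MeasRun r
  idle : ∀ s, s < 0 ∨ T ≤ s → r s = none
  follows : ∀ s, 0 ≤ s → s < T → r s = R.dec (runHistory ρ I r s)

open Classical in
/-- The number of events, releases and completions, that are still to come. -/
noncomputable def remainingEvents (I : Instance) (T : ℝ) (r : ℝ → Option ℕ) : ℕ :=
  (I.jobs.filter fun q => T < I.release q).card +
    (I.jobs.filter fun q => elapsed r q T < I.proc q).card

/-- With no event left nothing is pending after `T`, so the rule idles, as does `r`. -/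
theorem Rule.Good.finish {R : Rule} {ρ : ℝ} {I : Instance} {T : ℝ} {r : ℝ → Option ℕ}
    (h : R.Good ρ I T r) (hno : ∀ q ∈ I.jobs, I.release q ≤ T ∧ I.proc q ≤ elapsed r q T) :
    ∃ S : Schedule I, ∀ t, 0 ≤ t → S.run t = R.dec (history ρ S t) := by
  have hrun : ∀ t q, r t = some q → 0 ≤ t ∧ t < T := by
    intro t q hq
    by_contra hn
    rw [h.idle t (by by_contra h'; push Not at h'; exact hn h')] at hq
    exact absurd hq (by simp)
  refine ⟨⟨r, h.meas, fun t q hq => ?_, fun q hq => ⟨T, (hno q hq).2⟩⟩, fun t ht => ?_⟩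
  · have := hrun t q hq
    rw [h.follows t this.1 this.2] at hq
    exact pending_runHistory.1 (R.pending _ _ hq)
  · rw [Schedule.history_eq]
    change r t = R.dec (runHistory ρ I r t)
    rcases lt_or_ge t T with htT | htT
    · exact h.follows t ht htT
    · rw [h.idle t (Or.inr htT)]
      symm
      by_contra hne
      obtain ⟨q, hq⟩ := Option.ne_none_iff_exists'.1 hne
      have := pending_runHistory.1 (R.pending _ _ hq)
      have h2 := (hno q this.1).2.trans (elapsed_mono (run := r) q htT)
      linarith [this.2.2]

open Classical in
-- No release occurs strictly between `T` and `T'`, and the chosen job cannot finish before `T'`. So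
-- the information, and with it the decision, stays what it was at `T`.
theorem Rule.Good.extend {R : Rule} {ρ : ℝ} {I : Instance} {T : ℝ} {r : ℝ → Option ℕ}
    (h : R.Good ρ I T r) {T' : ℝ} (hT : T < T')
    (hrel : ∀ q ∈ I.jobs, T < I.release q → T' ≤ I.release q)
    (hfin : ∀ q, R.dec (runHistory ρ I r T) = some q → T' ≤ T + (I.proc q - elapsed r q T)) :
    ∃ r', R.Good ρ I T' r' ∧ (∀ q, elapsed r' q T = elapsed r q T) ∧
      ∀ q, R.dec (runHistory ρ I r T) = some q → elapsed r' q T' = elapsed r q T + (T' - T) := by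
  set d := R.dec (runHistory ρ I r T) with hd
  set r' : ℝ → Option ℕ := fun s => if T ≤ s ∧ s < T' then d else r s with hr'
  have hr1 : ∀ s, T ≤ s → s < T' → r' s = d := fun s h1 h2 => if_pos ⟨h1, h2⟩
  have hr2 : ∀ s, s < T → r' s = r s := fun s h1 => if_neg fun h2 => absurd h2.1 (not_le.2 h1)
  have hr3 : ∀ s, T' ≤ s → r' s = r s := fun s h1 => if_neg fun h2 => absurd h2.2 (not_lt.2 h1)
  have hagree : ∀ u, 0 ≤ u → u < T → r u = r' u := fun u _ hu => (hr2 u hu).symm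
  have hmeas : MeasRun r' := by
    intro q
    have : {s | r' s = some q} = (Ico T T' ∩ {_s | d = some q}) ∪ ((Ico T T')ᶜ ∩ {s | r s = some q}) := by
      ext s
      simp only [hr', mem_ofPred_eq, mem_union, mem_inter_iff, mem_Ico, mem_compl_iff]
      by_cases hs : T ≤ s ∧ s < T' <;> simp [hs]
    rw [this]
    exact (measurableSet_Ico.inter (MeasurableSet.const _)).union (measurableSet_Ico.compl.inter (h.meas q))
  have hel : ∀ q, elapsed r' q T = elapsed r q T := fun q => (elapsed_congr hagree q le_rfl).symm
  have hel1 : ∀ q, d = some q → ∀ s, T ≤ s → s ≤ T' → elapsed r' q s = elapsed r q T + (s - T) := by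
    intro q hq s hs1 hs2
    have := sum_elapsed_sub_eq hmeas {q} h.nonneg hs1 fun u h1 h2 =>
      ⟨q, by simp, by rw [hr1 u h1.le (by linarith), hq]⟩
    rw [Finset.sum_singleton, hel] at this
    linarith
  have hel2 : ∀ q, d ≠ some q → ∀ s, T ≤ s → s ≤ T' → elapsed r' q s = elapsed r q T := by
    intro q hq s hs1 hs2
    have := sum_elapsed_sub hmeas {q} h.nonneg hs1
    rw [Finset.sum_singleton, hel] at this
    have h0 : {u : ℝ | T ≤ u ∧ u < s ∧ ∃ q' ∈ ({q} : Finset ℕ), r' u = some q'} = ∅ := by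
      ext u
      simp only [mem_ofPred_eq, mem_empty_iff_false, iff_false]
      rintro ⟨h1, h2, q', hq', h3⟩
      rw [Finset.mem_singleton.1 hq', hr1 u h1 (by linarith)] at h3
      exact hq h3
    rw [h0] at this
    simp at this
    linarith
  refine ⟨r', ⟨h.nonneg.trans hT.le, hmeas, fun s hs => ?_, fun s hs0 hs => ?_⟩, hel,
    fun q hq => hel1 q hq T' hT.le le_rfl⟩
  · rcases hs with hs | hs
    · rw [hr2 s (by linarith [h.nonneg])]; exact h.idle s (Or.inl hs)
    · rw [hr3 s hs]; exact h.idle s (Or.inr (by linarith))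
  · rcases lt_or_ge s T with hsT | hsT
    · rw [hr2 s hsT, h.follows s hs0 hsT]
      rw [runHistory_congr ρ le_rfl (fun u h1 h2 => hagree u h1 (h2.trans hsT)) (fun _ _ h => h)
        fun _ _ h => h]
    · rw [hr1 s hsT hs, hd]
      rw [runHistory_congr ρ hsT hagree]
      · intro q hq hqs
        by_contra hn
        linarith [hrel q hq (not_le.1 hn)]
      · intro q hq hlt
        rw [hel] at hlt
        by_cases hdq : d = some q
        · rw [hel1 q hdq s hsT hs.le]
          linarith [hfin q hdq]
        · rw [hel2 q hdq s hsT hs.le]; exact hlt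

/-- Induction on the number of events to come: the decision at `T` is carried out until the next
release or the completion of the chosen job, which uses up an event. -/
theorem Rule.Good.exists_schedule {R : Rule} {ρ : ℝ} {I : Instance} (n : ℕ) :
    ∀ (T : ℝ) (r : ℝ → Option ℕ), R.Good ρ I T r → remainingEvents I T r = n →
    ∃ S : Schedule I, ∀ t, 0 ≤ t → S.run t = R.dec (history ρ S t) := by
  classical
  induction n using Nat.strong_induction_on with
  | _ n ih =>
  intro T r h hn
  set F := I.jobs.filter fun q => T < I.release q with hF
  have mono1 : ∀ T', T < T' → (I.jobs.filter fun q => T' < I.release q) ⊆ F := by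
    intro T' hT' q hq
    simp only [hF, Finset.mem_filter] at hq ⊢
    exact ⟨hq.1, hT'.trans hq.2⟩
  have mono2 : ∀ T' r', T < T' → (∀ q, elapsed r' q T = elapsed r q T) →
      (I.jobs.filter fun q => elapsed r' q T' < I.proc q) ⊆
        I.jobs.filter fun q => elapsed r q T < I.proc q := by
    intro T' r' hT' hel q hq
    simp only [Finset.mem_filter] at hq ⊢
    exact ⟨hq.1, by rw [← hel]; exact (elapsed_mono q hT'.le).trans_lt hq.2⟩
  have dec_rel : ∀ T' r', T < T' → (∀ q, elapsed r' q T = elapsed r q T) →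
      (∃ q ∈ F, I.release q = T') → remainingEvents I T' r' < n := by
    rintro T' r' hT' hel ⟨q, hq, hqT⟩
    rw [← hn]
    refine add_lt_add_of_lt_of_le (Finset.card_lt_card ⟨mono1 T' hT', fun hs => ?_⟩)
      (Finset.card_le_card (mono2 T' r' hT' hel))
    have := (Finset.mem_filter.1 (hs hq)).2
    linarith
  cases hd : R.dec (runHistory ρ I r T) with
  | none =>
    have hnop : ∀ q ∈ I.jobs, I.release q ≤ T → I.proc q ≤ elapsed r q T := by
      intro q hq hqr
      by_contra hlt
      exact R.busy _ (finite_runHistory ρ I r T) ⟨q, pending_runHistory.2 ⟨hq, hqr, not_le.1 hlt⟩⟩ hd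
    by_cases hFe : F.Nonempty
    · obtain ⟨q0, hq0, hmin⟩ := F.exists_min_image I.release hFe
      have hT : T < I.release q0 := (Finset.mem_filter.1 hq0).2
      obtain ⟨r', hg, hel, -⟩ := h.extend hT
        (fun q hq hqT => hmin q (Finset.mem_filter.2 ⟨hq, hqT⟩)) (by rw [hd]; simp)
      exact ih _ (dec_rel _ r' hT hel ⟨q0, hq0, rfl⟩) _ r' hg rfl
    · refine h.finish fun q hq => ?_
      have : I.release q ≤ T := by
        by_contra hlt
        exact hFe ⟨q, Finset.mem_filter.2 ⟨hq, not_le.1 hlt⟩⟩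
      exact ⟨this, hnop q hq this⟩
  | some q0 =>
    have hp := pending_runHistory.1 (R.pending _ _ hd)
    -- If a release comes no later than the completion, the extension stops at the first release;
    -- otherwise it stops at the completion.
    by_cases hrl : ∃ q ∈ F, I.release q ≤ T + (I.proc q0 - elapsed r q0 T)
    · obtain ⟨q1, hq1, hq1'⟩ := hrl
      obtain ⟨q2, hq2, hmin⟩ := F.exists_min_image I.release ⟨q1, hq1⟩
      have hT : T < I.release q2 := (Finset.mem_filter.1 hq2).2
      obtain ⟨r', hg, hel, -⟩ := h.extend hT
        (fun q hq hqT => hmin q (Finset.mem_filter.2 ⟨hq, hqT⟩)) (by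
          rw [hd]; rintro q hq; cases hq; exact (hmin q1 hq1).trans hq1')
      exact ih _ (dec_rel _ r' hT hel ⟨q2, hq2, rfl⟩) _ r' hg rfl
    · push Not at hrl
      have hT : T < T + (I.proc q0 - elapsed r q0 T) := by linarith [hp.2.2]
      obtain ⟨r', hg, hel, hel'⟩ := h.extend hT
        (fun q hq hqT => (hrl q (Finset.mem_filter.2 ⟨hq, hqT⟩)).le) (by
          rw [hd]; rintro q hq; cases hq; exact le_rfl)
      refine ih _ ?_ _ r' hg rfl
      rw [← hn]
      refine add_lt_add_of_le_of_lt (Finset.card_le_card (mono1 _ hT))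
        (Finset.card_lt_card ⟨mono2 _ r' hT hel, fun hs => ?_⟩)
      have := (Finset.mem_filter.1 (hs (Finset.mem_filter.2 ⟨hp.1, hp.2.2⟩))).2
      rw [hel' q0 hd] at this
      linarith

theorem Rule.exists_schedule (R : Rule) (ρ : ℝ) (I : Instance) :
    ∃ S : Schedule I, ∀ t, 0 ≤ t → S.run t = R.dec (history ρ S t) := by
  refine Rule.Good.exists_schedule _ 0 (fun _ => none)
    ⟨le_rfl, fun q => by simp, fun _ _ => rfl, fun s h1 h2 => by linarith⟩ rfl

/-- The algorithm that follows a rule. -/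
noncomputable def Rule.algorithm (R : Rule) (ρ : ℝ) : SemiclairvoyantAlgorithm ρ where
  decide _ h := R.dec h
  sched I := (R.exists_schedule ρ I).choose
  obeys I t ht := (R.exists_schedule ρ I).choose_spec t ht

/-! ### Comparison of two schedules on a set of jobs -/

/-- How far ahead of `A` the schedule `S` is on the jobs of `J`. -/
noncomputable def lead {I : Instance} (A S : Schedule I) (J : Finset ℕ) (t : ℝ) : ℝ :=
  ∑ q ∈ J, (elapsed S.run q t - elapsed A.run q t)

section lead
variable {I : Instance} {A S : Schedule I} {J : Finset ℕ}

theorem continuous_lead : Continuous (lead A S J) :=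
  continuous_finsetSum _ fun q _ =>
    (continuous_elapsed S.measRun q).sub (continuous_elapsed A.measRun q)

theorem lead_zero : lead A S J 0 = 0 := by
  simp [lead, elapsed_eq_zero_of_nonpos]

/-- `A` works on `J` at full speed, and `S` cannot be faster. -/
theorem lead_le_of_busy {a b : ℝ} (ha : 0 ≤ a) (hab : a ≤ b)
    (hr : ∀ s, a < s → s < b → ∃ q ∈ J, A.run s = some q) : lead A S J b ≤ lead A S J a := by
  have h1 := sum_elapsed_sub_eq A.measRun J ha hab hr
  have h2 := sum_elapsed_sub_le S.measRun J ha hab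
  unfold lead
  simp only [Finset.sum_sub_distrib] at h1 h2 ⊢
  linarith

/-- If `S` is ahead by more than `M` now, it was so at a time when `A` did not work on `J`. -/
theorem exists_lead_gt {M t : ℝ} (hM : 0 ≤ M) (ht : 0 ≤ t) (h : M < lead A S J t) :
    ∃ s, 0 ≤ s ∧ s < t ∧ M < lead A S J s ∧ ¬ ∃ q ∈ J, A.run s = some q := by
  by_contra hcon
  push Not at hcon
  have hcl : IsClosed {s | 0 ≤ s ∧ s ≤ t ∧ lead A S J s ≤ M} :=
    (isClosed_le continuous_const continuous_id).inter
      ((isClosed_le continuous_id continuous_const).inter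
        (isClosed_le continuous_lead continuous_const))
  have hne : {s | 0 ≤ s ∧ s ≤ t ∧ lead A S J s ≤ M}.Nonempty := ⟨0, le_rfl, ht, by rwa [lead_zero]⟩
  have hbdd : BddAbove {s | 0 ≤ s ∧ s ≤ t ∧ lead A S J s ≤ M} := ⟨t, fun s hs => hs.2.1⟩
  have hu := hcl.csSup_mem hne hbdd
  set u := sSup {s | 0 ≤ s ∧ s ≤ t ∧ lead A S J s ≤ M}
  have := lead_le_of_busy (A := A) (S := S) (J := J) hu.1 hu.2.1 fun s h1 h2 =>
    hcon s (hu.1.trans h1.le) h2 (by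
      by_contra hle
      exact absurd (le_csSup hbdd ⟨hu.1.trans h1.le, h2.le, not_lt.1 hle⟩) (not_le.2 h1))
  linarith [hu.2.2]

end lead
end FlowTime

/-! ### The last moment at which a set of jobs was neglected -/

namespace FlowTime

/-- Applied to the finite set of events, this gives event-free intervals on both sides of `u`. -/
theorem exists_gap (E : Finset ℝ) (u : ℝ) : ∃ δ > 0, ∀ e ∈ E, e ≠ u → δ ≤ |e - u| := by
  classical
  induction E using Finset.induction_on with
  | empty => exact ⟨1, one_pos, by simp⟩
  | insert a E _ ih =>
    obtain ⟨δ, hδ, h⟩ := ih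
    by_cases hau : a = u
    · refine ⟨δ, hδ, fun e he hne => ?_⟩
      rcases Finset.mem_insert.1 he with rfl | he
      · exact absurd hau hne
      · exact h e he hne
    · refine ⟨min δ |a - u|, lt_min hδ (abs_pos.2 (sub_ne_zero.2 hau)), fun e he hne => ?_⟩
      rcases Finset.mem_insert.1 he with rfl | he
      · exact min_le_right _ _
      · exact (min_le_left _ _).trans (h e he hne)

section
variable {I : Instance} {A S : Schedule I} {J : Finset ℕ}

theorem Schedule.elapsed_lt_iff (A : Schedule I) {q : ℕ} (hq : q ∈ I.jobs) (t : ℝ) :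
    elapsed A.run q t < I.proc q ↔ t < A.completion q := by
  rw [← not_le, ← not_le, A.completion_le_iff q hq]

/-- Releases and completions. -/
noncomputable def Schedule.events (A : Schedule I) : Finset ℝ := by
  classical exact I.jobs.image I.release ∪ I.jobs.image A.completion

theorem Schedule.release_mem_events (A : Schedule I) {q : ℕ} (hq : q ∈ I.jobs) :
    I.release q ∈ A.events := by
  classical
  exact Finset.mem_union_left _ (Finset.mem_image_of_mem _ hq)

theorem Schedule.completion_mem_events (A : Schedule I) {q : ℕ} (hq : q ∈ I.jobs) :
    A.completion q ∈ A.events := by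
  classical
  exact Finset.mem_union_right _ (Finset.mem_image_of_mem _ hq)

theorem Schedule.history_congr (ρ : ℝ) (A : Schedule I) {a b : ℝ} (hab : a ≤ b)
    (h : ∀ e ∈ A.events, a < e → b < e) : history ρ A b = history ρ A a := by
  rw [A.history_eq, A.history_eq]
  refine runHistory_congr ρ hab (fun _ _ _ => rfl) (fun q hq hqb => ?_) fun q hq hlt => ?_
  · by_contra hn
    linarith [h _ (A.release_mem_events hq) (not_le.1 hn)]
  · rw [A.elapsed_lt_iff hq] at hlt ⊢
    exact h _ (A.completion_mem_events hq) hlt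

/-- The schedule `A` follows the rule `R`. -/
def Schedule.Obeys (ρ : ℝ) (A : Schedule I) (R : Rule) : Prop :=
  ∀ t, 0 ≤ t → A.run t = R.dec (history ρ A t)

theorem Rule.algorithm_obeys (R : Rule) (ρ : ℝ) (I : Instance) :
    ((R.algorithm ρ).sched I).Obeys ρ R := fun t ht => (R.algorithm ρ).obeys I t ht

variable {ρ : ℝ} {R : Rule}

theorem Schedule.Obeys.run_congr (hA : A.Obeys ρ R) {a b : ℝ} (ha : 0 ≤ a) (hab : a ≤ b)
    (h : ∀ e ∈ A.events, a < e → b < e) : A.run b = A.run a := by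
  rw [hA b (ha.trans hab), hA a ha, A.history_congr ρ hab h]

theorem Schedule.mem_alive_of_run (A : Schedule I) {t : ℝ} {q : ℕ}
    (h : A.run t = some q) : q ∈ A.alive t :=
  A.mem_alive.2 (A.pending t q h)

theorem Schedule.pending_history (A : Schedule I) {t : ℝ} {q : ℕ} :
    Pending (history ρ A t) q ↔ q ∈ A.alive t := by
  rw [A.history_eq, pending_runHistory, A.mem_alive]

theorem Schedule.Obeys.alive_eq_empty (hA : A.Obeys ρ R) {t : ℝ} (ht : 0 ≤ t)
    (h : A.run t = none) : A.alive t = ∅ := by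
  rw [Finset.eq_empty_iff_forall_notMem]
  intro q hq
  rw [hA t ht] at h
  refine R.busy _ ?_ ⟨q, A.pending_history.2 hq⟩ h
  rw [A.history_eq]; exact finite_runHistory ρ I A.run t

/-- Work that is left on the jobs of `J`. -/
noncomputable def Schedule.remaining (A : Schedule I) (J : Finset ℕ) (t : ℝ) : ℝ := by
  classical exact ∑ q ∈ J with q ∈ A.alive t, (I.proc q - elapsed A.run q t)

theorem Schedule.remaining_nonneg (A : Schedule I) (J : Finset ℕ) (t : ℝ) :
    0 ≤ A.remaining J t := by
  classical
  refine Finset.sum_nonneg fun q hq => ?_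
  linarith [(A.mem_alive.1 (Finset.mem_filter.1 hq).2).2.2]

/-- For released jobs the processing times cancel; unreleased jobs contribute nothing to either
side. -/
theorem lead_eq (hJ : J ⊆ I.jobs) (t : ℝ) :
    lead A S J t = A.remaining J t - S.remaining J t := by
  classical
  have key : ∀ T : Schedule I, T.remaining J t =
      ∑ q ∈ J, if I.release q ≤ t then I.proc q - elapsed T.run q t else 0 := by
    intro T
    unfold Schedule.remaining
    rw [Finset.sum_filter]
    refine Finset.sum_congr rfl fun q hq => ?_
    have h1 := T.elapsed_le q (hJ hq) t
    by_cases hr : I.release q ≤ t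
    · by_cases hl : elapsed T.run q t < I.proc q
      · rw [if_pos hr, if_pos (T.mem_alive.2 ⟨hJ hq, hr, hl⟩)]
      · rw [if_pos hr, if_neg fun h => hl (T.mem_alive.1 h).2.2]; linarith
    · rw [if_neg hr, if_neg fun h => hr (T.mem_alive.1 h).2.1]
  rw [key, key, ← Finset.sum_sub_distrib]
  refine Finset.sum_congr rfl fun q hq => ?_
  by_cases hr : I.release q ≤ t
  · simp only [if_pos hr]; ring
  · have hle := (not_le.1 hr).le
    simp only [if_neg hr, S.elapsed_eq_zero_of_le_release q hle,
      A.elapsed_eq_zero_of_le_release q hle]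

theorem lead_le_remaining (hJ : J ⊆ I.jobs) (t : ℝ) : lead A S J t ≤ A.remaining J t := by
  rw [lead_eq hJ]; linarith [S.remaining_nonneg J t]

/-- If `S` is ahead by more than `M` now, it was so at the end of the last period in which `A` did
not work on `J`. -/
theorem Schedule.Obeys.exists_last_lead_gt (hA : A.Obeys ρ R) (hJ : J ⊆ I.jobs) {M t : ℝ}
    (hM : 0 ≤ M) (ht : 0 ≤ t) (h : M < lead A S J t) :
    ∃ s j, 0 ≤ s ∧ s < t ∧ M < lead A S J s ∧ A.run s = some j ∧ j ∉ J ∧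
      ∀ s', s < s' → s' < t → (∃ q ∈ J, A.run s' = some q) ∨ A.run s' = some j := by
  classical
  set Bd := {s | 0 ≤ s ∧ s < t ∧ ¬ ∃ q ∈ J, A.run s = some q} with hBd
  have hne : Bd.Nonempty := by
    obtain ⟨s, h1, h2, -, h4⟩ := exists_lead_gt hM ht h
    exact ⟨s, h1, h2, h4⟩
  have hbdd : BddAbove Bd := ⟨t, fun s hs => hs.2.1.le⟩
  set u := sSup Bd with hu
  have hut : u ≤ t := csSup_le hne fun s hs => hs.2.1.le
  have hu0 : 0 ≤ u := hne.some_mem.1.trans (le_csSup hbdd hne.some_mem)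
  have hafter : ∀ s, u < s → s < t → ∃ q ∈ J, A.run s = some q := by
    intro s h1 h2
    by_contra hb
    linarith [le_csSup hbdd (show s ∈ Bd from ⟨hu0.trans h1.le, h2, hb⟩)]
  have hlu : M < lead A S J u := h.trans_le (lead_le_of_busy hu0 hut hafter)
  obtain ⟨δ, hδ, hgap⟩ := exists_gap A.events u
  -- A decision persists to the right until the next event, so neglect at `u` would continue beyond
  -- `u`.
  have huB : u ∉ Bd := by
    intro hub
    set v := min ((u + t) / 2) (u + δ / 2)
    have hv1 : u < v := lt_min (by linarith [hub.2.1]) (by linarith)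
    have hv2 : v < t := (min_le_left _ _).trans_lt (by linarith [hub.2.1])
    have hv3 : v < u + δ := (min_le_right _ _).trans_lt (by linarith)
    have hc := hA.run_congr hu0 hv1.le fun e he hue => by
      have := hgap e he hue.ne'
      rw [abs_of_pos (by linarith)] at this
      linarith
    obtain ⟨q, hq, hq'⟩ := hafter v hv1 hv2
    exact hub.2.2 ⟨q, hq, by rw [← hc]; exact hq'⟩
  have hev : ∀ᶠ s in nhds u, M < lead A S J s :=
    (continuous_lead.tendsto u).eventually (lt_mem_nhds hlu)
  obtain ⟨ε, hε, hball⟩ := Metric.eventually_nhds_iff.1 hev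
  have hlt : max (u - δ) (u - ε) < u := max_lt (by linarith) (by linarith)
  -- Hence `u` is a limit of moments of neglect from the left. Close to `u` the lead still exceeds
  -- `M` by continuity, and no event separates `s` from `u`.
  obtain ⟨s, hsB, hs1⟩ := exists_lt_of_lt_csSup hne hlt
  have hsu : s < u := lt_of_le_of_ne (le_csSup hbdd hsB) fun h' => huB (h' ▸ hsB)
  have hs2 : u - δ < s := (le_max_left _ _).trans_lt hs1
  have hs3 : u - ε < s := (le_max_right _ _).trans_lt hs1
  have hls : M < lead A S J s := hball (by rw [Real.dist_eq, abs_sub_comm, abs_of_pos] <;> linarith)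
  have hconst : ∀ s', s < s' → s' < u → A.run s' = A.run s := fun s' h1 h2 =>
    hA.run_congr hsB.1 h1.le fun e he hse => by
      by_cases heu : e = u
      · rw [heu]; exact h2
      · have := hgap e he heu
        rcases lt_abs.1 (show δ / 2 < |e - u| by linarith) with h3 | h3
        · linarith
        · rw [abs_of_neg (by linarith)] at this; linarith
  cases hrun : A.run s with
  | none =>
    -- An idle machine has nothing pending, so `S` could not be ahead.
    have := lead_le_remaining (A := A) (S := S) hJ s
    unfold Schedule.remaining at this
    rw [hA.alive_eq_empty hsB.1 hrun] at this
    simp at this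
    linarith
  | some j =>
    refine ⟨s, j, hsB.1, hsu.trans_le hut, hls, hrun, fun hj => hsB.2.2 ⟨j, hj, hrun⟩,
      fun s' h1 h2 => ?_⟩
    rcases lt_trichotomy s' u with h3 | h3 | h3
    · right; rw [hconst s' h1 h3, hrun]
    · left
      by_contra hb
      exact huB ⟨hu0, h3 ▸ h2, h3 ▸ hb⟩
    · exact Or.inl (hafter s' h3 h2)

theorem Schedule.alive_of_not_run (A : Schedule I) {q : ℕ} {s t : ℝ} (hs : 0 ≤ s) (hst : s ≤ t)
    (hq : q ∈ A.alive s) (h : ∀ s', s ≤ s' → s' < t → A.run s' ≠ some q) : q ∈ A.alive t := by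
  have hq' := A.mem_alive.1 hq
  have := sum_elapsed_sub A.measRun {q} hs hst
  have h0 : {u : ℝ | s ≤ u ∧ u < t ∧ ∃ q' ∈ ({q} : Finset ℕ), A.run u = some q'} = ∅ := by
    ext u
    simp only [mem_ofPred_eq, mem_empty_iff_false, iff_false]
    rintro ⟨h1, h2, q', hq', h3⟩
    rw [Finset.mem_singleton.1 hq'] at h3
    exact h u h1 h2 h3
  rw [h0] at this
  simp at this
  exact A.mem_alive.2 ⟨hq'.1, hq'.2.1.trans hst, by linarith [hq'.2.2]⟩

theorem Schedule.alive_mono (A : Schedule I) {q : ℕ} {s t : ℝ} (hst : s ≤ t)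
    (hq : q ∈ A.alive t) (hr : I.release q ≤ s) : q ∈ A.alive s := by
  have hq' := A.mem_alive.1 hq
  exact A.mem_alive.2 ⟨hq'.1, hr, (elapsed_mono q hst).trans_lt hq'.2.2⟩

theorem Schedule.exists_run_of_elapsed_pos (A : Schedule I) {q : ℕ} {t : ℝ}
    (h : 0 < elapsed A.run q t) : ∃ s, 0 ≤ s ∧ s < t ∧ A.run s = some q := by
  by_contra hn
  push Not at hn
  have h0 : {s : ℝ | 0 ≤ s ∧ s < t ∧ A.run s = some q} = ∅ := by
    ext u
    simp only [mem_ofPred_eq, mem_empty_iff_false, iff_false]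
    rintro ⟨h1, h2, h3⟩
    exact hn u h1 h2 h3
  simp [elapsed, h0] at h

/-! ### Rules that pick a pending job with the largest key -/

open Classical in
/-- Run the pending job with the largest key. -/
noncomputable def Rule.ofKey {α : Type*} [LinearOrder α] (key : History → ℕ → α) : Rule where
  dec h := if H : {q | h q ≠ none}.Finite ∧ ∃ q, Pending h q then
      some (Finset.exists_max_image (H.1.toFinset.filter (Pending h)) (key h) (by
        obtain ⟨q, i, hi, hi'⟩ := H.2
        exact ⟨q, by simp [hi, show Pending h q from ⟨i, hi, hi'⟩]⟩)).choose
    else none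
  pending h q hq := by
    split_ifs at hq with H
    have h1 := (Finset.exists_max_image (H.1.toFinset.filter (Pending h)) (key h) (by
        obtain ⟨q, i, hi, hi'⟩ := H.2
        exact ⟨q, by simp [hi, show Pending h q from ⟨i, hi, hi'⟩]⟩)).choose_spec
    rw [Option.some.inj hq] at h1
    exact (Finset.mem_filter.1 h1.1).2
  busy h h1 h2 := by
    rw [dif_pos ⟨h1, h2⟩]; simp

theorem Rule.ofKey_le {α : Type*} [LinearOrder α] (key : History → ℕ → α) {h : History} {q : ℕ}
    (hq : (Rule.ofKey key).dec h = some q) {q' : ℕ} (hq' : Pending h q') : key h q' ≤ key h q := by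
  classical
  unfold Rule.ofKey at hq
  simp only at hq
  split_ifs at hq with H
  have h1 := (Finset.exists_max_image (H.1.toFinset.filter (Pending h)) (key h) (by
        obtain ⟨q, i, hi, hi'⟩ := H.2
        exact ⟨q, by simp [hi, show Pending h q from ⟨i, hi, hi'⟩]⟩)).choose_spec
  rw [Option.some.inj hq] at h1
  refine h1.2 q' (Finset.mem_filter.2 ⟨?_, hq'⟩)
  obtain ⟨i, hi, _⟩ := hq'
  simp [hi]

end
end FlowTime

namespace FlowTime

/-! ### Geometric classes -/

theorem le_jobClass {ρ x : ℝ} (hρ : 1 < ρ) (hx : 0 < x) (n : ℤ) : n ≤ jobClass ρ x ↔ ρ ^ n ≤ x := by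
  unfold jobClass
  rw [Int.le_floor, Real.le_logb_iff_rpow_le hρ hx, Real.rpow_intCast]

theorem jobClass_lt {ρ x : ℝ} (hρ : 1 < ρ) (hx : 0 < x) (n : ℤ) : jobClass ρ x < n ↔ x < ρ ^ n := by
  rw [← not_le, ← not_le, le_jobClass hρ hx]

/-- The class with respect to the base `ρ ^ b`. -/
noncomputable def level (ρ : ℝ) (b : ℤ) (x : ℝ) : ℤ := jobClass ρ x / b

theorem le_level {ρ x : ℝ} {b : ℤ} (hρ : 1 < ρ) (hb : 0 < b) (hx : 0 < x) (n : ℤ) :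
    n ≤ level ρ b x ↔ ρ ^ (b * n) ≤ x := by
  unfold level
  rw [Int.le_ediv_iff_mul_le hb, ← le_jobClass hρ hx, mul_comm]

theorem level_lt {ρ x : ℝ} {b : ℤ} (hρ : 1 < ρ) (hb : 0 < b) (hx : 0 < x) (n : ℤ) :
    level ρ b x < n ↔ x < ρ ^ (b * n) := by
  rw [← not_le, ← not_le, le_level hρ hb hx]

theorem sum_zpow_le {ρ : ℝ} (hρ : 1 < ρ) (T : Finset ℤ) :
    ∀ m : ℤ, (∀ k ∈ T, k ≤ m) → ∑ k ∈ T, ρ ^ k ≤ ρ / (ρ - 1) * ρ ^ m := by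
  have h0 : 0 < ρ - 1 := by linarith
  induction hn : T.card using Nat.strong_induction_on generalizing T with
  | _ n ih =>
  intro m hm
  rcases T.eq_empty_or_nonempty with rfl | hne
  · simp only [Finset.sum_empty]; positivity
  · have hmem := T.max'_mem hne
    set m' := T.max' hne
    have h1 := ih _ (by rw [← hn]; exact Finset.card_erase_lt_of_mem hmem) (T.erase m') rfl (m' - 1)
      fun k hk => by
        have h2 := T.le_max' k (Finset.mem_of_mem_erase hk)
        have h3 := Finset.ne_of_mem_erase hk
        omega
    rw [← Finset.add_sum_erase T _ hmem]
    have h2 : ρ ^ m' ≤ ρ ^ m := zpow_le_zpow_right₀ hρ.le (hm m' hmem)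
    have h3 : ρ ^ (m' - 1) = ρ ^ m' / ρ := by rw [zpow_sub_one₀ (by linarith)]; rfl
    rw [h3] at h1
    calc ρ ^ m' + ∑ k ∈ T.erase m', ρ ^ k ≤ ρ ^ m' + ρ / (ρ - 1) * (ρ ^ m' / ρ) := by linarith
      _ = ρ / (ρ - 1) * ρ ^ m' := by field_simp; ring
      _ ≤ _ := by gcongr

theorem sum_zpow_neg_le {ρ : ℝ} (hρ : 1 < ρ) (T : Finset ℤ) (m : ℤ) (h : ∀ k ∈ T, m ≤ k) :
    ∑ k ∈ T, ρ ^ (-k) ≤ ρ / (ρ - 1) * ρ ^ (-m) := by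
  classical
  have := sum_zpow_le hρ (T.image fun k => -k) (-m) fun k hk => by
    obtain ⟨k', hk', rfl⟩ := Finset.mem_image.1 hk
    exact neg_le_neg (h k' hk')
  rwa [Finset.sum_image fun a _ b _ hab => neg_injective hab] at this

/-- A sum over bins of bounded weight, geometrically discounted. -/
theorem sum_discounted_le {ρ : ℝ} (hρ : 1 < ρ) (F : Finset ℕ) (K : ℕ → ℤ) (f : ℕ → ℝ) {M : ℝ}
    (m : ℤ) (hM : 0 ≤ M) (hm : ∀ q ∈ F, m ≤ K q)
    (hf : ∀ k, m ≤ k → ∑ q ∈ F with K q = k, f q ≤ M) :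
    ∑ q ∈ F, ρ ^ (-K q) * f q ≤ M * (ρ / (ρ - 1) * ρ ^ (-m)) := by
  classical
  rw [← Finset.sum_fiberwise_of_maps_to (t := F.image K) fun q hq => Finset.mem_image_of_mem K hq]
  calc ∑ k ∈ F.image K, ∑ q ∈ F with K q = k, ρ ^ (-K q) * f q
      ≤ ∑ k ∈ F.image K, ρ ^ (-k) * M := by
        refine Finset.sum_le_sum fun k hk => ?_
        obtain ⟨q0, hq0, rfl⟩ := Finset.mem_image.1 hk
        rw [Finset.sum_congr rfl fun q hq => by rw [(Finset.mem_filter.1 hq).2], ← Finset.mul_sum]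
        have : (0:ℝ) ≤ ρ ^ (-K q0) := by positivity
        exact mul_le_mul_of_nonneg_left (hf _ (hm q0 hq0)) this
    _ = M * ∑ k ∈ F.image K, ρ ^ (-k) := by rw [← Finset.sum_mul, mul_comm]
    _ ≤ _ := by
        refine mul_le_mul_of_nonneg_left (sum_zpow_neg_le hρ _ _ fun k hk => ?_) hM
        obtain ⟨q0, hq0, rfl⟩ := Finset.mem_image.1 hk
        exact hm q0 hq0

theorem card_le_of_spread (T : Finset ℤ) {X : ℝ} (hX : 0 ≤ X)
    (h : ∀ k ∈ T, ∀ k' ∈ T, ((k - k' : ℤ) : ℝ) ≤ X) : (T.card : ℝ) ≤ X + 1 := by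
  rcases T.eq_empty_or_nonempty with rfl | hne
  · simp; linarith
  · have hsub : T ⊆ Finset.Icc (T.min' hne) (T.max' hne) := fun k hk =>
      Finset.mem_Icc.2 ⟨T.min'_le k hk, T.le_max' k hk⟩
    have h1 := Finset.card_le_card hsub
    rw [Int.card_Icc] at h1
    have h2 := h _ (T.max'_mem hne) _ (T.min'_mem hne)
    have h3 : T.min' hne ≤ T.max' hne := T.min'_le _ (T.max'_mem hne)
    have h4 : (T.card : ℤ) ≤ T.max' hne + 1 - T.min' hne := by omega
    have h5 : (T.card : ℝ) ≤ ((T.max' hne + 1 - T.min' hne : ℤ) : ℝ) := by exact_mod_cast h4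
    push_cast at h5 h2
    linarith

/-! ### Jobs in density bins -/

namespace Instance
variable (I : Instance) (ρ : ℝ) (b : ℤ)

/-- The density class of a job. -/
noncomputable def bin (q : ℕ) : ℤ := jobClass ρ (I.weight q) - jobClass ρ (I.proc q)

variable {I ρ}

/-- The bin fixes the density up to a factor `ρ` in each direction. This lemma and the next one
convert between weight and volume. -/
theorem weight_le_proc (hρ : 1 < ρ) {q : ℕ} (hq : q ∈ I.jobs) :
    I.weight q ≤ ρ ^ (I.bin ρ q + 1) * I.proc q := by
  have h1 := (jobClass_lt hρ (I.weight_pos q hq) _).1 (Int.lt_add_one_iff.2 le_rfl)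
  have h2 := (le_jobClass hρ (I.proc_pos q hq) _).1 le_rfl
  have h3 : ρ ^ (jobClass ρ (I.weight q) + 1) = ρ ^ (I.bin ρ q + 1) * ρ ^ jobClass ρ (I.proc q) := by
    rw [← zpow_add₀ (by linarith)]; congr 1; unfold bin; ring
  have h4 : (0:ℝ) < ρ ^ (I.bin ρ q + 1) := by positivity
  nlinarith

theorem proc_le_weight (hρ : 1 < ρ) {q : ℕ} (hq : q ∈ I.jobs) :
    I.proc q ≤ ρ * (ρ ^ (-I.bin ρ q) * I.weight q) := by
  have h1 := (jobClass_lt hρ (I.proc_pos q hq) _).1 (Int.lt_add_one_iff.2 le_rfl)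
  have h2 := (le_jobClass hρ (I.weight_pos q hq) _).1 le_rfl
  have h3 : ρ ^ (jobClass ρ (I.proc q) + 1) =
      ρ * (ρ ^ (-I.bin ρ q) * ρ ^ jobClass ρ (I.weight q)) := by
    rw [← zpow_add₀ (by linarith), ← zpow_one_add₀ (by linarith)]; congr 1; unfold bin; ring
  have h4 : (0:ℝ) < ρ ^ (-I.bin ρ q) := by positivity
  rw [h3] at h1
  refine h1.le.trans ?_
  gcongr

/-- The weight level of a job. -/
noncomputable def lev (I : Instance) (ρ : ℝ) (b : ℤ) (q : ℕ) : ℤ := level ρ b (I.weight q)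

end Instance

/-! ### The rule -/

namespace DensityBins
variable (ρ : ℝ) (b : ℤ)

noncomputable def infoBin (i : JobInfo) : ℤ := jobClass ρ i.weight - i.cls
noncomputable def infoLev (i : JobInfo) : ℤ := level ρ b i.weight

variable (h : History)

/-- The pending jobs of a bin. -/
def pendingIn (k : ℤ) : Set ℕ := {q | Pending h q ∧ (h q).elim 0 (infoBin ρ) = k}

noncomputable def binWeight (k : ℤ) : ℝ := ∑ᶠ q ∈ pendingIn ρ h k, (h q).elim 0 JobInfo.weight

noncomputable def binLevel (k : ℤ) : ℤ :=
  sSup ((fun q => (h q).elim 0 (infoLev ρ b)) '' pendingIn ρ h k)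

/-- The largest class of a job released so far. -/
noncomputable def top : ℤ := sSup ((fun q => (h q).elim 0 JobInfo.cls) '' {q | h q ≠ none})

/-- A released job of bin `k` has weight class at most `k + top h`, hence level at most the
quotient; the 4 leaves room for the 2 in `score`. The truncation keeps the weight scale of a bin
within a constant factor of `ρ ^ (k + top h)`, so that the sparse bins form a geometric series. -/
noncomputable def cap (k : ℤ) : ℤ := (k + top h) / b + 4

noncomputable def score (k : ℤ) : ℤ :=
  min (max (level ρ b (binWeight ρ h k)) (binLevel ρ b h k + 2)) (cap b h k)

/-- The order of preference: largest score of the bin, densest bin, largest weight level, and then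
first come first served. -/
noncomputable def key (q : ℕ) : ℤ ×ₗ ℤ ×ₗ ℤ ×ₗ ℝᵒᵈ ×ₗ ℕᵒᵈ :=
  toLex (score ρ b h ((h q).elim 0 (infoBin ρ)), toLex ((h q).elim 0 (infoBin ρ),
    toLex ((h q).elim 0 (infoLev ρ b), toLex (OrderDual.toDual ((h q).elim 0 JobInfo.release),
      OrderDual.toDual q))))

noncomputable def rule : Rule := Rule.ofKey (key ρ b)

variable {ρ b} {I : Instance} {A S : Schedule I}

theorem history_of_alive {t : ℝ} {q : ℕ} (hq : q ∈ A.alive t) : history ρ A t q =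
    some ⟨I.release q, I.weight q, jobClass ρ (I.proc q), none⟩ := by
  classical
  have h := A.mem_alive.1 hq
  unfold history
  rw [if_pos ⟨h.1, h.2.1⟩, if_neg (not_le.2 ((A.elapsed_lt_iff h.1 t).1 h.2.2))]

/-- The pending jobs of a bin. -/
noncomputable def aliveIn (ρ : ℝ) (A : Schedule I) (t : ℝ) (k : ℤ) : Finset ℕ :=
  {q ∈ A.alive t | I.bin ρ q = k}

theorem mem_aliveIn {t : ℝ} {k : ℤ} {q : ℕ} :
    q ∈ aliveIn ρ A t k ↔ q ∈ A.alive t ∧ I.bin ρ q = k := Finset.mem_filter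

theorem pendingIn_history (t : ℝ) (k : ℤ) : pendingIn ρ (history ρ A t) k = aliveIn ρ A t k := by
  ext q
  simp only [pendingIn, mem_ofPred_eq, A.pending_history, Finset.mem_coe, mem_aliveIn]
  refine and_congr_right fun hq => ?_
  rw [history_of_alive hq]
  rfl

/-- The pending weight of a bin. -/
noncomputable def wt (ρ : ℝ) (A : Schedule I) (t : ℝ) (k : ℤ) : ℝ := ∑ q ∈ aliveIn ρ A t k, I.weight q

theorem binWeight_history (t : ℝ) (k : ℤ) : binWeight ρ (history ρ A t) k = wt ρ A t k := by
  unfold binWeight wt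
  rw [pendingIn_history]
  simp only [Finset.mem_coe]
  rw [finsum_mem_finset_eq_sum]
  refine Finset.sum_congr rfl fun q hq => ?_
  rw [history_of_alive (mem_aliveIn.1 hq).1]
  rfl

theorem wt_pos {t : ℝ} {q : ℕ} (hq : q ∈ A.alive t) : 0 < wt ρ A t (I.bin ρ q) :=
  Finset.sum_pos (fun q hq => I.weight_pos q (A.mem_alive.1 (mem_aliveIn.1 hq).1).1)
    ⟨q, mem_aliveIn.2 ⟨hq, rfl⟩⟩

theorem image_lev_history (t : ℝ) (k : ℤ) :
    (fun q => (history ρ A t q).elim 0 (infoLev ρ b)) '' pendingIn ρ (history ρ A t) k =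
      I.lev ρ b '' (aliveIn ρ A t k : Set ℕ) := by
  rw [pendingIn_history]
  refine Set.image_congr fun q hq => ?_
  rw [history_of_alive (mem_aliveIn.1 (Finset.mem_coe.1 hq)).1]
  rfl

theorem lev_le_binLevel {t : ℝ} {q : ℕ} (hq : q ∈ A.alive t) :
    I.lev ρ b q ≤ binLevel ρ b (history ρ A t) (I.bin ρ q) := by
  unfold binLevel
  rw [image_lev_history]
  exact le_csSup ((Finset.finite_toSet _).image _).bddAbove
    ⟨q, Finset.mem_coe.2 (mem_aliveIn.2 ⟨hq, rfl⟩), rfl⟩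

theorem binLevel_le {t : ℝ} {q : ℕ} (hq : q ∈ A.alive t) {m : ℤ}
    (h : ∀ q' ∈ A.alive t, I.bin ρ q' = I.bin ρ q → I.lev ρ b q' ≤ m) :
    binLevel ρ b (history ρ A t) (I.bin ρ q) ≤ m := by
  unfold binLevel
  rw [image_lev_history]
  refine csSup_le ⟨_, q, Finset.mem_coe.2 (mem_aliveIn.2 ⟨hq, rfl⟩), rfl⟩ ?_
  rintro _ ⟨q', hq', rfl⟩
  have := mem_aliveIn.1 (Finset.mem_coe.1 hq')
  exact h q' this.1 this.2

theorem image_cls_history (t : ℝ) :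
    (fun q => (history ρ A t q).elim 0 JobInfo.cls) '' {q | history ρ A t q ≠ none} =
      (fun q => jobClass ρ (I.proc q)) '' {q | q ∈ I.jobs ∧ I.release q ≤ t} := by
  classical
  have : {q | history ρ A t q ≠ none} = {q | q ∈ I.jobs ∧ I.release q ≤ t} := by
    ext q
    simp only [mem_ofPred_eq, history]
    by_cases h : q ∈ I.jobs ∧ I.release q ≤ t <;> simp [h]
  rw [this]
  refine Set.image_congr fun q hq => ?_
  simp only [history, if_pos (show q ∈ I.jobs ∧ I.release q ≤ t from hq), Option.elim]

theorem finite_cls (I : Instance) (ρ t : ℝ) :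
    ((fun q => jobClass ρ (I.proc q)) '' {q | q ∈ I.jobs ∧ I.release q ≤ t}).Finite :=
  (I.jobs.finite_toSet.subset fun _ hq => hq.1).image _

theorem cls_le_top {t : ℝ} {q : ℕ} (hq : q ∈ I.jobs) (hr : I.release q ≤ t) :
    jobClass ρ (I.proc q) ≤ top (history ρ A t) := by
  unfold top
  rw [image_cls_history]
  exact le_csSup (finite_cls I ρ t).bddAbove ⟨q, ⟨hq, hr⟩, rfl⟩

theorem exists_top {t : ℝ} {q : ℕ} (hq : q ∈ I.jobs) (hr : I.release q ≤ t) :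
    ∃ q' ∈ I.jobs, I.release q' ≤ t ∧ jobClass ρ (I.proc q') = top (history ρ A t) := by
  have h := Int.csSup_mem (s := (fun q => jobClass ρ (I.proc q)) '' {q | q ∈ I.jobs ∧ I.release q ≤ t})
    ⟨_, q, ⟨hq, hr⟩, rfl⟩ (finite_cls I ρ t).bddAbove
  unfold top
  rw [image_cls_history]
  obtain ⟨q', hq', h⟩ := h
  exact ⟨q', hq'.1, hq'.2, h⟩

/-- `top` grows with new releases. Some job has to be released by time `s`, since the supremum of
the empty set has a default value. -/
theorem cap_mono (hb : 0 < b) {s t : ℝ} (hst : s ≤ t) {q : ℕ} (hq : q ∈ I.jobs)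
    (hr : I.release q ≤ s) (k : ℤ) : cap b (history ρ A s) k ≤ cap b (history ρ A t) k := by
  obtain ⟨q', hq', hr', h⟩ := exists_top (ρ := ρ) (A := A) hq hr
  have := cls_le_top (ρ := ρ) (A := A) hq' (hr'.trans hst)
  unfold cap
  have := Int.ediv_le_ediv hb (show k + top (history ρ A s) ≤ k + top (history ρ A t) by omega)
  omega

theorem cap_mono_bin (hb : 0 < b) (h : History) {k k' : ℤ} (hk : k ≤ k') : cap b h k ≤ cap b h k' := by
  unfold cap
  have := Int.ediv_le_ediv hb (show k + top h ≤ k' + top h by omega)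
  omega

theorem lev_le_cap (hb : 0 < b) {t : ℝ} {q : ℕ} (hq : q ∈ A.alive t) :
    I.lev ρ b q + 4 ≤ cap b (history ρ A t) (I.bin ρ q) := by
  have h := A.mem_alive.1 hq
  have h1 := cls_le_top (ρ := ρ) (A := A) h.1 h.2.1
  unfold cap Instance.lev level
  have := Int.ediv_le_ediv hb (show jobClass ρ (I.weight q) ≤ I.bin ρ q + top (history ρ A t) by
    unfold Instance.bin; omega)
  omega

/-- What it means that `j` is run. -/
theorem run_spec (hA : A.Obeys ρ (rule ρ b)) {t : ℝ} (ht : 0 ≤ t) {j q : ℕ} (hj : A.run t = some j)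
    (hq : q ∈ A.alive t) :
    (score ρ b (history ρ A t) (I.bin ρ q) < score ρ b (history ρ A t) (I.bin ρ j) ∨
      score ρ b (history ρ A t) (I.bin ρ q) = score ρ b (history ρ A t) (I.bin ρ j) ∧
        (I.bin ρ q < I.bin ρ j ∨ I.bin ρ q = I.bin ρ j ∧ 
          (I.lev ρ b q < I.lev ρ b j ∨ I.lev ρ b q = I.lev ρ b j ∧
            (I.release j < I.release q ∨ I.release q = I.release j ∧ j ≤ q)))) := by
  have hj' := A.mem_alive_of_run hj
  rw [hA t ht] at hj
  have hk := Rule.ofKey_le (key ρ b) hj (A.pending_history.2 hq)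
  unfold key at hk
  rw [history_of_alive hq, history_of_alive hj'] at hk
  simp only [Option.elim, Prod.Lex.toLex_le_toLex] at hk
  exact hk

end DensityBins
end FlowTime

/-! ### Density bins: no large jobs, and light bins where the cap is large -/

namespace FlowTime
namespace DensityBins

variable {ρ : ℝ} {b : ℤ} {I : Instance} {A S : Schedule I}

/-- A score below the cap is not truncated, so it is at least the level of the bin weight. -/
theorem wt_lt_of_score_lt (hρ : 1 < ρ) (hb : 0 < b) {t : ℝ} {q : ℕ} (hq : q ∈ A.alive t) {σ : ℤ}
    (h : score ρ b (history ρ A t) (I.bin ρ q) < σ) (hc : σ ≤ cap b (history ρ A t) (I.bin ρ q)) :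
    wt ρ A t (I.bin ρ q) < ρ ^ (b * σ) := by
  rw [← level_lt hρ hb (wt_pos hq), ← binWeight_history]
  unfold score at h
  omega

/-- If a job of a small level is run while a job of a large level is pending, or if the score of
its bin is large, then its bin is heavy. -/
theorem heavy_of_score (hρ : 1 < ρ) (hb : 0 < b) (hA : A.Obeys ρ (rule ρ b)) {t : ℝ} (ht : 0 ≤ t)
    {j : ℕ} (hj : A.run t = some j) {y : ℤ} (hy : I.lev ρ b j < y)
    (hs : y + 2 ≤ score ρ b (history ρ A t) (I.bin ρ j)) :
    (∀ q ∈ A.alive t, I.bin ρ q = I.bin ρ j → I.lev ρ b q < y) ∧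
    ρ ^ (b * (y + 2)) ≤ wt ρ A t (I.bin ρ j) ∧ y + 2 ≤ cap b (history ρ A t) (I.bin ρ j) := by
  have hj' := A.mem_alive_of_run hj
  -- `j` has the highest level of its bin. So the level term of the score is below `y + 2`, and only
  -- the weight of the bin can explain the score.
  have h1 : ∀ q ∈ A.alive t, I.bin ρ q = I.bin ρ j → I.lev ρ b q ≤ I.lev ρ b j := by
    intro q hq hqj
    have := run_spec hA ht hj hq
    rw [hqj] at this
    omega
  have h2 := binLevel_le hj' h1
  refine ⟨fun q hq hqj => (h1 q hq hqj).trans_lt hy, ?_⟩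
  rw [← le_level hρ hb (wt_pos hj'), ← binWeight_history]
  unfold score at hs
  omega

theorem score_ge (hb : 0 < b) {t : ℝ} {q : ℕ} (hq : q ∈ A.alive t) :
    I.lev ρ b q + 2 ≤ score ρ b (history ρ A t) (I.bin ρ q) := by
  have h1 := lev_le_cap (ρ := ρ) hb hq
  have h2 := lev_le_binLevel (ρ := ρ) (b := b) hq
  unfold score
  omega

theorem score_le_run (hA : A.Obeys ρ (rule ρ b)) {t : ℝ} (ht : 0 ≤ t) {j q : ℕ}
    (hj : A.run t = some j) (hq : q ∈ A.alive t) :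
    score ρ b (history ρ A t) (I.bin ρ q) ≤ score ρ b (history ρ A t) (I.bin ρ j) := by
  have := run_spec hA ht hj hq
  omega

/-- Ties go to the denser bin, so a nonempty bin denser than that of `j` has a strictly smaller
score. Its cap is at least as large, so this score is not truncated. -/
theorem wt_lt_of_bin_lt (hρ : 1 < ρ) (hb : 0 < b) (hA : A.Obeys ρ (rule ρ b)) {t : ℝ} (ht : 0 ≤ t)
    {j : ℕ} (hj : A.run t = some j) {k : ℤ} (hk : I.bin ρ j < k) :
    wt ρ A t k < ρ ^ (b * score ρ b (history ρ A t) (I.bin ρ j)) := by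
  rcases (aliveIn ρ A t k).eq_empty_or_nonempty with he | ⟨q, hq0⟩
  · unfold wt; rw [he, Finset.sum_empty]; positivity
  · obtain ⟨hq, rfl⟩ := mem_aliveIn.1 hq0
    have h1 := run_spec hA ht hj hq
    have h2 := cap_mono_bin hb (history ρ A t) hk.le
    have h3 : score ρ b (history ρ A t) (I.bin ρ j) ≤ cap b (history ρ A t) (I.bin ρ j) :=
      min_le_right _ _
    exact wt_lt_of_score_lt hρ hb hq (by omega) (h3.trans h2)

/-- Volume of bins of bounded weight. -/
theorem remaining_le_of_wt_le (hρ : 1 < ρ) {J : Finset ℕ} {s : ℝ} {M : ℝ} (hM : 0 ≤ M) {k : ℤ}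
    (hJ : ∀ q ∈ J, q ∈ A.alive s → k ≤ I.bin ρ q) (hw : ∀ k', k ≤ k' → wt ρ A s k' ≤ M) :
    A.remaining J s ≤ ρ * (M * (ρ / (ρ - 1) * ρ ^ (-k))) := by
  classical
  unfold Schedule.remaining
  calc ∑ q ∈ J with q ∈ A.alive s, (I.proc q - elapsed A.run q s)
      ≤ ∑ q ∈ J with q ∈ A.alive s, ρ * (ρ ^ (-I.bin ρ q) * I.weight q) := by
        refine Finset.sum_le_sum fun q hq => ?_
        have h1 := Instance.proc_le_weight hρ (A.mem_alive.1 (Finset.mem_filter.1 hq).2).1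
        linarith [elapsed_nonneg A.run q s]
    _ = ρ * ∑ q ∈ J with q ∈ A.alive s, ρ ^ (-I.bin ρ q) * I.weight q := by rw [Finset.mul_sum]
    _ ≤ _ := by
        gcongr
        refine sum_discounted_le hρ _ _ _ k hM (fun q hq => ?_) fun k' hk' => ?_
        · exact hJ q (Finset.mem_filter.1 hq).1 (Finset.mem_filter.1 hq).2
        · refine le_trans (Finset.sum_le_sum_of_subset_of_nonneg (fun q hq => ?_) fun q hq _ => ?_)
            (hw k' hk')
          · have := Finset.mem_filter.1 hq
            exact mem_aliveIn.2 ⟨(Finset.mem_filter.1 this.1).2, this.2⟩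
          · exact (I.weight_pos q (A.mem_alive.1 (mem_aliveIn.1 hq).1).1).le

/-- At most one job of each level of a bin has been started. -/
theorem touched_unique (hA : A.Obeys ρ (rule ρ b)) {t : ℝ} {q q' : ℕ} (hq : q ∈ A.alive t)
    (hq' : q' ∈ A.alive t) (hk : I.bin ρ q = I.bin ρ q') (hl : I.lev ρ b q = I.lev ρ b q')
    (hE : 0 < elapsed A.run q t) (hE' : 0 < elapsed A.run q' t) : q = q' := by
  have key : ∀ q q', q ∈ A.alive t → I.bin ρ q = I.bin ρ q' → I.lev ρ b q = I.lev ρ b q' →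
      0 < elapsed A.run q' t → ¬ (I.release q < I.release q' ∨ I.release q = I.release q' ∧ q < q') := by
    intro q q' hq hk hl hE' h
    obtain ⟨s, hs0, hst, hs⟩ := A.exists_run_of_elapsed_pos hE'
    have h1 := A.pending s q' hs
    have hqs := A.alive_mono hst.le hq (by rcases h with h | h <;> linarith [h1.2.1])
    have := run_spec hA hs0 hs hqs
    rw [hk, hl] at this
    simp only [lt_irrefl, true_and, false_or] at this
    rcases this with h2 | h2 <;> rcases h with h | h
    · linarith
    · linarith [h.1]
    · linarith [h2.1]
    · omega
  have h1 := key q q' hq hk hl hE'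
  have h2 := key q' q hq' hk.symm hl.symm hE
  rcases lt_trichotomy (I.release q) (I.release q') with h | h | h
  · exact absurd (Or.inl h) h1
  · rcases lt_trichotomy q q' with h' | h' | h'
    · exact absurd (Or.inr ⟨h, h'⟩) h1
    · exact h'
    · exact absurd (Or.inr ⟨h.symm, h'⟩) h2
  · exact absurd (Or.inl h) h2

/-- With one started job per level, the weights are dominated by a geometric series of ratio at
least 2. -/
theorem touched_weight_le (hρ : 1 < ρ) (hb : 0 < b) (hB : 2 ≤ ρ ^ b) (hA : A.Obeys ρ (rule ρ b))
    {t : ℝ} (F : Finset ℕ) (k m : ℤ)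
    (hF : ∀ q ∈ F, q ∈ A.alive t ∧ I.bin ρ q = k ∧ I.lev ρ b q ≤ m ∧ 0 < elapsed A.run q t) :
    ∑ q ∈ F, I.weight q ≤ 2 * ρ ^ (b * (m + 1)) := by
  classical
  have hB1 : 1 < ρ ^ b := by linarith
  calc ∑ q ∈ F, I.weight q ≤ ∑ q ∈ F, (ρ ^ b) ^ (I.lev ρ b q + 1) := by
        refine Finset.sum_le_sum fun q hq => ?_
        rw [← zpow_mul]
        exact ((level_lt hρ hb (I.weight_pos q (A.mem_alive.1 (hF q hq).1).1) _).1
          (Int.lt_add_one_iff.2 le_rfl)).le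
    _ = ∑ k ∈ F.image fun q => I.lev ρ b q + 1, (ρ ^ b) ^ k := by
        rw [Finset.sum_image]
        intro q hq q' hq' h
        have h1 := hF q hq
        have h2 := hF q' hq'
        exact touched_unique hA h1.1 h2.1 (h1.2.1.trans h2.2.1.symm) (by simpa using h) h1.2.2.2
          h2.2.2.2
    _ ≤ ρ ^ b / (ρ ^ b - 1) * (ρ ^ b) ^ (m + 1) := by
        refine sum_zpow_le hB1 _ _ fun k hk => ?_
        obtain ⟨q, hq, rfl⟩ := Finset.mem_image.1 hk
        linarith [(hF q hq).2.2.1]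
    _ ≤ _ := by
        rw [← zpow_mul]
        have : ρ ^ b / (ρ ^ b - 1) ≤ 2 := by rw [div_le_iff₀ (by linarith)]; linarith
        gcongr

/-- Pending weight of small levels in a bin. -/
noncomputable def swt (ρ : ℝ) (b : ℤ) (A : Schedule I) (t : ℝ) (y k : ℤ) : ℝ :=
  ∑ q ∈ aliveIn ρ A t k with I.lev ρ b q < y, I.weight q

/-- A heavy bin of small jobs that is being worked on while it is abandoned stays heavy. -/
theorem swt_of_last (hρ : 1 < ρ) (hb : 0 < b) (hB : 2 ≤ ρ ^ b) {s t : ℝ} (hs : 0 ≤ s)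
    (hst : s < t) {j : ℕ} {J : Finset ℕ} {y : ℤ} (hrun : A.run s = some j) (hjy : I.lev ρ b j < y)
    (hsmall : ∀ q ∈ A.alive s, I.bin ρ q = I.bin ρ j → I.lev ρ b q < y)
    (hJ : ∀ q ∈ J, I.lev ρ b q < y → I.bin ρ q ≠ I.bin ρ j)
    (hafter : ∀ s', s < s' → s' < t → (∃ q ∈ J, A.run s' = some q) ∨ A.run s' = some j)
    (hw : ρ ^ (b * (y + 2)) ≤ wt ρ A s (I.bin ρ j)) :
    ρ ^ (b * (y + 2)) / 2 ≤ swt ρ b A t y (I.bin ρ j) := by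
  classical
  have hj : j ∈ A.alive s := A.mem_alive.2 (A.pending s j hrun)
  have hsub : (aliveIn ρ A s (I.bin ρ j)).erase j ⊆
      {q ∈ aliveIn ρ A t (I.bin ρ j) | I.lev ρ b q < y} := by
    intro q hq
    obtain ⟨hne, hq⟩ := Finset.mem_erase.1 hq
    obtain ⟨hqa, hqk⟩ := mem_aliveIn.1 hq
    have hqy := hsmall q hqa hqk
    refine Finset.mem_filter.2 ⟨mem_aliveIn.2 ⟨A.alive_of_not_run hs hst.le hqa ?_, hqk⟩, hqy⟩
    intro s' h1 h2 h3
    rcases h1.eq_or_lt with rfl | h1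
    · rw [hrun] at h3; exact hne (Option.some.inj h3).symm
    · rcases hafter s' h1 h2 with ⟨q', hq', h4⟩ | h4
      · rw [h3] at h4
        cases h4
        exact hJ q hq' hqy hqk
      · rw [h3] at h4; exact hne (Option.some.inj h4)
  have h1 : wt ρ A s (I.bin ρ j) = I.weight j + ∑ q ∈ (aliveIn ρ A s (I.bin ρ j)).erase j, I.weight q :=
    (Finset.add_sum_erase _ _ (mem_aliveIn.2 ⟨hj, rfl⟩)).symm
  have h2 : ∑ q ∈ (aliveIn ρ A s (I.bin ρ j)).erase j, I.weight q ≤ swt ρ b A t y (I.bin ρ j) :=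
    Finset.sum_le_sum_of_subset_of_nonneg hsub fun q hq _ =>
      (I.weight_pos q (A.mem_alive.1 (mem_aliveIn.1 (Finset.mem_filter.1 hq).1).1).1).le
  -- Of the jobs pending in the bin at time `s` only `j` can have left, and its weight is below a
  -- quarter of `ρ ^ (b * (y + 2))`.
  have h3 : I.weight j < ρ ^ (b * y) :=
    (level_lt hρ hb (I.weight_pos j (A.mem_alive.1 hj).1) _).1 hjy
  have h4 : ρ ^ (b * (y + 2)) = ρ ^ (b * y) * (ρ ^ b * ρ ^ b) := by
    rw [← zpow_add₀ (by linarith), ← zpow_add₀ (by linarith)]; congr 1; ring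
  have h5 : (0:ℝ) < ρ ^ (b * y) := by positivity
  rw [h4] at hw ⊢
  nlinarith [mul_le_mul hB hB (by norm_num) (by linarith)]

theorem lev_lt_of_load_lt (hρ : 1 < ρ) (hb : 0 < b) {t : ℝ} {y : ℤ} (h : S.load t < ρ ^ (b * y))
    {q : ℕ} (hq : q ∈ S.alive t) : I.lev ρ b q < y := by
  have hq' := (S.mem_alive.1 hq).1
  refine (level_lt hρ hb (I.weight_pos q hq') y).2 (lt_of_le_of_lt ?_ h)
  exact Finset.single_le_sum (f := I.weight) (fun q hq => (I.weight_pos q (S.mem_alive.1 hq).1).le) hq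

/-- The jobs of level at least `y` and those in bin `k` or denser. -/
noncomputable def upper (ρ : ℝ) (b : ℤ) (I : Instance) (y k : ℤ) : Finset ℕ :=
  {q ∈ I.jobs | y ≤ I.lev ρ b q ∨ k ≤ I.bin ρ q}

theorem upper_subset (y k : ℤ) : upper ρ b I y k ⊆ I.jobs := Finset.filter_subset _ _

theorem mem_upper {y k : ℤ} {q : ℕ} :
    q ∈ upper ρ b I y k ↔ q ∈ I.jobs ∧ (y ≤ I.lev ρ b q ∨ k ≤ I.bin ρ q) := Finset.mem_filter

/-- Every pending job of `S` has level below `y` because the whole load is below `ρ ^ (b * y)`. So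
the pending jobs of `S` in `upper` belong to it through their bin. -/
theorem remaining_upper_opt (hρ : 1 < ρ) (hb : 0 < b) {t : ℝ} {y : ℤ}
    (h : S.load t < ρ ^ (b * y)) (k : ℤ) :
    S.remaining (upper ρ b I y k) t ≤
      ∑ q ∈ S.alive t with k ≤ I.bin ρ q, ρ * (ρ ^ (-I.bin ρ q) * I.weight q) := by
  classical
  unfold Schedule.remaining
  calc ∑ q ∈ upper ρ b I y k with q ∈ S.alive t, (I.proc q - elapsed S.run q t)
      ≤ ∑ q ∈ upper ρ b I y k with q ∈ S.alive t, ρ * (ρ ^ (-I.bin ρ q) * I.weight q) := by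
        refine Finset.sum_le_sum fun q hq => ?_
        have h1 := Instance.proc_le_weight hρ (S.mem_alive.1 (Finset.mem_filter.1 hq).2).1
        linarith [elapsed_nonneg S.run q t]
    _ ≤ _ := by
        refine Finset.sum_le_sum_of_subset_of_nonneg (fun q hq => ?_) fun q hq _ => ?_
        · obtain ⟨h1, h2⟩ := Finset.mem_filter.1 hq
          have := lev_lt_of_load_lt hρ hb h h2
          have h3 := (mem_upper.1 h1).2
          exact Finset.mem_filter.2 ⟨h2, by omega⟩
        · have := I.weight_pos q (S.mem_alive.1 (Finset.mem_filter.1 hq).1).1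
          positivity

theorem remaining_upper_opt_le (hρ : 1 < ρ) (hb : 0 < b) {t : ℝ} {y : ℤ}
    (h : S.load t < ρ ^ (b * y)) (k : ℤ) :
    S.remaining (upper ρ b I y k) t ≤ ρ * ρ ^ (-k) * ρ ^ (b * y) := by
  classical
  refine (remaining_upper_opt hρ hb h k).trans ?_
  calc ∑ q ∈ S.alive t with k ≤ I.bin ρ q, ρ * (ρ ^ (-I.bin ρ q) * I.weight q)
      ≤ ∑ q ∈ S.alive t with k ≤ I.bin ρ q, ρ * ρ ^ (-k) * I.weight q := by
        refine Finset.sum_le_sum fun q hq => ?_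
        have h1 := (Finset.mem_filter.1 hq).2
        have h2 := I.weight_pos q (S.mem_alive.1 (Finset.mem_filter.1 hq).1).1
        have h3 : ρ ^ (-I.bin ρ q) ≤ ρ ^ (-k) := zpow_le_zpow_right₀ hρ.le (by omega)
        rw [mul_assoc]
        gcongr
    _ ≤ ∑ q ∈ S.alive t, ρ * ρ ^ (-k) * I.weight q :=
        Finset.sum_le_sum_of_subset_of_nonneg (Finset.filter_subset _ _) fun q hq _ => by
          have := I.weight_pos q (S.mem_alive.1 hq).1
          positivity
    _ = ρ * ρ ^ (-k) * S.load t := by rw [← Finset.mul_sum]; rfl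
    _ ≤ _ := by gcongr

/-- The base `ρ ^ b` of the levels has to be large. -/
structure LargeBase (ρ : ℝ) (b : ℤ) : Prop where
  pos : 0 < b
  le : 4 * ρ ^ 3 * (1 + ρ / (ρ - 1)) + 4 ≤ ρ ^ b

theorem LargeBase.two_le (hρ : 1 < ρ) (hb : LargeBase ρ b) : 2 ≤ ρ ^ b := by
  have := hb.le
  have h1 : 0 < ρ - 1 := by linarith
  have : 0 ≤ 4 * ρ ^ 3 * (1 + ρ / (ρ - 1)) := by positivity
  linarith

theorem exists_largeBase (hρ : 1 < ρ) : ∃ b, LargeBase ρ b := by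
  obtain ⟨n, hn⟩ := pow_unbounded_of_one_lt (4 * ρ ^ 3 * (1 + ρ / (ρ - 1)) + 4) hρ
  refine ⟨n + 1, by omega, ?_⟩
  have : ρ ^ ((n : ℤ) + 1) = ρ ^ n * ρ := by
    rw [zpow_add_one₀ (by linarith), zpow_natCast]
  rw [this]
  have : (0:ℝ) < ρ ^ n := by positivity
  nlinarith

/-- The core estimate: the sparsest heavy bin is bounded through the volume of everything at least
as dense or of large level. On that set `S` gained only while the algorithm ran a sparser bin of
score at most `y + 1`, and then the set had small volume. -/
theorem swt_lt (hρ : 1 < ρ) (hb : LargeBase ρ b) (hA : A.Obeys ρ (rule ρ b)) {t : ℝ} (ht : 0 ≤ t)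
    {y : ℤ} (hload : S.load t < ρ ^ (b * y)) (k : ℤ) (hk : y + 2 ≤ cap b (history ρ A t) k) :
    swt ρ b A t y k < ρ ^ (b * (y + 2)) / 2 := by
  classical
  by_contra hcon
  have hB := hb.two_le hρ
  have hbig : (0:ℝ) < ρ ^ (b * (y + 2)) / 2 := by positivity
  set F := ((A.alive t).image (I.bin ρ)).filter fun k =>
    y + 2 ≤ cap b (history ρ A t) k ∧ ρ ^ (b * (y + 2)) / 2 ≤ swt ρ b A t y k with hF
  have hmemF : ∀ k, y + 2 ≤ cap b (history ρ A t) k → ρ ^ (b * (y + 2)) / 2 ≤ swt ρ b A t y k →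
      k ∈ F := by
    intro k h1 h2
    refine Finset.mem_filter.2 ⟨?_, h1, h2⟩
    by_contra hk
    have : swt ρ b A t y k = 0 := by
      refine Finset.sum_eq_zero fun q hq => absurd ?_ hk
      obtain ⟨h3, h4⟩ := mem_aliveIn.1 (Finset.mem_filter.1 hq).1
      exact Finset.mem_image.2 ⟨q, h3, h4⟩
    linarith
  have hne : F.Nonempty := ⟨k, hmemF k hk (not_lt.1 hcon)⟩
  -- The sparsest offending bin, so that an offending bin left of `K` is a contradiction.
  set K := F.min' hne with hK
  have hKF := (Finset.mem_filter.1 (F.min'_mem hne)).2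
  set J := upper ρ b I y K with hJ
  -- The volume of bins `K` and denser if each has weight at most `ρ ^ (b * (y + 1))`.
  set M := ρ * (ρ ^ (b * (y + 1)) * (ρ / (ρ - 1) * ρ ^ (-K))) with hM
  have hρ1 : 0 < ρ - 1 := by linarith
  have hM0 : 0 ≤ M := by positivity
  have hlead : lead A S J t ≤ M := by
    by_contra hgt
    obtain ⟨s, j, hs0, hst, hls, hrun, hjJ, hafter⟩ :=
      hA.exists_last_lead_gt (upper_subset y K) hM0 ht (not_le.1 hgt)
    have hja := A.mem_alive_of_run hrun
    have hjI := (A.mem_alive.1 hja)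
    have hj1 : I.lev ρ b j < y ∧ I.bin ρ j < K := by
      by_contra hn
      exact hjJ (mem_upper.2 ⟨hjI.1, by omega⟩)
    -- With a score of at least `y + 2` the bin of `j` was heavy at `s` and still is at `t`, against
    -- the minimality of `K`.
    have hσ : score ρ b (history ρ A s) (I.bin ρ j) ≤ y + 1 := by
      by_contra hσ
      obtain ⟨h1, h2, h3⟩ := heavy_of_score hρ hb.pos hA hs0 hrun hj1.1 (by omega)
      have h4 := swt_of_last hρ hb.pos hB hs0 hst hrun hj1.1 h1 (J := J) (fun q hq hqy => by
        have := (mem_upper.1 hq).2; omega) hafter h2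
      have := F.min'_le _ (hmemF _ (h3.trans (cap_mono hb.pos hst.le hjI.1 hjI.2.1 _)) h4)
      omega
    refine absurd hls (not_lt.2 ((lead_le_remaining (upper_subset y K) s).trans ?_))
    refine remaining_le_of_wt_le hρ (by positivity) (fun q hq hqa => ?_) fun k' hk' => ?_
    · have h1 := (mem_upper.1 hq).2
      -- A pending job of level `y` or more would have forced a score of at least `y + 2`; so the
      -- pending jobs of `J` lie in bins from `K` on.
      have h2 := score_ge (b := b) (ρ := ρ) hb.pos hqa
      have h3 := score_le_run hA hs0 hrun hqa
      omega
    · refine (wt_lt_of_bin_lt hρ hb.pos hA hs0 hrun (by omega)).le.trans ?_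
      exact zpow_le_zpow_right₀ hρ.le (mul_le_mul_of_nonneg_left hσ hb.pos.le)
  have hrem : A.remaining J t ≤ M + ρ * ρ ^ (-K) * ρ ^ (b * y) := by
    have h1 := lead_eq (A := A) (S := S) (upper_subset (ρ := ρ) (b := b) (I := I) y K) t
    have h2 := remaining_upper_opt_le hρ hb.pos hload K
    linarith
  -- the untouched small jobs of bin `K`
  set E := (aliveIn ρ A t K).filter fun q => I.lev ρ b q < y with hE
  have hEm : ∀ q ∈ E, q ∈ A.alive t ∧ I.bin ρ q = K ∧ I.lev ρ b q < y := fun q hq => by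
    obtain ⟨h1, h2⟩ := Finset.mem_filter.1 hq
    exact ⟨(mem_aliveIn.1 h1).1, (mem_aliveIn.1 h1).2, h2⟩
  have hsplit := Finset.sum_filter_add_sum_filter_not E (fun q => 0 < elapsed A.run q t) I.weight
  have htouched : ∑ q ∈ E with 0 < elapsed A.run q t, I.weight q ≤ 2 * ρ ^ (b * y) := by
    have := touched_weight_le hρ hb.pos hB hA (t := t) (E.filter fun q => 0 < elapsed A.run q t) K
      (y - 1) fun q hq => by
        obtain ⟨h1, h2⟩ := Finset.mem_filter.1 hq
        have := hEm q h1
        exact ⟨this.1, this.2.1, by omega, h2⟩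
    rwa [sub_add_cancel] at this
  have hunt : ∑ q ∈ E with ¬ 0 < elapsed A.run q t, I.weight q ≤
      ρ ^ (K + 1) * A.remaining J t := by
    unfold Schedule.remaining
    rw [Finset.mul_sum]
    calc ∑ q ∈ E with ¬ 0 < elapsed A.run q t, I.weight q
        ≤ ∑ q ∈ E with ¬ 0 < elapsed A.run q t, ρ ^ (K + 1) * (I.proc q - elapsed A.run q t) := by
          refine Finset.sum_le_sum fun q hq => ?_
          obtain ⟨h1, h2⟩ := Finset.mem_filter.1 hq
          have h3 := hEm q h1
          have h4 : elapsed A.run q t = 0 := le_antisymm (not_lt.1 h2) (elapsed_nonneg _ _ _)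
          have := I.weight_le_proc hρ (A.mem_alive.1 h3.1).1
          rw [h3.2.1] at this
          rw [h4, sub_zero]; exact this
      _ ≤ _ := by
          refine Finset.sum_le_sum_of_subset_of_nonneg (fun q hq => ?_) fun q hq _ => ?_
          · have h3 := hEm q (Finset.mem_filter.1 hq).1
            exact Finset.mem_filter.2 ⟨mem_upper.2 ⟨(A.mem_alive.1 h3.1).1, Or.inr h3.2.1.ge⟩, h3.1⟩
          · have := (A.mem_alive.1 (Finset.mem_filter.1 hq).2).2.2
            have : 0 ≤ I.proc q - elapsed A.run q t := by linarith
            positivity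
  have hswt : swt ρ b A t y K = ∑ q ∈ E, I.weight q := rfl
  have hfin : ρ ^ (b * (y + 2)) / 2 ≤ 2 * ρ ^ (b * y) + ρ ^ (K + 1) *
      (M + ρ * ρ ^ (-K) * ρ ^ (b * y)) := by
    have h1 : (0:ℝ) ≤ ρ ^ (K + 1) := by positivity
    have := mul_le_mul_of_nonneg_left hrem h1
    linarith [hKF.2]
  have e1 : ρ ^ (b * (y + 2)) = ρ ^ (b * y) * (ρ ^ b * ρ ^ b) := by
    rw [← zpow_add₀ (by linarith), ← zpow_add₀ (by linarith)]; congr 1; ring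
  have e2 : ρ ^ (b * (y + 1)) = ρ ^ (b * y) * ρ ^ b := by
    rw [← zpow_add₀ (by linarith)]; congr 1; ring
  have e3 : ρ ^ (K + 1) * ρ ^ (-K) = ρ := by
    rw [← zpow_add₀ (by linarith)]; norm_num
  have e4 : ρ ^ (K + 1) * (M + ρ * ρ ^ (-K) * ρ ^ (b * y)) =
      ρ ^ (b * y) * (ρ ^ 2 * (1 + ρ ^ b * (ρ / (ρ - 1)))) := by
    rw [hM, e2]
    linear_combination (ρ * (ρ ^ (b * y) * ρ ^ b * (ρ / (ρ - 1))) + ρ * ρ ^ (b * y)) * e3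
  rw [e1, e4] at hfin
  have hθ : (0:ℝ) < ρ ^ (b * y) := by positivity
  -- Dividing by `ρ ^ (b * y)` leaves a quadratic inequality in `ρ ^ b`, which the size of the base
  -- rules out.
  have h1 : ρ ^ b * ρ ^ b / 2 ≤ 2 + ρ ^ 2 * (1 + ρ ^ b * (ρ / (ρ - 1))) := by
    refine le_of_mul_le_mul_left ?_ hθ
    linarith
  have hc : 0 < ρ / (ρ - 1) := by positivity
  have hle := hb.le
  have h3 : ρ ^ 2 ≤ ρ ^ 3 := pow_le_pow_right₀ hρ.le (by norm_num)
  have h4 : 4 * ρ ^ 2 * (1 + ρ / (ρ - 1)) + 4 ≤ ρ ^ b := by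
    refine le_trans ?_ hle
    gcongr
  generalize ρ ^ b = B at *
  have h5 : (4 * ρ ^ 2 * (1 + ρ / (ρ - 1)) + 4) * B ≤ B * B := by
    exact mul_le_mul_of_nonneg_right h4 (by linarith)
  have h6 : 0 < ρ ^ 2 := by positivity
  have h7 : 0 < ρ ^ 2 * B * (ρ / (ρ - 1)) := by positivity
  have h8 : ρ ^ 2 * 2 ≤ ρ ^ 2 * B := mul_le_mul_of_nonneg_left hB h6.le
  nlinarith

/-- `S` has no large job at `t`, so one in `A` means that `S` is ahead on large jobs. When `A` last
neglected them, one was pending, and so the bin of the small job that was run had to be heavy. Such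
a bin would still be heavy at `t`, which `swt_lt` excludes. -/
theorem no_large (hρ : 1 < ρ) (hb : LargeBase ρ b) (hA : A.Obeys ρ (rule ρ b)) {t : ℝ} (ht : 0 ≤ t)
    {y : ℤ} (hload : S.load t < ρ ^ (b * y)) {q : ℕ} (hq : q ∈ A.alive t) : I.lev ρ b q < y := by
  classical
  by_contra hqy
  set J := I.jobs.filter fun q => y ≤ I.lev ρ b q with hJ
  have hJI : J ⊆ I.jobs := Finset.filter_subset _ _
  have hlead : lead A S J t ≤ 0 := by
    by_contra hgt
    obtain ⟨s, j, hs0, hst, hls, hrun, hjJ, hafter⟩ :=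
      hA.exists_last_lead_gt hJI le_rfl ht (not_le.1 hgt)
    have hjI := A.pending s j hrun
    have hj1 : I.lev ρ b j < y := by
      by_contra hn
      exact hjJ (Finset.mem_filter.2 ⟨hjI.1, not_lt.1 hn⟩)
    have hpos := hls.trans_le (lead_le_remaining hJI s)
    have hex : ∃ q' ∈ A.alive s, y ≤ I.lev ρ b q' := by
      by_contra hn
      push Not at hn
      refine hpos.ne' (Finset.sum_eq_zero fun q hq => ?_)
      obtain ⟨h1, h2⟩ := Finset.mem_filter.1 hq
      exact absurd (hn q h2) (not_lt.2 (Finset.mem_filter.1 h1).2)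
    obtain ⟨q', hq', hqy'⟩ := hex
    obtain ⟨h1, h2, h3⟩ := heavy_of_score hρ hb.pos hA hs0 hrun hj1 (by
      have h1 := score_ge (b := b) (ρ := ρ) hb.pos hq'
      have h2 := score_le_run hA hs0 hrun hq'
      omega)
    have h4 := swt_of_last hρ hb.pos (hb.two_le hρ) hs0 hst hrun hj1 h1 (J := J) (fun q hq hqy => by
      have := (Finset.mem_filter.1 hq).2; omega) hafter h2
    exact absurd h4 (not_le.2 (swt_lt hρ hb hA ht hload _
      (h3.trans (cap_mono hb.pos hst.le hjI.1 hjI.2.1 _))))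
  rw [lead_eq hJI] at hlead
  have h0 : S.remaining J t = 0 := by
    refine Finset.sum_eq_zero fun q hq => ?_
    obtain ⟨h1, h2⟩ := Finset.mem_filter.1 hq
    exact absurd (lev_lt_of_load_lt hρ hb.pos hload h2) (not_lt.2 (Finset.mem_filter.1 h1).2)
  have hq' := A.mem_alive.1 hq
  have h1 : I.proc q - elapsed A.run q t ≤ A.remaining J t := by
    unfold Schedule.remaining
    refine Finset.single_le_sum (f := fun q => I.proc q - elapsed A.run q t) (fun q hq => ?_) ?_
    · linarith [(A.mem_alive.1 (Finset.mem_filter.1 hq).2).2.2]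
    · exact Finset.mem_filter.2 ⟨Finset.mem_filter.2 ⟨hq'.1, not_lt.1 hqy⟩, hq⟩
  linarith [hq'.2.2]

end DensityBins
end FlowTime

/-! ### Density bins: bins of small cap, and the number of the others -/

namespace FlowTime
namespace DensityBins

variable {ρ : ℝ} {b : ℤ} {I : Instance} {A S : Schedule I}

/-- The pending jobs in bins of a small cap. -/
noncomputable def low (ρ : ℝ) (b : ℤ) (A : Schedule I) (t : ℝ) (y : ℤ) : Finset ℕ :=
  {q ∈ A.alive t | cap b (history ρ A t) (I.bin ρ q) ≤ y + 1}

theorem mem_low {t : ℝ} {y : ℤ} {q : ℕ} : q ∈ low ρ b A t y ↔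
    q ∈ A.alive t ∧ cap b (history ρ A t) (I.bin ρ q) ≤ y + 1 := Finset.mem_filter

theorem bin_of_cap_le (hb : 0 < b) {h : History} {k y : ℤ} (hk : cap b h k ≤ y + 1) :
    k ≤ b * (y - 2) - top h - 1 := by
  unfold cap at hk
  have : (k + top h) / b < y - 2 := by omega
  rw [Int.ediv_lt_iff_lt_mul hb] at this
  linarith [mul_comm b (y - 2)]

/-- When `upper` is neglected, the bin that is run is sparser than `k`, so its score is bounded by a
cap of at most `y + 1` and no large job is pending. The denser bins weigh less than the base to that
cap, that is, less than `ρ ^ (k + top + 4 * b)`; dividing by the density leaves a volume of order `ρ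
^ top`. -/
theorem lead_low_le (hρ : 1 < ρ) (hb : LargeBase ρ b) (hA : A.Obeys ρ (rule ρ b)) {t : ℝ}
    (ht : 0 ≤ t) {y k : ℤ} (hk : cap b (history ρ A t) k ≤ y + 1) :
    lead A S (upper ρ b I y k) t ≤
      ρ * (ρ / (ρ - 1)) * ρ ^ (4 * b) * ρ ^ top (history ρ A t) := by
  have hρ1 : 0 < ρ - 1 := by linarith
  by_contra hgt
  obtain ⟨s, j, hs0, hst, hls, hrun, hjJ, -⟩ :=
    hA.exists_last_lead_gt (upper_subset y k) (by positivity) ht (not_le.1 hgt)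
  have hjI := A.pending s j hrun
  have hj1 : I.lev ρ b j < y ∧ I.bin ρ j < k := by
    by_contra hn
    exact hjJ (mem_upper.2 ⟨hjI.1, by omega⟩)
  have hcap : cap b (history ρ A s) (I.bin ρ j) ≤ y + 1 :=
    ((cap_mono hb.pos hst.le hjI.1 hjI.2.1 _).trans (cap_mono_bin hb.pos _ hj1.2.le)).trans hk
  have hσ : score ρ b (history ρ A s) (I.bin ρ j) ≤ cap b (history ρ A s) (I.bin ρ j) :=
    min_le_right _ _
  have hσt := hσ.trans (cap_mono hb.pos hst.le hjI.1 hjI.2.1 (ρ := ρ) (A := A) _)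
  refine absurd hls (not_lt.2 ((lead_le_remaining (upper_subset y k) s).trans ?_))
  refine (remaining_le_of_wt_le hρ (M := ρ ^ (b * cap b (history ρ A t) (I.bin ρ j))) (k := k)
    (by positivity) (fun q hq hqa => ?_) fun k' hk' => ?_).trans ?_
  · have h1 := (mem_upper.1 hq).2
    have h2 := score_ge (b := b) (ρ := ρ) hb.pos hqa
    have h3 := score_le_run hA hs0 hrun hqa
    omega
  · refine (wt_lt_of_bin_lt hρ hb.pos hA hs0 hrun (by omega)).le.trans ?_
    exact zpow_le_zpow_right₀ hρ.le (mul_le_mul_of_nonneg_left hσt hb.pos.le)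
  · have h1 : b * cap b (history ρ A t) (I.bin ρ j) - k ≤ 4 * b + top (history ρ A t) := by
      unfold cap
      have := Int.mul_ediv_self_le (x := I.bin ρ j + top (history ρ A t)) (k := b) hb.pos.ne'
      rw [mul_add]
      linarith [hj1.2]
    have h2 := zpow_le_zpow_right₀ hρ.le h1
    rw [zpow_add₀ (by linarith), sub_eq_add_neg, zpow_add₀ (by linarith)] at h2
    have h3 : 0 < ρ * (ρ / (ρ - 1)) := by positivity
    have := mul_le_mul_of_nonneg_left h2 h3.le
    linarith

/-- In low bins `k + top` is less than `b * (y - 2)`, so the terms are bounded by `c` times distinct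
powers of `ρ` below `ρ ^ (b * y)`. -/
theorem sum_low_bins (hρ : 1 < ρ) (hb : 0 < b) {t : ℝ} {y : ℤ} {f : ℤ → ℝ} {c : ℝ} (hc : 0 ≤ c)
    (hf : ∀ k, f k ≤ c * ρ ^ (k + top (history ρ A t))) :
    ∑ k ∈ (low ρ b A t y).image (I.bin ρ), f k ≤ c * (ρ / (ρ - 1)) * ρ ^ (b * y) := by
  have hρ1 : 0 < ρ - 1 := by linarith
  calc ∑ k ∈ (low ρ b A t y).image (I.bin ρ), f k
      ≤ ∑ k ∈ (low ρ b A t y).image (I.bin ρ), c * ρ ^ top (history ρ A t) * ρ ^ k :=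
        Finset.sum_le_sum fun k _ => (hf k).trans_eq (by rw [zpow_add₀ (by linarith)]; ring)
    _ = c * ρ ^ top (history ρ A t) * ∑ k ∈ (low ρ b A t y).image (I.bin ρ), ρ ^ k := by
        rw [Finset.mul_sum]
    _ ≤ c * ρ ^ top (history ρ A t) * (ρ / (ρ - 1) * ρ ^ (b * (y - 2) - top (history ρ A t) - 1)) := by
        gcongr
        refine sum_zpow_le hρ _ _ fun k hk => ?_
        obtain ⟨q, hq, rfl⟩ := Finset.mem_image.1 hk
        exact bin_of_cap_le hb (mem_low.1 hq).2
    _ = c * (ρ / (ρ - 1)) * ρ ^ (top (history ρ A t) + (b * (y - 2) - top (history ρ A t) - 1)) := by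
        rw [zpow_add₀ (by linarith)]; ring
    _ ≤ _ := by
        gcongr
        · exact hρ.le
        · nlinarith

/-- The three constants come from the started jobs, from the lead of `S` on `upper`, and from what
`S` itself has pending. In each bin an unstarted job has all its volume left, so volume bounds its
weight. -/
theorem low_le (hρ : 1 < ρ) (hb : LargeBase ρ b) (hA : A.Obeys ρ (rule ρ b)) {t : ℝ} (ht : 0 ≤ t)
    {y : ℤ} (hload : S.load t < ρ ^ (b * y)) :
    ∑ q ∈ low ρ b A t y, I.weight q ≤
      (2 * ρ ^ b * (ρ / (ρ - 1)) + ρ * (ρ * (ρ / (ρ - 1)) * ρ ^ (4 * b)) * (ρ / (ρ - 1)) +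
        ρ ^ 2 * (ρ / (ρ - 1))) * ρ ^ (b * y) := by
  classical
  have hρ1 : 0 < ρ - 1 := by linarith
  rw [← Finset.sum_filter_add_sum_filter_not _ fun q => 0 < elapsed A.run q t]
  have h1 : ∑ q ∈ low ρ b A t y with 0 < elapsed A.run q t, I.weight q ≤
      2 * ρ ^ b * (ρ / (ρ - 1)) * ρ ^ (b * y) := by
    rw [← Finset.sum_fiberwise_of_maps_to (t := (low ρ b A t y).image (I.bin ρ)) fun q hq =>
      Finset.mem_image_of_mem (I.bin ρ) (Finset.mem_filter.1 hq).1]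
    refine sum_low_bins hρ hb.pos (A := A) (t := t) (by positivity) fun k => ?_
    refine (touched_weight_le hρ hb.pos (hb.two_le hρ) hA (t := t) _ k ((k + top (history ρ A t)) / b)
      fun q hq => ?_).trans ?_
    · obtain ⟨h1, h2⟩ := Finset.mem_filter.1 hq
      obtain ⟨h3, h4⟩ := Finset.mem_filter.1 h1
      have h5 := (mem_low.1 h3).1
      have h6 := lev_le_cap (ρ := ρ) hb.pos h5
      unfold cap at h6
      rw [h2] at h6
      exact ⟨h5, h2, by omega, h4⟩
    · have := Int.mul_ediv_self_le (x := k + top (history ρ A t)) (k := b) hb.pos.ne'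
      rw [mul_assoc, ← zpow_add₀ (by linarith)]
      gcongr
      · exact hρ.le
      · linarith
  have h2 : ∑ q ∈ low ρ b A t y with ¬ 0 < elapsed A.run q t, I.weight q ≤
      ∑ k ∈ (low ρ b A t y).image (I.bin ρ), ρ ^ (k + 1) * A.remaining (upper ρ b I y k) t := by
    rw [← Finset.sum_fiberwise_of_maps_to (t := (low ρ b A t y).image (I.bin ρ)) fun q hq =>
      Finset.mem_image_of_mem (I.bin ρ) (Finset.mem_filter.1 hq).1]
    refine Finset.sum_le_sum fun k _ => ?_
    unfold Schedule.remaining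
    rw [Finset.mul_sum]
    calc _ ≤ ∑ q ∈ {q ∈ low ρ b A t y | ¬ 0 < elapsed A.run q t} with I.bin ρ q = k,
          ρ ^ (k + 1) * (I.proc q - elapsed A.run q t) := by
          refine Finset.sum_le_sum fun q hq => ?_
          obtain ⟨h1, h2⟩ := Finset.mem_filter.1 hq
          obtain ⟨h3, h4⟩ := Finset.mem_filter.1 h1
          have h5 : elapsed A.run q t = 0 := le_antisymm (not_lt.1 h4) (elapsed_nonneg _ _ _)
          have := I.weight_le_proc hρ (A.mem_alive.1 (mem_low.1 h3).1).1
          rw [h2] at this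
          rw [h5, sub_zero]; exact this
      _ ≤ _ := by
          refine Finset.sum_le_sum_of_subset_of_nonneg (fun q hq => ?_) fun q hq _ => ?_
          · obtain ⟨h1, h2⟩ := Finset.mem_filter.1 hq
            have h3 := (mem_low.1 (Finset.mem_filter.1 h1).1).1
            exact Finset.mem_filter.2 ⟨mem_upper.2 ⟨(A.mem_alive.1 h3).1, Or.inr h2.ge⟩, h3⟩
          · have := (A.mem_alive.1 (Finset.mem_filter.1 hq).2).2.2
            have : 0 ≤ I.proc q - elapsed A.run q t := by linarith
            positivity
  set C1 := ρ * (ρ / (ρ - 1)) * ρ ^ (4 * b) with hC1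
  have h3 : ∀ k ∈ (low ρ b A t y).image (I.bin ρ),
      ρ ^ (k + 1) * A.remaining (upper ρ b I y k) t ≤ ρ * C1 * ρ ^ (k + top (history ρ A t)) +
        ρ ^ (k + 1) * ∑ q ∈ S.alive t with k ≤ I.bin ρ q, ρ * (ρ ^ (-I.bin ρ q) * I.weight q) := by
    intro k hk
    obtain ⟨q, hq, rfl⟩ := Finset.mem_image.1 hk
    have h4 := lead_low_le (S := S) hρ hb hA ht (mem_low.1 hq).2
    rw [lead_eq (upper_subset _ _)] at h4
    have h5 := remaining_upper_opt hρ hb.pos hload (I.bin ρ q)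
    have h6 : (0:ℝ) ≤ ρ ^ (I.bin ρ q + 1) := by positivity
    have h7 := mul_le_mul_of_nonneg_left (show A.remaining (upper ρ b I y (I.bin ρ q)) t ≤
      C1 * ρ ^ top (history ρ A t) + ∑ q' ∈ S.alive t with I.bin ρ q ≤ I.bin ρ q',
        ρ * (ρ ^ (-I.bin ρ q') * I.weight q') by linarith) h6
    refine h7.trans_eq ?_
    rw [mul_add, zpow_add₀ (by linarith : ρ ≠ 0) _ (top _), zpow_add_one₀ (by linarith : ρ ≠ 0)]
    ring
  have h4 : ∑ k ∈ (low ρ b A t y).image (I.bin ρ), ρ * C1 * ρ ^ (k + top (history ρ A t)) ≤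
      ρ * C1 * (ρ / (ρ - 1)) * ρ ^ (b * y) :=
    sum_low_bins hρ hb.pos (A := A) (t := t) (by positivity) fun k => le_rfl
  have h5 : ∑ k ∈ (low ρ b A t y).image (I.bin ρ), ρ ^ (k + 1) *
      ∑ q ∈ S.alive t with k ≤ I.bin ρ q, ρ * (ρ ^ (-I.bin ρ q) * I.weight q) ≤
      ρ ^ 2 * (ρ / (ρ - 1)) * ρ ^ (b * y) := by
    -- Exchanging the sums, a pending job of `S` is charged by all low bins `k` up to its own, with
    -- factors that decay geometrically in the distance.
    calc _ = ∑ k ∈ (low ρ b A t y).image (I.bin ρ), ∑ q ∈ S.alive t,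
          if k ≤ I.bin ρ q then ρ ^ k * (ρ ^ 2 * (ρ ^ (-I.bin ρ q) * I.weight q)) else 0 := by
          refine Finset.sum_congr rfl fun k _ => ?_
          rw [Finset.mul_sum, Finset.sum_filter]
          refine Finset.sum_congr rfl fun q _ => ?_
          split_ifs
          · rw [zpow_add_one₀ (by linarith)]; ring
          · rfl
      _ = ∑ q ∈ S.alive t, (∑ k ∈ (low ρ b A t y).image (I.bin ρ) with k ≤ I.bin ρ q, ρ ^ k) *
            (ρ ^ 2 * (ρ ^ (-I.bin ρ q) * I.weight q)) := by
          rw [Finset.sum_comm]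
          refine Finset.sum_congr rfl fun q _ => ?_
          rw [Finset.sum_mul, Finset.sum_filter]
      _ ≤ ∑ q ∈ S.alive t, ρ ^ 2 * (ρ / (ρ - 1)) * I.weight q := by
          refine Finset.sum_le_sum fun q hq => ?_
          have h1 := sum_zpow_le hρ ({k ∈ (low ρ b A t y).image (I.bin ρ) | k ≤ I.bin ρ q}) (I.bin ρ q)
            fun k hk => (Finset.mem_filter.1 hk).2
          have h2 := I.weight_pos q (S.mem_alive.1 hq).1
          have h3 : ρ ^ I.bin ρ q * ρ ^ (-I.bin ρ q) = 1 := by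
            rw [← zpow_add₀ (by linarith)]; norm_num
          calc _ ≤ ρ / (ρ - 1) * ρ ^ I.bin ρ q * (ρ ^ 2 * (ρ ^ (-I.bin ρ q) * I.weight q)) := by
                gcongr
            _ = ρ ^ 2 * (ρ / (ρ - 1)) * I.weight q := by
                linear_combination (ρ / (ρ - 1) * ρ ^ 2 * I.weight q) * h3
      _ = ρ ^ 2 * (ρ / (ρ - 1)) * S.load t := by rw [← Finset.mul_sum]; rfl
      _ ≤ _ := by gcongr
  have h6 := Finset.sum_le_sum h3
  rw [Finset.sum_add_distrib] at h6
  linarith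

/-- The bins that are not low. -/
noncomputable def highBins (ρ : ℝ) (b : ℤ) (A : Schedule I) (t : ℝ) (y : ℤ) : Finset ℤ :=
  {k ∈ (A.alive t).image (I.bin ρ) | ¬ cap b (history ρ A t) k ≤ y + 1}

/-- A constant that depends on `ρ` and the base only. -/
noncomputable def lowConst (ρ : ℝ) (b : ℤ) : ℝ :=
  2 * ρ ^ b * (ρ / (ρ - 1)) + ρ * (ρ * (ρ / (ρ - 1)) * ρ ^ (4 * b)) * (ρ / (ρ - 1)) +
    ρ ^ 2 * (ρ / (ρ - 1))

theorem lowConst_pos (hρ : 1 < ρ) : 0 < lowConst ρ b := by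
  have hρ1 : 0 < ρ - 1 := by linarith
  unfold lowConst
  positivity

/-- All pending jobs are small by `no_large`, so `swt_lt` bounds the entire weight of each high bin.
-/
theorem load_le (hρ : 1 < ρ) (hb : LargeBase ρ b) (hA : A.Obeys ρ (rule ρ b)) {t : ℝ} (ht : 0 ≤ t)
    {y : ℤ} (hload : S.load t < ρ ^ (b * y)) :
    A.load t ≤ (((highBins ρ b A t y).card : ℝ) * ρ ^ (2 * b) + lowConst ρ b) * ρ ^ (b * y) := by
  classical
  unfold Schedule.load
  rw [← Finset.sum_filter_add_sum_filter_not _ fun q => cap b (history ρ A t) (I.bin ρ q) ≤ y + 1]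
  have h1 : ∑ q ∈ A.alive t with cap b (history ρ A t) (I.bin ρ q) ≤ y + 1, I.weight q ≤
      lowConst ρ b * ρ ^ (b * y) := low_le hρ hb hA ht hload
  have h2 : ∑ q ∈ A.alive t with ¬ cap b (history ρ A t) (I.bin ρ q) ≤ y + 1, I.weight q ≤
      (highBins ρ b A t y).card * (ρ ^ (2 * b) * ρ ^ (b * y)) := by
    rw [← Finset.sum_fiberwise_of_maps_to (t := highBins ρ b A t y) (g := I.bin ρ) fun q hq => by
      obtain ⟨h1, h2⟩ := Finset.mem_filter.1 hq
      exact Finset.mem_filter.2 ⟨Finset.mem_image_of_mem _ h1, h2⟩]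
    rw [← nsmul_eq_mul]
    refine Finset.sum_le_card_nsmul _ _ _ fun k hk => ?_
    have hk2 := (Finset.mem_filter.1 hk).2
    have h3 := swt_lt hρ hb hA ht hload k (by omega)
    have h4 : ∑ q ∈ {q ∈ A.alive t | ¬ cap b (history ρ A t) (I.bin ρ q) ≤ y + 1} with
        I.bin ρ q = k, I.weight q ≤ swt ρ b A t y k := by
      refine Finset.sum_le_sum_of_subset_of_nonneg (fun q hq => ?_) fun q hq _ => ?_
      · obtain ⟨h5, h6⟩ := Finset.mem_filter.1 hq
        have h7 := (Finset.mem_filter.1 h5).1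
        exact Finset.mem_filter.2 ⟨mem_aliveIn.2 ⟨h7, h6⟩, no_large hρ hb hA ht hload h7⟩
      · exact (I.weight_pos q (A.mem_alive.1 (mem_aliveIn.1 (Finset.mem_filter.1 hq).1).1).1).le
    have h5 : ρ ^ (b * (y + 2)) = ρ ^ (2 * b) * ρ ^ (b * y) := by
      rw [← zpow_add₀ (by linarith)]; congr 1; ring
    have h6 : (0:ℝ) < ρ ^ (b * (y + 2)) := by positivity
    rw [← h5]
    linarith
  linarith

theorem le_maxRatio {s : Finset ℕ} {f : ℕ → ℝ} {q q' : ℕ} (hq : q ∈ s) (hq' : q' ∈ s) :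
    f q / f q' ≤ maxRatio s f := by
  classical
  refine le_csSup (Set.Finite.bddAbove ?_) ⟨q, hq, q', hq', rfl⟩
  refine ((s ×ˢ s).image fun x => f x.1 / f x.2).finite_toSet.subset ?_
  rintro x ⟨q, hq, q', hq', rfl⟩
  exact Finset.mem_coe.2 (Finset.mem_image.2 ⟨(q, q'), Finset.mem_product.2 ⟨hq, hq'⟩, rfl⟩)

theorem one_le_maxRatio {s : Finset ℕ} {f : ℕ → ℝ} (hf : ∀ q ∈ s, 0 < f q) (hs : s.Nonempty) :
    1 ≤ maxRatio s f := by
  obtain ⟨q, hq⟩ := hs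
  have := le_maxRatio (f := f) hq hq
  rwa [div_self (hf q hq).ne'] at this

/-- The cap gives the lower bound `b * (y - 2) - top` for the bin. For the upper bound, `no_large`
puts the weight class below `b * y`, and the processing class is at least `top - 1 - logb ρ I.P`. -/
theorem card_highBins_le_P (hρ : 1 < ρ) (hb : LargeBase ρ b) (hA : A.Obeys ρ (rule ρ b)) {t : ℝ}
    (ht : 0 ≤ t) {y : ℤ} (hload : S.load t < ρ ^ (b * y)) (hne : I.jobs.Nonempty) :
    ((highBins ρ b A t y).card : ℝ) ≤ 2 * b + 2 + Real.logb ρ I.P := by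
  have hP : 1 ≤ I.P := one_le_maxRatio I.proc_pos hne
  have hlog := Real.logb_nonneg hρ hP
  have hbp : (0:ℝ) < b := by exact_mod_cast hb.pos
  have hb1 : ∀ k ∈ highBins ρ b A t y, b * (y - 2) - top (history ρ A t) ≤ k := by
    intro k hk
    have := (Finset.mem_filter.1 hk).2
    unfold cap at this
    have h1 : y - 2 ≤ (k + top (history ρ A t)) / b := by omega
    rw [Int.le_ediv_iff_mul_le hb.pos] at h1
    linarith [mul_comm b (y - 2)]
  have hb2 : ∀ k ∈ highBins ρ b A t y,
      (k : ℝ) ≤ b * y - top (history ρ A t) + 1 + Real.logb ρ I.P := by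
    intro k hk
    obtain ⟨q, hq, rfl⟩ := Finset.mem_image.1 (Finset.mem_filter.1 hk).1
    have hq' := A.mem_alive.1 hq
    obtain ⟨q1, hq1, -, htop⟩ := exists_top (ρ := ρ) (A := A) hq'.1 hq'.2.1
    have h1 := no_large hρ hb hA ht hload hq
    have h2 : jobClass ρ (I.weight q) < b * y := by
      rw [jobClass_lt hρ (I.weight_pos q hq'.1)]
      exact (level_lt hρ hb.pos (I.weight_pos q hq'.1) _).1 h1
    have h3 : I.proc q1 ≤ I.P * I.proc q := by
      have := le_maxRatio (f := I.proc) hq1 hq'.1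
      rwa [div_le_iff₀ (I.proc_pos q hq'.1)] at this
    have h4 := (Real.logb_le_logb hρ (I.proc_pos q1 hq1)
      (by have := I.proc_pos q hq'.1; positivity)).2 h3
    rw [Real.logb_mul (by linarith) (I.proc_pos q hq'.1).ne'] at h4
    have h5 := Int.floor_le (Real.logb ρ (I.proc q1))
    have h6 := (Int.lt_floor_add_one (Real.logb ρ (I.proc q))).le
    have h7 : ((jobClass ρ (I.weight q) : ℤ) : ℝ) ≤ b * y := by exact_mod_cast h2.le
    rw [← htop]
    unfold Instance.bin
    push_cast
    unfold jobClass at *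
    linarith
  refine (card_le_of_spread _ (X := 2 * b + 1 + Real.logb ρ I.P) (by positivity)
    fun k hk k' hk' => ?_).trans (by linarith)
  have h1 := hb2 k hk
  have h2 : ((b * (y - 2) - top (history ρ A t) : ℤ) : ℝ) ≤ k' := by exact_mod_cast hb1 k' hk'
  push_cast at h2 ⊢
  linarith

theorem card_highBins_le_D (hρ : 1 < ρ) {t : ℝ} {y : ℤ} (hne : I.jobs.Nonempty) :
    ((highBins ρ b A t y).card : ℝ) ≤ 3 + Real.logb ρ I.D := by
  have hd : ∀ q ∈ I.jobs, 0 < I.weight q / I.proc q := fun q hq =>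
    div_pos (I.weight_pos q hq) (I.proc_pos q hq)
  have hD : 1 ≤ I.D := one_le_maxRatio hd hne
  have hlog := Real.logb_nonneg hρ hD
  refine (card_le_of_spread _ (X := 2 + Real.logb ρ I.D) (by positivity)
    fun k hk k' hk' => ?_).trans (by linarith)
  obtain ⟨q, hq, rfl⟩ := Finset.mem_image.1 (Finset.mem_filter.1 hk).1
  obtain ⟨q', hq', rfl⟩ := Finset.mem_image.1 (Finset.mem_filter.1 hk').1
  have hq := (A.mem_alive.1 hq).1
  have hq' := (A.mem_alive.1 hq').1
  have h1 := le_maxRatio (f := fun q => I.weight q / I.proc q) hq hq'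
  rw [div_le_iff₀ (hd q' hq')] at h1
  have hD1 : 0 < maxRatio I.jobs (fun q => I.weight q / I.proc q) := one_pos.trans_le hD
  have hD0 := hD1.ne'
  have h2 := (Real.logb_le_logb hρ (hd q hq) (mul_pos hD1 (hd q' hq'))).2 h1
  rw [Real.logb_mul hD0 (hd q' hq').ne',
    Real.logb_div (I.weight_pos q hq).ne' (I.proc_pos q hq).ne',
    Real.logb_div (I.weight_pos q' hq').ne' (I.proc_pos q' hq').ne'] at h2
  have e : maxRatio I.jobs (fun q => I.weight q / I.proc q) = I.D := rfl
  rw [e] at h2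
  have h3 := Int.floor_le (Real.logb ρ (I.weight q))
  have h4 := Int.floor_le (Real.logb ρ (I.proc q'))
  have h5 := Int.lt_floor_add_one (Real.logb ρ (I.weight q'))
  have h6 := Int.lt_floor_add_one (Real.logb ρ (I.proc q))
  have h7 := Int.floor_le (Real.logb ρ (I.proc q))
  have h8 := Int.lt_floor_add_one (Real.logb ρ (I.weight q))
  have h9 := Int.floor_le (Real.logb ρ (I.weight q'))
  have h10 := Int.lt_floor_add_one (Real.logb ρ (I.proc q'))
  unfold Instance.bin jobClass
  push_cast
  linarith

end DensityBins

/-! ### From bounds on the load to the competitive ratios in P and D -/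

theorem Schedule.load_nonneg {I : Instance} (S : Schedule I) (t : ℝ) : 0 ≤ S.load t :=
  Finset.sum_nonneg fun q hq => (I.weight_pos q (S.mem_alive.1 hq).1).le

/-- From bounds in terms of all powers of a base to a bound by the value. -/
theorem le_of_forall_zpow {B x a R : ℝ} (hB : 1 < B) (hx : 0 ≤ x) (hR : 0 ≤ R)
    (h : ∀ y : ℤ, x < B ^ y → a ≤ R * B ^ y) : a ≤ R * B * x := by
  rcases hx.eq_or_lt with rfl | hx
  · rw [mul_zero]
    -- For `x = 0` every exponent is admissible, and a very negative one contradicts `0 < a`.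
    by_contra ha
    push Not at ha
    obtain ⟨n, hn⟩ := pow_unbounded_of_one_lt (R / a) hB
    have h1 := h (-n) (by positivity)
    have h2 : (0:ℝ) < B ^ n := by positivity
    rw [zpow_neg, zpow_natCast, ← div_eq_mul_inv, le_div_iff₀ h2] at h1
    rw [div_lt_iff₀ ha] at hn
    linarith
  · obtain ⟨n, h1, h2⟩ := exists_mem_Ico_zpow hx hB
    refine (h _ h2).trans ?_
    rw [zpow_add_one₀ (by linarith), mul_assoc, mul_comm B x]
    gcongr

/-- The criterion by which the algorithms are analysed. -/
theorem Rule.isCompetitive_of_load_le {ρ B : ℝ} (R : Rule) (ratio N : Instance → ℝ) (hB : 1 < B)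
    (hN : ∀ I : Instance, I.jobs.Nonempty → 0 ≤ N I ∧ N I * B ≤ ratio I)
    (h : ∀ (I : Instance) (A S : Schedule I), A.Obeys ρ R → I.jobs.Nonempty → ∀ t, 0 ≤ t → ∀ y : ℤ,
      S.load t < B ^ y → A.load t ≤ N I * B ^ y) :
    (R.algorithm ρ).IsCompetitive ratio := by
  intro I S
  rcases I.jobs.eq_empty_or_nonempty with he | hne
  · simp [Schedule.flowTime, he]
  · refine Schedule.flowTime_le_of_load_le S _ fun t ht => ?_
    obtain ⟨h1, h2⟩ := hN I hne
    refine (le_of_forall_zpow hB (S.load_nonneg t) h1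
      (h I _ S (R.algorithm_obeys ρ I) hne t ht)).trans ?_
    have := S.load_nonneg t
    gcongr

theorem exists_competitive_P {ρ : ℝ} (hρ : 1 < ρ) :
    ∃ (A : SemiclairvoyantAlgorithm ρ) (C : ℝ), 0 < C ∧
      A.IsCompetitive fun I => C * (1 + Real.log I.P) := by
  obtain ⟨b, hb⟩ := DensityBins.exists_largeBase hρ
  have hB := hb.two_le hρ
  have hbp : (0:ℝ) < b := by exact_mod_cast hb.pos
  have hL : 0 < Real.log ρ := Real.log_pos hρ
  have hc := DensityBins.lowConst_pos (b := b) hρ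
  refine ⟨(DensityBins.rule ρ b).algorithm ρ,
    ((2 * b + 2 + 1 / Real.log ρ) * ρ ^ (2 * b) + DensityBins.lowConst ρ b) * ρ ^ b, by positivity, ?_⟩
  refine Rule.isCompetitive_of_load_le (B := ρ ^ b) _ _
    (fun I => (2 * b + 2 + Real.logb ρ I.P) * ρ ^ (2 * b) + DensityBins.lowConst ρ b) (by linarith)
    (fun I hne => ?_) fun I A S hA hne t ht y hy => ?_
  · have hP : 1 ≤ I.P := DensityBins.one_le_maxRatio I.proc_pos hne
    have h1 := Real.log_nonneg hP
    have h2 := Real.logb_nonneg hρ hP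
    refine ⟨by positivity, ?_⟩
    have h3 : Real.logb ρ I.P = 1 / Real.log ρ * Real.log I.P := by
      rw [Real.logb]; ring
    rw [mul_right_comm, h3]
    gcongr
    have h4 : 0 ≤ 1 / Real.log ρ := by positivity
    have h5 : (0:ℝ) < ρ ^ (2 * b) := by positivity
    have h6 : (2 * b + 2 + 1 / Real.log ρ * Real.log I.P) ≤
        (2 * b + 2 + 1 / Real.log ρ) * (1 + Real.log I.P) := by nlinarith
    have h7 := mul_le_mul_of_nonneg_right h6 h5.le
    nlinarith
  · rw [← zpow_mul] at hy ⊢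
    refine (DensityBins.load_le hρ hb hA ht hy).trans ?_
    have := DensityBins.card_highBins_le_P hρ hb hA ht hy hne
    gcongr

theorem exists_competitive_D {ρ : ℝ} (hρ : 1 < ρ) :
    ∃ (A : SemiclairvoyantAlgorithm ρ) (C : ℝ), 0 < C ∧
      A.IsCompetitive fun I => C * (1 + Real.log I.D) := by
  obtain ⟨b, hb⟩ := DensityBins.exists_largeBase hρ
  have hB := hb.two_le hρ
  have hL : 0 < Real.log ρ := Real.log_pos hρ
  have hc := DensityBins.lowConst_pos (b := b) hρ
  refine ⟨(DensityBins.rule ρ b).algorithm ρ,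
    ((3 + 1 / Real.log ρ) * ρ ^ (2 * b) + DensityBins.lowConst ρ b) * ρ ^ b, by positivity, ?_⟩
  refine Rule.isCompetitive_of_load_le (B := ρ ^ b) _ _
    (fun I => (3 + Real.logb ρ I.D) * ρ ^ (2 * b) + DensityBins.lowConst ρ b) (by linarith)
    (fun I hne => ?_) fun I A S hA hne t ht y hy => ?_
  · have hD : 1 ≤ I.D := DensityBins.one_le_maxRatio
      (fun q hq => div_pos (I.weight_pos q hq) (I.proc_pos q hq)) hne
    have h1 := Real.log_nonneg hD
    have h2 := Real.logb_nonneg hρ hD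
    refine ⟨by positivity, ?_⟩
    have h3 : Real.logb ρ I.D = 1 / Real.log ρ * Real.log I.D := by
      rw [Real.logb]; ring
    rw [mul_right_comm, h3]
    gcongr
    have h4 : 0 ≤ 1 / Real.log ρ := by positivity
    have h5 : (0:ℝ) < ρ ^ (2 * b) := by positivity
    have h6 : (3 + 1 / Real.log ρ * Real.log I.D) ≤
        (3 + 1 / Real.log ρ) * (1 + Real.log I.D) := by nlinarith
    have h7 := mul_le_mul_of_nonneg_right h6 h5.le
    nlinarith
  · rw [← zpow_mul] at hy ⊢
    refine (DensityBins.load_le hρ hb hA ht hy).trans ?_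
    have := DensityBins.card_highBins_le_D (b := b) (A := A) (t := t) (y := y) hρ hne
    gcongr

end FlowTime

namespace FlowTime

namespace Slots

/-! ### Ranks inside the rows of a set of jobs -/

section rank
variable {α : Type*} [LinearOrder α] (row : ℕ → ℤ) (ord : ℕ → α) (p : ℕ → ℝ)

/-- The rank of `q` among the members of `X` in its row, counted from one. -/
def rank (X : Finset ℕ) (q : ℕ) : ℕ := (X.filter fun x => row x = row q ∧ ord x ≤ ord q).card

/-- Total size of the jobs beyond the first `k j` ones of each row `j`. -/
def excess (X : Finset ℕ) (k : ℤ → ℕ) : ℝ := ∑ q ∈ X with k (row q) < rank row ord X q, p q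

variable {row ord p} {X : Finset ℕ} {q q' z : ℕ}

theorem one_le_rank (hq : q ∈ X) : 1 ≤ rank row ord X q :=
  Finset.card_pos.2 ⟨q, Finset.mem_filter.2 ⟨hq, rfl, le_rfl⟩⟩

theorem rank_lt_rank (hq' : q' ∈ X) (hrow : row q = row q') (h : ord q < ord q') :
    rank row ord X q < rank row ord X q' := by
  refine Finset.card_lt_card ⟨fun x hx => ?_, fun hs => ?_⟩
  · obtain ⟨h1, h2, h3⟩ := Finset.mem_filter.1 hx
    exact Finset.mem_filter.2 ⟨h1, h2.trans hrow, h3.trans h.le⟩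
  · have := (Finset.mem_filter.1 (hs (Finset.mem_filter.2 ⟨hq', rfl, le_rfl⟩))).2.2
    exact absurd this (not_le.2 h)

theorem rank_inj (hord : Function.Injective ord) (hq : q ∈ X) (hq' : q' ∈ X)
    (hrow : row q = row q') (h : rank row ord X q = rank row ord X q') : q = q' := by
  rcases lt_trichotomy (ord q) (ord q') with h1 | h1 | h1
  · exact absurd h (rank_lt_rank hq' hrow h1).ne
  · exact hord h1
  · exact absurd h (rank_lt_rank hq hrow.symm h1).ne'

theorem rank_insert_le : rank row ord (insert z X) q ≤ rank row ord X q + 1 := by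
  unfold rank
  rw [Finset.filter_insert]
  split_ifs
  · exact Finset.card_insert_le _ _
  · omega

theorem rank_insert_of_not (h : ¬ (row z = row q ∧ ord z ≤ ord q)) :
    rank row ord (insert z X) q = rank row ord X q := by
  unfold rank
  rw [Finset.filter_insert, if_neg h]

/-- The jobs of `X` in front of `z` have distinct ranks between 1 and their number, so every such
rank occurs. -/
theorem exists_rank (hord : Function.Injective ord) (hz : z ∉ X) {i : ℕ} (hi : 1 ≤ i)
    (hiz : i < rank row ord (insert z X) z) :
    ∃ x ∈ X, row x = row z ∧ ord x < ord z ∧ rank row ord X x = i := by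
  classical
  set G := X.filter fun x => row x = row z ∧ ord x ≤ ord z with hG
  have hcard : rank row ord (insert z X) z = G.card + 1 := by
    unfold rank
    rw [Finset.filter_insert, if_pos ⟨rfl, le_rfl⟩, Finset.card_insert_of_notMem]
    exact fun h => hz (Finset.mem_filter.1 h).1
  have hsub : G.image (rank row ord X) ⊆ Finset.Icc 1 G.card := by
    intro j hj
    obtain ⟨x, hx, rfl⟩ := Finset.mem_image.1 hj
    obtain ⟨h1, h2, h3⟩ := Finset.mem_filter.1 hx
    refine Finset.mem_Icc.2 ⟨one_le_rank h1, Finset.card_le_card fun y hy => ?_⟩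
    obtain ⟨h4, h5, h6⟩ := Finset.mem_filter.1 hy
    exact Finset.mem_filter.2 ⟨h4, h5.trans h2, h6.trans h3⟩
  have himg : (G.image (rank row ord X)).card = G.card := by
    refine Finset.card_image_of_injOn fun x hx y hy hxy => ?_
    have hx := Finset.mem_filter.1 (Finset.mem_coe.1 hx)
    have hy := Finset.mem_filter.1 (Finset.mem_coe.1 hy)
    exact rank_inj hord hx.1 hy.1 (hx.2.1.trans hy.2.1.symm) hxy
  have heq := Finset.eq_of_subset_of_card_le hsub (by rw [himg]; simp)
  have : i ∈ G.image (rank row ord X) := by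
    rw [heq]; exact Finset.mem_Icc.2 ⟨hi, by omega⟩
  obtain ⟨x, hx, hxi⟩ := Finset.mem_image.1 this
  obtain ⟨h1, h2, h3⟩ := Finset.mem_filter.1 hx
  exact ⟨x, h1, h2, lt_of_le_of_ne h3 fun h => hz (hord h ▸ h1), hxi⟩

/-- Either `z` lies beyond the border and no other job crosses it, or `z` pushes at most one job
across, the one of rank `k (row z)`. That job stands behind `z`, so it is no larger. -/
theorem excess_insert_le (hord : Function.Injective ord) (hp : ∀ q, q ∈ insert z X → 0 ≤ p q)
    (hz : z ∉ X) (k : ℤ → ℕ) (h : ∀ x ∈ X, row x = row z → ord z < ord x → p x ≤ p z) :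
    excess row ord p (insert z X) k ≤ excess row ord p X k + p z := by
  classical
  unfold excess
  have hzp := hp z (Finset.mem_insert_self _ _)
  by_cases hk : k (row z) < rank row ord (insert z X) z
  · rw [Finset.filter_insert, if_pos hk, Finset.sum_insert (fun h => hz (Finset.mem_filter.1 h).1),
      add_comm]
    gcongr ?_ + _
    refine Finset.sum_le_sum_of_subset_of_nonneg (fun q hq => ?_) fun q hq _ =>
      hp q (Finset.mem_insert_of_mem (Finset.mem_filter.1 hq).1)
    obtain ⟨h1, h2⟩ := Finset.mem_filter.1 hq
    refine Finset.mem_filter.2 ⟨h1, ?_⟩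
    by_cases hzq : row z = row q ∧ ord z ≤ ord q
    · have hlt : ord z < ord q := lt_of_le_of_ne hzq.2 fun h => hz (hord h ▸ h1)
      have := rank_lt_rank (X := insert z X) (Finset.mem_insert_of_mem h1) hzq.1 hlt
      have := rank_insert_le (row := row) (ord := ord) (X := X) (q := q) (z := z)
      rw [← hzq.1]
      omega
    · rwa [rank_insert_of_not hzq] at h2
  · rw [Finset.filter_insert, if_neg hk]
    set E := X.filter fun q => k (row q) < rank row ord X q
    set E' := X.filter fun q => k (row q) < rank row ord (insert z X) q
    have hD : ∀ q ∈ E' \ E, row q = row z ∧ ord z < ord q ∧ rank row ord X q = k (row z) ∧ q ∈ X := by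
      intro q hq
      obtain ⟨h1, h2⟩ := Finset.mem_sdiff.1 hq
      obtain ⟨h1, h3⟩ := Finset.mem_filter.1 h1
      have h4 : ¬ k (row q) < rank row ord X q := fun h => h2 (Finset.mem_filter.2 ⟨h1, h⟩)
      by_cases hzq : row z = row q ∧ ord z ≤ ord q
      · have := rank_insert_le (row := row) (ord := ord) (X := X) (q := q) (z := z)
        rw [hzq.1]
        exact ⟨rfl, lt_of_le_of_ne hzq.2 fun h => hz (hord h ▸ h1), by omega, h1⟩
      · rw [rank_insert_of_not hzq] at h3
        exact absurd h3 h4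
    have h1 : ∑ q ∈ E', p q ≤ ∑ q ∈ E ∪ (E' \ E), p q := by
      refine Finset.sum_le_sum_of_subset_of_nonneg (fun q hq => ?_) fun q hq _ => ?_
      · by_cases h : q ∈ E
        · exact Finset.mem_union_left _ h
        · exact Finset.mem_union_right _ (Finset.mem_sdiff.2 ⟨hq, h⟩)
      · refine hp q (Finset.mem_insert_of_mem ?_)
        rcases Finset.mem_union.1 hq with h | h
        · exact (Finset.mem_filter.1 h).1
        · exact (hD q h).2.2.2
    rw [Finset.sum_union Finset.disjoint_sdiff] at h1
    have h2 : ∑ q ∈ E' \ E, p q ≤ p z := by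
      rcases (E' \ E).eq_empty_or_nonempty with he | ⟨y, hy⟩
      · rw [he]; simpa
      · have hy' := hD y hy
        have : E' \ E = {y} := Finset.eq_singleton_iff_unique_mem.2 ⟨hy, fun x hx => by
          have hx' := hD x hx
          exact rank_inj hord hx'.2.2.2 hy'.2.2.2 (hx'.1.trans hy'.1.symm)
            (hx'.2.2.1.trans hy'.2.2.1.symm)⟩
        rw [this, Finset.sum_singleton]
        exact h y hy'.2.2.2 hy'.1 hy'.2.1
    linarith

/-- The border advances by at least one in the row of `z`, which offsets the shift of ranks. If `z`
is itself beyond the new border, the `c` jobs of ranks `k + 1` to `k + c` in front of it come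
inside, and each has at least a `c`-th of its size. -/
theorem excess_insert_le_of_add_le (hord : Function.Injective ord)
    (hp : ∀ q, q ∈ insert z X → 0 ≤ p q) (hz : z ∉ X) {c : ℕ} (hc : 1 ≤ c) {k k' : ℤ → ℕ}
    (hk : ∀ j, k j ≤ k' j) (hkz : k (row z) + c ≤ k' (row z))
    (h : ∀ x ∈ X, row x = row z → ord x < ord z → p z ≤ c * p x) :
    excess row ord p (insert z X) k' ≤ excess row ord p X k := by
  classical
  unfold excess
  set E := X.filter fun q => k (row q) < rank row ord X q
  set E' := X.filter fun q => k' (row q) < rank row ord (insert z X) q with hE'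
  have hsub : E' ⊆ E := by
    intro q hq
    obtain ⟨h1, h2⟩ := Finset.mem_filter.1 hq
    refine Finset.mem_filter.2 ⟨h1, ?_⟩
    have h3 := hk (row q)
    by_cases hzq : row z = row q ∧ ord z ≤ ord q
    · have := rank_insert_le (row := row) (ord := ord) (X := X) (q := q) (z := z)
      rw [hzq.1] at hkz
      omega
    · rw [rank_insert_of_not hzq] at h2
      omega
  have hpE : ∀ q ∈ E, 0 ≤ p q := fun q hq => hp q (Finset.mem_insert_of_mem (Finset.mem_filter.1 hq).1)
  by_cases hkz' : k' (row z) < rank row ord (insert z X) z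
  · rw [Finset.filter_insert, if_pos hkz', Finset.sum_insert (fun h => hz (Finset.mem_filter.1 h).1)]
    choose! f hf using fun i (hi : i ∈ Finset.Icc (k (row z) + 1) (k (row z) + c)) =>
      exists_rank (row := row) hord hz (i := i) (by have := (Finset.mem_Icc.1 hi).1; omega)
        (by have := (Finset.mem_Icc.1 hi).2; omega)
    set W := (Finset.Icc (k (row z) + 1) (k (row z) + c)).image f
    have hW : W.card = c := by
      rw [Finset.card_image_of_injOn, Nat.card_Icc]
      · omega
      · intro i hi j hj hij
        rw [← (hf i hi).2.2.2, ← (hf j hj).2.2.2, hij]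
    have hWs : ∀ x ∈ W, x ∈ X ∧ row x = row z ∧ ord x < ord z ∧ k (row z) < rank row ord X x ∧
        rank row ord X x ≤ k (row z) + c := by
      intro x hx
      obtain ⟨i, hi, rfl⟩ := Finset.mem_image.1 hx
      have h1 := hf i hi
      have := Finset.mem_Icc.1 hi
      exact ⟨h1.1, h1.2.1, h1.2.2.1, by omega, by omega⟩
    have hdisj : Disjoint W E' := by
      rw [Finset.disjoint_left]
      intro x hx hx'
      have h1 := hWs x hx
      have h2 := (Finset.mem_filter.1 hx').2
      rw [rank_insert_of_not fun h => absurd h.2 (not_le.2 h1.2.2.1), h1.2.1] at h2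
      omega
    have h1 : ∑ q ∈ W ∪ E', p q ≤ ∑ q ∈ E, p q := by
      refine Finset.sum_le_sum_of_subset_of_nonneg (Finset.union_subset (fun x hx => ?_) hsub)
        fun q hq _ => hpE q hq
      have h1 := hWs x hx
      exact Finset.mem_filter.2 ⟨h1.1, by rw [h1.2.1]; exact h1.2.2.2.1⟩
    rw [Finset.sum_union hdisj] at h1
    have h2 : p z ≤ ∑ q ∈ W, p q := by
      have h3 : ∑ q ∈ W, p z / c ≤ ∑ q ∈ W, p q := by
        refine Finset.sum_le_sum fun x hx => ?_
        have h1 := hWs x hx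
        rw [div_le_iff₀ (by exact_mod_cast hc), mul_comm]
        exact h x h1.1 h1.2.1 h1.2.2.1
      rw [Finset.sum_const, hW, nsmul_eq_mul] at h3
      have hc' : (c:ℝ) ≠ 0 := by
        have : c ≠ 0 := by omega
        exact_mod_cast this
      rwa [mul_div_cancel₀ _ hc'] at h3
    linarith
  · rw [Finset.filter_insert, if_neg hkz']
    exact Finset.sum_le_sum_of_subset_of_nonneg hsub fun q hq _ => hpE q hq

end rank

end Slots
end FlowTime

namespace FlowTime

theorem Schedule.Obeys.run_eq {ρ : ℝ} {I : Instance} {A : Schedule I} {R : Rule}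
    (hA : A.Obeys ρ R) (t : ℝ) : A.run t = R.dec (history ρ A t) := by
  rcases le_or_gt 0 t with ht | ht
  · exact hA t ht
  · have hal : ∀ q, q ∉ A.alive t := fun q hq => by
      have h := A.mem_alive.1 hq
      linarith [I.release_nonneg q h.1]
    have h1 : A.run t = none := by
      by_contra h
      obtain ⟨q, hq⟩ := Option.ne_none_iff_exists'.1 h
      exact hal q (A.mem_alive_of_run hq)
    rw [h1, eq_comm]
    by_contra h
    obtain ⟨q, hq⟩ := Option.ne_none_iff_exists'.1 h
    exact hal q (A.pending_history.1 (R.pending _ _ hq))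

namespace Slots

/-! ### The rule -/

section rule
variable (ρ : ℝ)

/-- Release and completion times. -/
def eventTimes (h : History) : Set ℝ :=
  {u | ∃ q i, h q = some i ∧ (i.release = u ∨ i.completedAt = some u)}

open Classical in
/-- The information that was available just before the last event. -/
noncomputable def prev (h : History) : History := fun q => (h q).bind fun i =>
  if i.release < sSup (eventTimes h) then
    some { i with completedAt := i.completedAt.bind fun c =>
            if c < sSup (eventTimes h) then some c else none }
  else none

/-- The row of a job: its weight class. -/
noncomputable def infoRow (h : History) (q : ℕ) : ℤ := (h q).elim 0 fun i => jobClass ρ i.weight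

/-- Large classes first, and in a class the older jobs first. -/
noncomputable def infoOrd (h : History) (q : ℕ) : ℤ ×ₗ ℝ ×ₗ ℕ :=
  toLex (-(h q).elim 0 JobInfo.cls, toLex ((h q).elim 0 JobInfo.release, q))

/-- The slot of a job: the one it received when it was interrupted, or, as long as this number is
zero, the rank of the job among the other such jobs of its row. -/
noncomputable def infoPos (slot : ℕ → ℕ) (h : History) (q : ℕ) : ℕ :=
  if slot q = 0 then
    {x | Pending h x ∧ slot x = 0 ∧ infoRow ρ h x = infoRow ρ h q ∧ infoOrd h x ≤ infoOrd h q}.ncard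
  else slot q

/-- The weight of the slots of the row up to the slot of the job; among equals, interrupted jobs come
first. -/
noncomputable def key (slot : ℕ → ℕ) (h : History) (q : ℕ) : ℝ ×ₗ ℕ :=
  toLex (ρ ^ infoRow ρ h q * infoPos ρ slot h q, if slot q = 0 then 0 else 1)

open Classical in
/-- The slots after the next event. -/
noncomputable def next (slot : ℕ → ℕ) (h : History) (q : ℕ) : ℕ :=
  if slot q ≠ 0 then slot q
  else if (Rule.ofKey (key ρ slot)).dec h = some q then infoPos ρ slot h q else 0

/-- Recursion over the number of past events; `prev` recovers the earlier information, which makes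
the slots a function of the history alone. A job that is running when an event occurs counts as
interrupted even if it is resumed at once. -/
noncomputable def slotAfter : ℕ → History → ℕ → ℕ
  | 0, _ => 0
  | n + 1, h => next ρ (slotAfter n (prev h)) (prev h)

/-- The slots of the interrupted jobs. -/
noncomputable def slot (h : History) : ℕ → ℕ := slotAfter ρ (eventTimes h).ncard h

/-- Run the last slot of the row whose slots are the heaviest. -/
noncomputable def rule : Rule := Rule.ofKey fun h => key ρ (slot ρ h) h

end rule

/-! ### The rule on an instance -/

section schedule
variable {ρ : ℝ} {I : Instance} {A S : Schedule I}

theorem events_nonneg {e : ℝ} (he : e ∈ A.events) : 0 ≤ e := by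
  classical
  rcases Finset.mem_union.1 he with h | h
  · obtain ⟨q, hq, rfl⟩ := Finset.mem_image.1 h
    exact I.release_nonneg q hq
  · obtain ⟨q, hq, rfl⟩ := Finset.mem_image.1 h
    exact (A.completion_mem q hq).1

theorem eventTimes_history (t : ℝ) : eventTimes (history ρ A t) = {u | u ∈ A.events ∧ u ≤ t} := by
  classical
  ext u
  simp only [eventTimes, mem_ofPred_eq]
  constructor
  · rintro ⟨q, i, hi, h⟩
    unfold history at hi
    split_ifs at hi with h1 h2
    · obtain rfl := Option.some.inj hi
      rcases h with rfl | h
      · exact ⟨A.release_mem_events h1.1, h1.2⟩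
      · obtain rfl := Option.some.inj h
        exact ⟨A.completion_mem_events h1.1, h2⟩
    · obtain rfl := Option.some.inj hi
      rcases h with rfl | h
      · exact ⟨A.release_mem_events h1.1, h1.2⟩
      · exact absurd h (by simp)
  · rintro ⟨hu, hut⟩
    rcases Finset.mem_union.1 hu with h | h
    · obtain ⟨q, hq, rfl⟩ := Finset.mem_image.1 h
      exact ⟨q, _, if_pos ⟨hq, hut⟩, Or.inl rfl⟩
    · obtain ⟨q, hq, rfl⟩ := Finset.mem_image.1 h
      exact ⟨q, _, if_pos ⟨hq, (A.release_lt_completion q hq).le.trans hut⟩, Or.inr (if_pos hut)⟩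

/-- No event lies strictly between `s` and `e`, so an event is earlier than `e` exactly if it is not
later than `s`. -/
theorem prev_history {s e : ℝ} (hse : s < e) (he : e ∈ A.events)
    (hgap : ∀ u ∈ A.events, u ≤ s ∨ e ≤ u) : prev (history ρ A e) = history ρ A s := by
  classical
  have hsup : sSup (eventTimes (history ρ A e)) = e := by
    rw [eventTimes_history]
    exact (show IsGreatest {u | u ∈ A.events ∧ u ≤ e} e from ⟨⟨he, le_rfl⟩, fun u hu => hu.2⟩).csSup_eq
  have hiff : ∀ u ∈ A.events, u < e ↔ u ≤ s := fun u hu =>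
    ⟨fun h => (hgap u hu).resolve_right (not_le.2 h), fun h => h.trans_lt hse⟩
  funext q
  unfold prev
  rw [hsup]
  by_cases hq : q ∈ I.jobs
  · have hr := hiff _ (A.release_mem_events hq)
    have hc := hiff _ (A.completion_mem_events hq)
    unfold history
    by_cases h1 : I.release q ≤ s
    · rw [if_pos ⟨hq, h1.trans hse.le⟩,
        if_pos (show q ∈ I.jobs ∧ I.release q ≤ s from ⟨hq, h1⟩)]
      simp only [Option.bind_some, if_pos (hr.2 h1)]
      by_cases h2 : A.completion q ≤ s
      · simp [h2, h2.trans hse.le, hc.2 h2]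
      · by_cases h3 : A.completion q ≤ e
        · simp [h2, h3, mt hc.1 h2]
        · simp [h2, h3]
    · by_cases h3 : I.release q ≤ e
      · rw [if_pos ⟨hq, h3⟩,
          if_neg (show ¬ (q ∈ I.jobs ∧ I.release q ≤ s) from fun h => h1 h.2)]
        simp only [Option.bind_some, if_neg (mt hr.1 h1)]
      · rw [if_neg fun h => h3 h.2, if_neg fun h => h1 h.2]; rfl
  · unfold history
    rw [if_neg fun h => hq h.1, if_neg fun h => hq h.1]; rfl

theorem slot_history {s e : ℝ} (hse : s < e) (he : e ∈ A.events)
    (hgap : ∀ u ∈ A.events, u ≤ s ∨ e ≤ u) :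
    slot ρ (history ρ A e) = next ρ (slot ρ (history ρ A s)) (history ρ A s) := by
  have hcard : (eventTimes (history ρ A e)).ncard = (eventTimes (history ρ A s)).ncard + 1 := by
    have hins : eventTimes (history ρ A e) = insert e (eventTimes (history ρ A s)) := by
      ext u
      simp only [eventTimes_history, mem_insert_iff, mem_ofPred_eq]
      constructor
      · rintro ⟨h1, h2⟩
        rcases hgap u h1 with h | h
        · exact Or.inr ⟨h1, h⟩
        · exact Or.inl (le_antisymm h2 h)
      · rintro (rfl | ⟨h1, h2⟩)
        · exact ⟨he, le_rfl⟩
        · exact ⟨h1, h2.trans hse.le⟩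
    rw [hins, ncard_insert_of_notMem (fun h => ?_) (by
      rw [eventTimes_history]; exact A.events.finite_toSet.subset fun u hu => hu.1)]
    rw [eventTimes_history] at h
    exact absurd h.2 (not_le.2 hse)
  conv_lhs => rw [slot, hcard, slotAfter, prev_history hse he hgap]
  rfl

theorem slot_history_of_neg {s : ℝ} (hs : s < 0) : slot ρ (history ρ A s) = 0 := by
  have : eventTimes (history ρ A s) = ∅ := by
    rw [eventTimes_history]
    ext u
    simp only [mem_ofPred_eq, mem_empty_iff_false, iff_false]
    rintro ⟨h1, h2⟩
    linarith [events_nonneg h1]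
  rw [slot, this, ncard_empty]; rfl

end schedule

end Slots

namespace Instance
variable (I : Instance) (ρ : ℝ)

noncomputable def row (q : ℕ) : ℤ := jobClass ρ (I.weight q)

noncomputable def ord (q : ℕ) : ℤ ×ₗ ℝ ×ₗ ℕ :=
  toLex (-jobClass ρ (I.proc q), toLex (I.release q, q))

theorem ord_injective : Function.Injective (I.ord ρ) := fun q q' h => by
  have h1 := congrArg (fun x => (ofLex (ofLex x).2).2) h
  exact h1

end Instance

namespace Slots
section schedule
variable {ρ : ℝ} {I : Instance} {A S : Schedule I}

/-- The jobs that wait uninterrupted. -/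
noncomputable def fulls (ρ : ℝ) (A : Schedule I) (t : ℝ) : Finset ℕ :=
  {q ∈ A.alive t | slot ρ (history ρ A t) q = 0}

theorem mem_fulls {t : ℝ} {q : ℕ} :
    q ∈ fulls ρ A t ↔ q ∈ A.alive t ∧ slot ρ (history ρ A t) q = 0 := Finset.mem_filter

/-- The slot of a pending job. -/
noncomputable def pos (ρ : ℝ) (A : Schedule I) (t : ℝ) (q : ℕ) : ℕ :=
  if slot ρ (history ρ A t) q = 0 then rank (I.row ρ) (I.ord ρ) (fulls ρ A t) q
  else slot ρ (history ρ A t) q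

theorem infoRow_of_alive {t : ℝ} {q : ℕ} (hq : q ∈ A.alive t) :
    infoRow ρ (history ρ A t) q = I.row ρ q := by
  unfold infoRow; rw [DensityBins.history_of_alive hq]; rfl

theorem infoOrd_of_alive {t : ℝ} {q : ℕ} (hq : q ∈ A.alive t) :
    infoOrd (history ρ A t) q = I.ord ρ q := by
  unfold infoOrd; rw [DensityBins.history_of_alive hq]; rfl

theorem infoPos_of_alive {t : ℝ} {q : ℕ} (hq : q ∈ A.alive t) :
    infoPos ρ (slot ρ (history ρ A t)) (history ρ A t) q = pos ρ A t q := by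
  unfold infoPos pos rank
  congr 1
  rw [← ncard_coe_finset]
  congr 1
  ext x
  simp only [mem_ofPred_eq, Finset.coe_filter, A.pending_history, mem_fulls, and_assoc]
  refine and_congr_right fun hx => ?_
  rw [infoRow_of_alive hx, infoRow_of_alive hq, infoOrd_of_alive hx, infoOrd_of_alive hq]

theorem one_le_pos {t : ℝ} {q : ℕ} (hq : q ∈ A.alive t) : 1 ≤ pos ρ A t q := by
  unfold pos
  split_ifs with h
  · exact one_le_rank (mem_fulls.2 ⟨hq, h⟩)
  · omega

/-- The second part is the tie-break in favour of interrupted jobs, which keeps their slots distinct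
within a row. -/
theorem run_spec (hA : A.Obeys ρ (rule ρ)) {t : ℝ} {r q : ℕ} (hr : A.run t = some r)
    (hq : q ∈ A.alive t) :
    ρ ^ I.row ρ q * pos ρ A t q ≤ ρ ^ I.row ρ r * pos ρ A t r ∧
    (ρ ^ I.row ρ q * pos ρ A t q = ρ ^ I.row ρ r * pos ρ A t r → slot ρ (history ρ A t) r = 0 →
      slot ρ (history ρ A t) q = 0) := by
  have hra := A.mem_alive_of_run hr
  rw [hA.run_eq t] at hr
  have h := Rule.ofKey_le _ hr (A.pending_history.2 hq)
  unfold key at h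
  rw [infoRow_of_alive hq, infoRow_of_alive hra, infoPos_of_alive hq, infoPos_of_alive hra,
    Prod.Lex.toLex_le_toLex] at h
  rcases h with h | ⟨h1, h2⟩
  · exact ⟨h.le, fun h' => absurd h' h.ne⟩
  · refine ⟨h1.le, fun _ h0 => ?_⟩
    simp only [h0, if_true] at h2
    by_contra hne
    simp [hne] at h2

theorem next_history (hA : A.Obeys ρ (rule ρ)) (s : ℝ) (q : ℕ) :
    next ρ (slot ρ (history ρ A s)) (history ρ A s) q =
      if slot ρ (history ρ A s) q ≠ 0 then slot ρ (history ρ A s) q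
      else if A.run s = some q then pos ρ A s q else 0 := by
  classical
  have hrun : (Rule.ofKey (key ρ (slot ρ (history ρ A s)))).dec (history ρ A s) = A.run s :=
    (hA.run_eq s).symm
  unfold next
  rw [hrun]
  split_ifs with h1 h2
  · rfl
  · exact infoPos_of_alive (A.mem_alive_of_run h2)
  · rfl

end schedule
end Slots
end FlowTime

/-! ### Granted slots and the effect of releases -/

namespace FlowTime

theorem elapsed_eq_of_not_run {run : ℝ → Option ℕ} {q : ℕ} {s e : ℝ} (hse : s ≤ e)
    (h : ∀ u, s ≤ u → u < e → run u ≠ some q) : elapsed run q e = elapsed run q s := by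
  unfold elapsed
  congr 2
  ext u
  simp only [mem_ofPred_eq]
  constructor
  · rintro ⟨h1, h2, h3⟩
    exact ⟨h1, by by_contra hn; exact h u (not_lt.1 hn) h2 h3, h3⟩
  · rintro ⟨h1, h2, h3⟩
    exact ⟨h1, by linarith, h3⟩

namespace Slots

/-- How many slots of row `j` weigh `K`. -/
noncomputable def numSlots (ρ K : ℝ) (j : ℤ) : ℕ := ⌊K / ρ ^ j⌋₊

section
variable {ρ : ℝ} {I : Instance} {A S : Schedule I}

/-- A slot lies beyond those of weight `K` exactly if its key exceeds `K`: a single threshold on the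
key describes the border in all rows. -/
theorem numSlots_lt (hρ : 1 < ρ) {K : ℝ} {j : ℤ} {n : ℕ} (hn : 1 ≤ n) :
    numSlots ρ K j < n ↔ K < ρ ^ j * n := by
  unfold numSlots
  have hj : 0 < ρ ^ j := zpow_pos (by linarith) j
  rw [Nat.floor_lt' (by omega), div_lt_iff₀ hj, mul_comm]

theorem numSlots_mono (hρ : 1 < ρ) {K K' : ℝ} (h : K ≤ K') (j : ℤ) :
    numSlots ρ K j ≤ numSlots ρ K' j := by
  have hj : 0 < ρ ^ j := zpow_pos (by linarith) j
  exact Nat.floor_mono (by gcongr)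

theorem numSlots_add (hρ : 1 < ρ) {K w : ℝ} (hK : 0 ≤ K) (c : ℕ) {j : ℤ} (h : ρ ^ j ≤ w) :
    numSlots ρ K j + c ≤ numSlots ρ (K + c * w) j := by
  have hj : 0 < ρ ^ j := zpow_pos (by linarith) j
  unfold numSlots
  rw [← Nat.floor_add_natCast (by positivity)]
  refine Nat.floor_mono ?_
  rw [add_div, mul_div_assoc]
  have : 1 ≤ w / ρ ^ j := by rwa [le_div_iff₀ hj, one_mul]
  have hc : (0:ℝ) ≤ c := by positivity
  nlinarith

theorem row_spec (hρ : 1 < ρ) {q : ℕ} (hq : q ∈ I.jobs) :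
    ρ ^ I.row ρ q ≤ I.weight q ∧ I.weight q < ρ ^ (I.row ρ q + 1) :=
  ⟨(le_jobClass hρ (I.weight_pos q hq) _).1 le_rfl,
    (jobClass_lt hρ (I.weight_pos q hq) _).1 (lt_add_one _)⟩

theorem cls_lt (hρ : 1 < ρ) {q q' : ℕ} (hq : q ∈ I.jobs) (hq' : q' ∈ I.jobs)
    (h : jobClass ρ (I.proc q) < jobClass ρ (I.proc q')) : I.proc q ≤ I.proc q' :=
  ((jobClass_lt hρ (I.proc_pos q hq) _).1 h).le.trans
    ((le_jobClass hρ (I.proc_pos q' hq') _).1 le_rfl)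

theorem proc_le_mul (hρ : 1 < ρ) {q q' : ℕ} (hq : q ∈ I.jobs) (hq' : q' ∈ I.jobs)
    (h : jobClass ρ (I.proc q) ≤ jobClass ρ (I.proc q')) : I.proc q ≤ ρ * I.proc q' := by
  have h1 := (jobClass_lt hρ (I.proc_pos q hq) _).1 (Int.lt_add_one_of_le h)
  have h2 := (le_jobClass hρ (I.proc_pos q' hq') _).1 le_rfl
  rw [zpow_add_one₀ (by linarith)] at h1
  nlinarith

theorem ord_lt {q q' : ℕ} (h : I.ord ρ q < I.ord ρ q') :
    jobClass ρ (I.proc q') < jobClass ρ (I.proc q) ∨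
      jobClass ρ (I.proc q') = jobClass ρ (I.proc q) ∧ (I.release q < I.release q' ∨
        I.release q = I.release q' ∧ q < q') := by
  unfold Instance.ord at h
  simp only [Prod.Lex.toLex_lt_toLex] at h
  rcases h with h | ⟨h1, h2⟩
  · left; linarith
  · right; exact ⟨by linarith, h2⟩

/-- When new jobs arrive, the excess grows by at most the size of those among them that do not
widen the slots. -/
theorem excess_union_le (hρ : 1 < ρ) {c : ℕ} (hc : ρ ≤ c) {X Y O : Finset ℕ} {e K : ℝ}
    (hX : ∀ x ∈ X, x ∈ I.jobs ∧ I.release x < e) (hY : ∀ y ∈ Y, y ∈ I.jobs ∧ I.release y = e)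
    (hK : 0 ≤ K) :
    excess (I.row ρ) (I.ord ρ) I.proc (Y ∪ X)
        (numSlots ρ (K + c * ∑ q ∈ Y with q ∈ O, I.weight q)) ≤
      excess (I.row ρ) (I.ord ρ) I.proc X (numSlots ρ K) + ∑ q ∈ Y with q ∉ O, I.proc q := by
  classical
  have hc1 : 1 ≤ c := by
    have : (1:ℝ) < c := hρ.trans_le hc
    exact_mod_cast this.le
  -- New jobs enter in increasing order of name, so each comes last in its row and class, and all
  -- jobs behind it have a smaller class.
  induction Y using Finset.induction_on_max with
  | empty => simp
  | insert z Y hz ih =>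
    have ih := ih fun y hy => hY y (Finset.mem_insert_of_mem hy)
    obtain ⟨hzj, hze⟩ := hY z (Finset.mem_insert_self _ _)
    have hzY : z ∉ Y := fun h => lt_irrefl _ (hz z h)
    have hzX : z ∉ Y ∪ X := by
      rw [Finset.mem_union]
      rintro (h | h)
      · exact hzY h
      · linarith [(hX z h).2]
    have hYX : ∀ x ∈ Y ∪ X, x ∈ I.jobs ∧ (I.release x < I.release z ∨
        I.release x = I.release z ∧ x < z) := by
      intro x hx
      rcases Finset.mem_union.1 hx with h | h
      · have := hY x (Finset.mem_insert_of_mem h)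
        exact ⟨this.1, Or.inr ⟨this.2.trans hze.symm, hz x h⟩⟩
      · exact ⟨(hX x h).1, Or.inl (by rw [hze]; exact (hX x h).2)⟩
    have hp : ∀ q ∈ insert z (Y ∪ X), 0 ≤ I.proc q := by
      intro q hq
      rcases Finset.mem_insert.1 hq with rfl | hq
      · exact (I.proc_pos q hzj).le
      · exact (I.proc_pos q (hYX q hq).1).le
    have hK' : 0 ≤ K + c * ∑ q ∈ Y with q ∈ O, I.weight q := by
      refine add_nonneg hK (mul_nonneg (by positivity) (Finset.sum_nonneg fun q hq => ?_))
      exact (I.weight_pos q (hY q (Finset.mem_insert_of_mem (Finset.mem_filter.1 hq).1)).1).le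
    rw [Finset.insert_union]
    by_cases hzO : z ∈ O
    · rw [Finset.filter_insert, if_pos hzO, Finset.filter_insert, if_neg (not_not.2 hzO),
        Finset.sum_insert fun h => hzY (Finset.mem_filter.1 h).1]
      refine le_trans ?_ ih
      -- A job of `O` weighs at least `ρ` to its row, so its row gains `c` slots. The jobs in front
      -- have at least its class, so `c ≥ ρ` of them suffice to make up its size.
      have hw := row_spec hρ hzj
      have hadd : K + c * (I.weight z + ∑ q ∈ Y with q ∈ O, I.weight q) =
        K + c * ∑ q ∈ Y with q ∈ O, I.weight q + c * I.weight z := by ring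
      rw [hadd]
      have hwz := I.weight_pos z hzj
      refine excess_insert_le_of_add_le (I.ord_injective ρ) hp hzX hc1
        (numSlots_mono hρ (by nlinarith [show (0:ℝ) ≤ c by positivity]))
        (numSlots_add hρ hK' c hw.1) fun x hx _ hlt => ?_
      have hcls : jobClass ρ (I.proc z) ≤ jobClass ρ (I.proc x) := by
        rcases ord_lt hlt with h | h
        · exact h.le
        · exact h.1.le
      have := I.proc_pos x (hYX x hx).1
      calc I.proc z ≤ ρ * I.proc x := proc_le_mul hρ hzj (hYX x hx).1 hcls
        _ ≤ c * I.proc x := by gcongr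
    · rw [Finset.filter_insert, if_neg hzO, Finset.filter_insert, if_pos hzO,
        Finset.sum_insert fun h => hzY (Finset.mem_filter.1 h).1]
      have := excess_insert_le (row := I.row ρ) (I.ord_injective ρ) hp hzX
        (numSlots ρ (K + c * ∑ q ∈ Y with q ∈ O, I.weight q)) fun x hx _ hlt => ?_
      · linarith
      · have hx' := hYX x hx
        rcases ord_lt hlt with h | ⟨_, h | h⟩
        · exact cls_lt hρ hx'.1 hzj h
        · rcases hx'.2 with h' | h'
          · linarith
          · linarith [h'.1]
        · rcases hx'.2 with h' | h'
          · linarith [h.1]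
          · exact absurd h.2 (by omega)

end
end Slots
end FlowTime

/-! ### The invariant for slots and the bound in W -/

namespace FlowTime
namespace Slots
section
variable {ρ : ℝ} {I : Instance} {A S : Schedule I} {O : Finset ℕ} {c : ℕ}

/-- The slots that are granted because of the jobs of `O`. -/
noncomputable def granted (ρ : ℝ) (I : Instance) (O : Finset ℕ) (c : ℕ) (s : ℝ) : ℤ → ℕ :=
  numSlots ρ (c * ∑ q ∈ O with I.release q ≤ s, I.weight q)

open Classical in
/-- The pending jobs outside the granted slots. -/
noncomputable def outside (ρ : ℝ) (A : Schedule I) (O : Finset ℕ) (c : ℕ) (s : ℝ) : Finset ℕ :=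
  {q ∈ A.alive s | granted ρ I O c s (I.row ρ q) < pos ρ A s q}

theorem mem_outside {s : ℝ} {q : ℕ} : q ∈ outside ρ A O c s ↔
    q ∈ A.alive s ∧ granted ρ I O c s (I.row ρ q) < pos ρ A s q := Finset.mem_filter

/-- The released jobs that do not belong to `O`. -/
noncomputable def others (I : Instance) (O : Finset ℕ) (s : ℝ) : Finset ℕ :=
  {q ∈ I.jobs | q ∉ O ∧ I.release q ≤ s}

/-- The interrupted jobs of a row have different slots, and the work that `A` has outside the granted
slots is at most the work that `S` has on the jobs that do not belong to `O`. -/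
structure Inv (ρ : ℝ) (A S : Schedule I) (O : Finset ℕ) (c : ℕ) (s : ℝ) : Prop where
  full : ∀ q, slot ρ (history ρ A s) q = 0 → elapsed A.run q s = 0
  released : ∀ q, slot ρ (history ρ A s) q ≠ 0 → I.release q ≤ s
  inj : ∀ q ∈ A.alive s, ∀ q' ∈ A.alive s, slot ρ (history ρ A s) q ≠ 0 →
    slot ρ (history ρ A s) q = slot ρ (history ρ A s) q' → I.row ρ q = I.row ρ q' → q = q'
  le : ∑ q ∈ outside ρ A O c s, (I.proc q - elapsed A.run q s) ≤
    ∑ q ∈ others I O s, (I.proc q - elapsed S.run q s)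

theorem run_const (hA : A.Obeys ρ (rule ρ)) {s e : ℝ} (hgap : ∀ u ∈ A.events, u ≤ s ∨ e ≤ u)
    {u : ℝ} (hsu : s ≤ u) (hue : u < e) : A.run u = A.run s := by
  rw [hA.run_eq u, hA.run_eq s, A.history_congr ρ hsu fun v hv hsv => ?_]
  rcases hgap v hv with h | h <;> linarith

theorem not_alive_of_neg {s : ℝ} (hs : s < 0) : A.alive s = ∅ := by
  rw [Finset.eq_empty_iff_forall_notMem]
  intro q hq
  have h := A.mem_alive.1 hq
  linarith [I.release_nonneg q h.1]

theorem Inv.of_neg {s : ℝ} (hs : s < 0) : Inv ρ A S O c s where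
  full q _ := elapsed_eq_zero_of_nonpos _ _ hs.le
  released q hq := by rw [slot_history_of_neg hs] at hq; exact absurd rfl hq
  inj q hq := by rw [not_alive_of_neg hs] at hq; simp at hq
  le := by
    rw [outside, not_alive_of_neg hs]
    simp only [Finset.filter_empty, Finset.sum_empty]
    exact Finset.sum_nonneg fun q hq =>
      sub_nonneg.2 (S.elapsed_le q (Finset.mem_filter.1 hq).1 s)

/-- If some pending job lies outside the granted slots, then so does the job that is run, whose key
is largest. The left side falls at rate one, the right side at most at rate one. -/
theorem Inv.flow (hρ : 1 < ρ) (hA : A.Obeys ρ (rule ρ)) {s e : ℝ} (h : Inv ρ A S O c s)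
    (hse : s ≤ e) (hgap : ∀ u ∈ A.events, u ≤ s ∨ e ≤ u) :
    ∑ q ∈ outside ρ A O c s, (I.proc q - elapsed A.run q e) ≤
      ∑ q ∈ others I O s, (I.proc q - elapsed S.run q e) := by
  rcases (outside ρ A O c s).eq_empty_or_nonempty with he | ⟨q0, hq0⟩
  · rw [he, Finset.sum_empty]
    exact Finset.sum_nonneg fun q hq => sub_nonneg.2 (S.elapsed_le q (Finset.mem_filter.1 hq).1 e)
  · obtain ⟨hq0a, hq0p⟩ := mem_outside.1 hq0
    have hs : 0 ≤ s := by
      by_contra hs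
      rw [not_alive_of_neg (not_le.1 hs)] at hq0a
      simp at hq0a
    obtain ⟨r, hr⟩ : ∃ r, A.run s = some r := by
      rw [← Option.ne_none_iff_exists']
      intro hn
      rw [hA.alive_eq_empty hs hn] at hq0a
      simp at hq0a
    have hra := A.mem_alive_of_run hr
    have hro : r ∈ outside ρ A O c s := by
      refine mem_outside.2 ⟨hra, ?_⟩
      unfold granted at hq0p ⊢
      rw [numSlots_lt hρ (one_le_pos hra)]
      rw [numSlots_lt hρ (one_le_pos hq0a)] at hq0p
      exact hq0p.trans_le (run_spec hA hr hq0a).1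
    have h1 := sum_elapsed_sub_eq A.measRun (outside ρ A O c s) hs hse fun u h1 h2 =>
      ⟨r, hro, by rw [run_const hA hgap h1.le h2, hr]⟩
    have h2 := sum_elapsed_sub_le S.measRun (others I O s) hs hse
    have h3 := h.le
    simp only [Finset.sum_sub_distrib] at h1 h2 h3 ⊢
    linarith

/-- At `e` the job that was being run fixes its slot and the jobs released at `e` enter the ranking.
Fixing a slot leaves all other positions unchanged; the arrivals are accounted for by
`excess_union_le`. -/
theorem Inv.step (hρ : 1 < ρ) (hc : ρ ≤ c) (hA : A.Obeys ρ (rule ρ)) (hO : O ⊆ I.jobs) {s e : ℝ}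
    (h : Inv ρ A S O c s) (hse : s < e) (he : e ∈ A.events)
    (hgap : ∀ u ∈ A.events, u ≤ s ∨ e ≤ u) : Inv ρ A S O c e := by
  classical
  have hslot : ∀ q, slot ρ (history ρ A e) q =
      if slot ρ (history ρ A s) q ≠ 0 then slot ρ (history ρ A s) q
      else if A.run s = some q then pos ρ A s q else 0 := fun q => by
    rw [slot_history hse he hgap, next_history hA]
  have hrel : ∀ q ∈ I.jobs, I.release q ≤ s ∨ e ≤ I.release q := fun q hq =>
    hgap _ (A.release_mem_events hq)
  have hzero : ∀ q, slot ρ (history ρ A e) q = 0 ↔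
      slot ρ (history ρ A s) q = 0 ∧ A.run s ≠ some q := by
    intro q
    rw [hslot]
    split_ifs with h1 h2
    · exact ⟨fun h => absurd h h1, fun h => absurd h.1 h1⟩
    · have := one_le_pos (ρ := ρ) (A.mem_alive_of_run h2)
      exact ⟨fun h => by omega, fun h => absurd h2 h.2⟩
    · exact ⟨fun _ => ⟨not_not.1 h1, h2⟩, fun _ => rfl⟩
  have hpos : ∀ q, slot ρ (history ρ A e) q ≠ 0 → slot ρ (history ρ A e) q = pos ρ A s q := by
    intro q hq
    rw [hslot] at hq ⊢
    split_ifs at hq ⊢ with h1 h2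
    · unfold pos; rw [if_neg h1]
    · rfl
    · exact absurd rfl hq
  have hidle : ∀ q, A.run s ≠ some q → elapsed A.run q e = elapsed A.run q s := fun q hq =>
    elapsed_eq_of_not_run hse.le fun u h1 h2 => by rw [run_const hA hgap h1 h2]; exact hq
  have hfull : ∀ q, slot ρ (history ρ A e) q = 0 → elapsed A.run q e = 0 := fun q hq => by
    obtain ⟨h1, h2⟩ := (hzero q).1 hq
    rw [hidle q h2, h.full q h1]
  have hreleased : ∀ q, slot ρ (history ρ A e) q ≠ 0 → I.release q ≤ s := fun q hq => by
    by_cases h1 : slot ρ (history ρ A s) q = 0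
    · by_cases h2 : A.run s = some q
      · exact (A.pending s q h2).2.1
      · exact absurd ((hzero q).2 ⟨h1, h2⟩) hq
    · exact h.released q h1
  have hbefore : ∀ q ∈ A.alive e, slot ρ (history ρ A e) q ≠ 0 → q ∈ A.alive s := fun q hq h1 =>
    A.alive_mono hse.le hq (hreleased q h1)
  refine ⟨hfull, fun q hq => (hreleased q hq).trans hse.le, ?_, ?_⟩
  · have key : ∀ q ∈ A.alive s, ∀ q' ∈ A.alive s, slot ρ (history ρ A s) q ≠ 0 →
        A.run s = some q' → slot ρ (history ρ A s) q' = 0 → pos ρ A s q = pos ρ A s q' →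
        I.row ρ q = I.row ρ q' → False := by
      intro q hq q' hq' h1 h2 h3 h4 h5
      exact h1 ((run_spec hA h2 hq).2 (by rw [h4, h5]) h3)
    have key2 : ∀ q ∈ A.alive e, slot ρ (history ρ A e) q ≠ 0 → slot ρ (history ρ A s) q ≠ 0 ∨
        slot ρ (history ρ A s) q = 0 ∧ A.run s = some q := by
      intro q hq h1
      by_cases h2 : slot ρ (history ρ A s) q = 0
      · exact Or.inr ⟨h2, by_contra fun h3 => h1 ((hzero q).2 ⟨h2, h3⟩)⟩
      · exact Or.inl h2
    intro q hq q' hq' h1 h2 h3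
    have h1' : slot ρ (history ρ A e) q' ≠ 0 := h2 ▸ h1
    have hqs := hbefore q hq h1
    have hqs' := hbefore q' hq' h1'
    rw [hpos q h1, hpos q' h1'] at h2
    rcases key2 q hq h1 with h4 | h4 <;> rcases key2 q' hq' h1' with h5 | h5
    · refine h.inj q hqs q' hqs' h4 ?_ h3
      unfold pos at h2
      rwa [if_neg h4, if_neg h5] at h2
    · exact (key q hqs q' hqs' h4 h5.2 h5.1 h2 h3).elim
    · exact (key q' hqs' q hqs h5 h4.2 h4.1 h2.symm h3.symm).elim
    · exact Option.some.inj (h4.2.symm.trans h5.2)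
  · set X := {q ∈ fulls ρ A s | A.run s ≠ some q} with hXdef
    set Y := {q ∈ I.jobs | I.release q = e} with hYdef
    have hX : ∀ x ∈ X, x ∈ I.jobs ∧ I.release x < e := fun x hx => by
      have h1 := A.mem_alive.1 (mem_fulls.1 (Finset.mem_filter.1 hx).1).1
      exact ⟨h1.1, h1.2.1.trans_lt hse⟩
    have hY : ∀ y ∈ Y, y ∈ I.jobs ∧ I.release y = e := fun y hy => Finset.mem_filter.1 hy
    have hfulls : fulls ρ A e = Y ∪ X := by
      ext q
      rw [mem_fulls, hzero, Finset.mem_union, Finset.mem_filter, Finset.mem_filter, mem_fulls]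
      constructor
      · rintro ⟨h1, h2, h3⟩
        have h4 := A.mem_alive.1 h1
        rcases hrel q h4.1 with h5 | h5
        · exact Or.inr ⟨⟨A.alive_mono hse.le h1 h5, h2⟩, h3⟩
        · exact Or.inl ⟨h4.1, le_antisymm h4.2.1 h5⟩
      · rintro (⟨h1, h2⟩ | ⟨⟨h1, h2⟩, h3⟩)
        · refine ⟨A.mem_alive.2 ⟨h1, h2.le, ?_⟩, ?_, ?_⟩
          · rw [A.elapsed_eq_zero_of_le_release q h2.ge]; exact I.proc_pos q h1
          · by_contra h3; linarith [h.released q h3]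
          · intro h3; linarith [(A.pending s q h3).2.1]
        · have h4 := A.mem_alive.1 h1
          exact ⟨A.mem_alive.2 ⟨h4.1, h4.2.1.trans hse.le, by rw [hidle q h3]; exact h4.2.2⟩, h2, h3⟩
    -- If the job that is run was uninterrupted, it is the last uninterrupted one of its row, so its
    -- removal shifts no rank.
    have hrank : ∀ q ∈ X, rank (I.row ρ) (I.ord ρ) X q = pos ρ A s q := by
      intro q hq
      obtain ⟨hqf, hqr⟩ := Finset.mem_filter.1 hq
      have hqf' := mem_fulls.1 hqf
      unfold pos
      rw [if_pos hqf'.2]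
      by_cases hr : ∃ r ∈ fulls ρ A s, A.run s = some r
      · obtain ⟨r, hrf, hr⟩ := hr
        have hins : fulls ρ A s = insert r X := by
          ext x
          rw [Finset.mem_insert, Finset.mem_filter]
          constructor
          · intro hx
            by_cases hxr : x = r
            · exact Or.inl hxr
            · exact Or.inr ⟨hx, fun h => hxr (Option.some.inj (h.symm.trans hr))⟩
          · rintro (rfl | hx)
            · exact hrf
            · exact hx.1
        rw [hins]
        refine (rank_insert_of_not ?_).symm
        rintro ⟨h1, h2⟩
        have hrf' := mem_fulls.1 hrf
        have hlt : I.ord ρ r < I.ord ρ q := lt_of_le_of_ne h2 fun h =>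
          hqr (by rw [hr, I.ord_injective ρ h])
        have h3 := rank_lt_rank (X := fulls ρ A s) hqf h1 hlt
        have h4 := (run_spec hA hr hqf'.1).1
        unfold pos at h4
        rw [if_pos hqf'.2, if_pos hrf'.2, h1] at h4
        have h5 : (0:ℝ) < ρ ^ I.row ρ q := zpow_pos (by linarith) _
        have h6 := le_of_mul_le_mul_left h4 h5
        have h7 : rank (I.row ρ) (I.ord ρ) (fulls ρ A s) q ≤
          rank (I.row ρ) (I.ord ρ) (fulls ρ A s) r := by exact_mod_cast h6
        omega
      · have : X = fulls ρ A s := Finset.filter_true_of_mem fun x hx h => hr ⟨x, hx, h⟩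
        rw [this]
    have hgr : granted ρ I O c e = numSlots ρ (c * (∑ q ∈ O with I.release q ≤ s, I.weight q) +
        c * ∑ q ∈ Y with q ∈ O, I.weight q) := by
      unfold granted
      congr 1
      rw [← mul_add, ← Finset.sum_union]
      · congr 2
        ext q
        simp only [hYdef, Finset.mem_union, Finset.mem_filter]
        constructor
        · rintro ⟨h1, h2⟩
          rcases hrel q (hO h1) with h3 | h3
          · exact Or.inl ⟨h1, h3⟩
          · exact Or.inr ⟨⟨hO h1, le_antisymm h2 h3⟩, h1⟩
        · rintro (⟨h1, h2⟩ | ⟨⟨_, h2⟩, h3⟩)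
          · exact ⟨h1, h2.trans hse.le⟩
          · exact ⟨h3, h2.le⟩
      · rw [Finset.disjoint_left]
        intro q h1 h2
        have h1 := (Finset.mem_filter.1 h1).2
        have h2 := (Finset.mem_filter.1 (Finset.mem_filter.1 h2).1).2
        linarith
    have hwO : ∀ q ∈ O, 0 ≤ I.weight q := fun q hq => (I.weight_pos q (hO hq)).le
    have hgmono : ∀ j, granted ρ I O c s j ≤ granted ρ I O c e j := by
      intro j
      refine numSlots_mono hρ ?_ j
      refine mul_le_mul_of_nonneg_left (Finset.sum_le_sum_of_subset_of_nonneg (fun q hq => ?_)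
        fun q hq _ => hwO q (Finset.mem_filter.1 hq).1) (by positivity)
      obtain ⟨h1, h2⟩ := Finset.mem_filter.1 hq
      exact Finset.mem_filter.2 ⟨h1, h2.trans hse.le⟩
    have hK : (0:ℝ) ≤ c * ∑ q ∈ O with I.release q ≤ s, I.weight q :=
      mul_nonneg (by positivity) (Finset.sum_nonneg fun q hq => hwO q (Finset.mem_filter.1 hq).1)
    have hun := excess_union_le (O := O) hρ hc hX hY hK
    rw [← hfulls, ← hgr] at hun
    have hflow := h.flow hρ hA hse.le hgap
    -- The work outside splits into that of uninterrupted jobs, which is an excess, and that of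
    -- interrupted jobs, whose slots are fixed while the grants only grow.
    have hl1 : ∑ q ∈ outside ρ A O c e with slot ρ (history ρ A e) q = 0,
        (I.proc q - elapsed A.run q e) =
        excess (I.row ρ) (I.ord ρ) I.proc (fulls ρ A e) (granted ρ I O c e) := by
      unfold excess
      refine Finset.sum_congr ?_ fun q hq => ?_
      · ext q
        simp only [Finset.mem_filter, mem_outside, mem_fulls]
        constructor
        · rintro ⟨⟨h1, h2⟩, h3⟩
          unfold pos at h2
          rw [if_pos h3] at h2
          exact ⟨⟨h1, h3⟩, h2⟩
        · rintro ⟨⟨h1, h3⟩, h2⟩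
          refine ⟨⟨h1, ?_⟩, h3⟩
          unfold pos
          rwa [if_pos h3]
      · rw [hfull q (mem_fulls.1 (Finset.mem_filter.1 hq).1).2, sub_zero]
    have hr1 : excess (I.row ρ) (I.ord ρ) I.proc X (granted ρ I O c s) =
        ∑ q ∈ outside ρ A O c s with slot ρ (history ρ A e) q = 0,
          (I.proc q - elapsed A.run q e) := by
      unfold excess
      refine Finset.sum_congr ?_ fun q hq => ?_
      · ext q
        simp only [Finset.mem_filter, mem_outside, hzero]
        constructor
        · rintro ⟨h1, h2⟩
          rw [hrank q h1] at h2
          obtain ⟨h3, h4⟩ := Finset.mem_filter.1 h1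
          have h3 := mem_fulls.1 h3
          exact ⟨⟨h3.1, h2⟩, h3.2, h4⟩
        · rintro ⟨⟨h1, h2⟩, h3, h4⟩
          have h5 : q ∈ X := Finset.mem_filter.2 ⟨mem_fulls.2 ⟨h1, h3⟩, h4⟩
          exact ⟨h5, by rw [hrank q h5]; exact h2⟩
      · rw [hfull q (Finset.mem_filter.1 hq).2, sub_zero]
    have hl2 : ∑ q ∈ outside ρ A O c e with ¬ slot ρ (history ρ A e) q = 0,
        (I.proc q - elapsed A.run q e) ≤
        ∑ q ∈ outside ρ A O c s with ¬ slot ρ (history ρ A e) q = 0,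
        (I.proc q - elapsed A.run q e) := by
      refine Finset.sum_le_sum_of_subset_of_nonneg (fun q hq => ?_) fun q hq _ => ?_
      · obtain ⟨h1, h2⟩ := Finset.mem_filter.1 hq
        obtain ⟨h1, h3⟩ := mem_outside.1 h1
        refine Finset.mem_filter.2 ⟨mem_outside.2 ⟨hbefore q h1 h2, ?_⟩, h2⟩
        have h4 : pos ρ A e q = pos ρ A s q := by
          rw [← hpos q h2]; unfold pos; rw [if_neg h2]
        exact (hgmono _).trans_lt (h4 ▸ h3)
      · exact sub_nonneg.2 (A.elapsed_le q
          (A.mem_alive.1 (mem_outside.1 (Finset.mem_filter.1 hq).1).1).1 e)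
    have hright : ∑ q ∈ others I O e, (I.proc q - elapsed S.run q e) =
        ∑ q ∈ others I O s, (I.proc q - elapsed S.run q e) + ∑ q ∈ Y with q ∉ O, I.proc q := by
      have : others I O e = others I O s ∪ {q ∈ Y | q ∉ O} := by
        ext q
        simp only [others, hYdef, Finset.mem_union, Finset.mem_filter]
        constructor
        · rintro ⟨h1, h2, h3⟩
          rcases hrel q h1 with h4 | h4
          · exact Or.inl ⟨h1, h2, h4⟩
          · exact Or.inr ⟨⟨h1, le_antisymm h3 h4⟩, h2⟩
        · rintro (⟨h1, h2, h3⟩ | ⟨⟨h1, h2⟩, h3⟩)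
          · exact ⟨h1, h2, h3.trans hse.le⟩
          · exact ⟨h1, h3, h2.le⟩
      rw [this, Finset.sum_union]
      · congr 1
        refine Finset.sum_congr rfl fun q hq => ?_
        rw [S.elapsed_eq_zero_of_le_release q (hY q (Finset.mem_filter.1 hq).1).2.ge, sub_zero]
      · rw [Finset.disjoint_left]
        intro q h1 h2
        have h1 := (Finset.mem_filter.1 h1).2.2
        have h2 := (hY q (Finset.mem_filter.1 h2).1).2
        linarith
    rw [← Finset.sum_filter_add_sum_filter_not (outside ρ A O c e)
      fun q => slot ρ (history ρ A e) q = 0, hl1, hright]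
    rw [← Finset.sum_filter_add_sum_filter_not (outside ρ A O c s)
      fun q => slot ρ (history ρ A e) q = 0, ← hr1] at hflow
    unfold granted at hr1 hflow
    linarith

theorem inv_of_mem_events (hρ : 1 < ρ) (hc : ρ ≤ c) (hA : A.Obeys ρ (rule ρ)) (hO : O ⊆ I.jobs)
    (n : ℕ) : ∀ e ∈ A.events, (A.events.filter (· < e)).card = n → Inv ρ A S O c e := by
  classical
  induction n using Nat.strong_induction_on with
  | _ n ih =>
  intro e he hn
  rcases (A.events.filter (· < e)).eq_empty_or_nonempty with h0 | hne
  · refine (Inv.of_neg (s := -1) (by norm_num)).step hρ hc hA hO (by linarith [events_nonneg he]) he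
      fun u hu => Or.inr ?_
    by_contra hlt
    rw [Finset.filter_eq_empty_iff] at h0
    exact h0 hu (not_le.1 hlt)
  · have hm := Finset.max'_mem _ hne
    set m := (A.events.filter (· < e)).max' hne
    obtain ⟨hm1, hm2⟩ := Finset.mem_filter.1 hm
    have hlt : (A.events.filter (· < m)).card < n := by
      rw [← hn]
      refine Finset.card_lt_card ⟨fun u hu => ?_, fun hs => ?_⟩
      · obtain ⟨h1, h2⟩ := Finset.mem_filter.1 hu
        exact Finset.mem_filter.2 ⟨h1, h2.trans hm2⟩
      · exact lt_irrefl _ (Finset.mem_filter.1 (hs hm)).2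
    refine (ih _ hlt m hm1 rfl).step hρ hc hA hO hm2 he fun u hu => ?_
    by_cases hue : u < e
    · exact Or.inl (Finset.le_max' _ _ (Finset.mem_filter.2 ⟨hu, hue⟩))
    · exact Or.inr (not_lt.1 hue)

/-- The invariant is used with `O` the jobs pending in `S` at `t`. All other released jobs are
finished in `S`, so `A` has nothing outside the granted slots, and each granted slot holds at most
one uninterrupted and one interrupted job. -/
theorem load_le (hρ : 1 < ρ) (hc : ρ ≤ c) (hA : A.Obeys ρ (rule ρ)) (t : ℝ) :
    A.load t ≤ ((I.jobs.image (I.row ρ)).card : ℝ) * (2 * ρ * c) * S.load t := by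
  classical
  set O := S.alive t with hOdef
  have hO : O ⊆ I.jobs := fun q hq => (S.mem_alive.1 hq).1
  rcases (A.events.filter (· ≤ t)).eq_empty_or_nonempty with h0 | hne
  · have : A.alive t = ∅ := by
      rw [Finset.eq_empty_iff_forall_notMem]
      intro q hq
      have h := A.mem_alive.1 hq
      rw [Finset.filter_eq_empty_iff] at h0
      exact h0 (A.release_mem_events h.1) h.2.1
    unfold Schedule.load
    rw [this, Finset.sum_empty]
    have : 0 ≤ ∑ q ∈ S.alive t, I.weight q := Finset.sum_nonneg fun q hq =>
      (I.weight_pos q (hO hq)).le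
    positivity
  have hm := Finset.max'_mem _ hne
  -- From the last event `s` up to `t` the history is constant, so the invariant at `s` and
  -- `Inv.flow` reach `t`.
  set s := (A.events.filter (· ≤ t)).max' hne
  obtain ⟨hs, hst⟩ := Finset.mem_filter.1 hm
  have hlast : ∀ u ∈ A.events, u ≤ s ∨ t < u := fun u hu => by
    by_cases hut : u ≤ t
    · exact Or.inl (Finset.le_max' _ _ (Finset.mem_filter.2 ⟨hu, hut⟩))
    · exact Or.inr (not_le.1 hut)
  have hinv : Inv ρ A S O c s := inv_of_mem_events hρ hc hA hO _ s hs rfl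
  have hflow := hinv.flow hρ hA hst fun u hu => (hlast u hu).imp_right le_of_lt
  have halive : A.alive t = A.alive s := by
    ext q
    rw [← A.pending_history (ρ := ρ), ← A.pending_history (ρ := ρ), A.history_congr ρ hst
      fun u hu hsu => (hlast u hu).resolve_left (not_le.2 hsu)]
  have hzero : ∑ q ∈ others I O s, (I.proc q - elapsed S.run q t) ≤ 0 := by
    refine Finset.sum_nonpos fun q hq => ?_
    obtain ⟨h1, h2, h3⟩ := Finset.mem_filter.1 hq
    by_contra hlt
    exact h2 (S.mem_alive.2 ⟨h1, h3.trans hst, by linarith⟩)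
  have hin : ∀ q ∈ A.alive s, pos ρ A s q ≤ granted ρ I O c s (I.row ρ q) := by
    intro q hq
    by_contra hlt
    have hout : q ∈ outside ρ A O c s := mem_outside.2 ⟨hq, not_le.1 hlt⟩
    have hpos : ∀ q ∈ outside ρ A O c s, 0 < I.proc q - elapsed A.run q t := fun q hq => by
      have h1 := (mem_outside.1 hq).1
      rw [← halive] at h1
      linarith [(A.mem_alive.1 h1).2.2]
    linarith [Finset.sum_pos hpos ⟨q, hout⟩]
  have hM : ∑ q ∈ O with I.release q ≤ s, I.weight q ≤ S.load t :=
    Finset.sum_le_sum_of_subset_of_nonneg (Finset.filter_subset _ _) fun q hq _ =>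
      (I.weight_pos q (hO hq)).le
  have hM0 : 0 ≤ ∑ q ∈ O with I.release q ≤ s, I.weight q := Finset.sum_nonneg fun q hq =>
    (I.weight_pos q (hO (Finset.mem_filter.1 hq).1)).le
  unfold Schedule.load
  rw [halive, ← Finset.sum_fiberwise_of_maps_to (t := I.jobs.image (I.row ρ)) (g := I.row ρ)
    fun q hq => Finset.mem_image_of_mem _ (A.mem_alive.1 hq).1, mul_assoc, ← nsmul_eq_mul]
  refine Finset.sum_le_card_nsmul _ _ _ fun j _ => ?_
  set k := granted ρ I O c s j with hk
  have hj : (0:ℝ) < ρ ^ j := zpow_pos (by linarith) j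
  have hcount : ∀ R : Finset ℕ, (∀ q ∈ R, q ∈ A.alive s ∧ I.row ρ q = j) →
      (∀ q ∈ R, ∀ q' ∈ R, pos ρ A s q = pos ρ A s q' → q = q') → R.card ≤ k := by
    intro R hR hRinj
    have : (R.image (pos ρ A s)).card ≤ (Finset.Icc 1 k).card := by
      refine Finset.card_le_card fun i hi => ?_
      obtain ⟨q, hq, rfl⟩ := Finset.mem_image.1 hi
      have h1 := hin q (hR q hq).1
      rw [(hR q hq).2] at h1
      exact Finset.mem_Icc.2 ⟨one_le_pos (hR q hq).1, h1⟩
    rw [Finset.card_image_of_injOn fun q hq q' hq' => hRinj q hq q' hq', Nat.card_Icc] at this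
    omega
  set R := {q ∈ A.alive s | I.row ρ q = j} with hRdef
  have hR : ∀ q ∈ R, q ∈ A.alive s ∧ I.row ρ q = j := fun q hq => Finset.mem_filter.1 hq
  have hc1 : ({q ∈ R | slot ρ (history ρ A s) q = 0}).card ≤ k := by
    refine hcount _ (fun q hq => hR q (Finset.mem_filter.1 hq).1) fun q hq q' hq' hqq => ?_
    obtain ⟨h1, h2⟩ := Finset.mem_filter.1 hq
    obtain ⟨h3, h4⟩ := Finset.mem_filter.1 hq'
    unfold pos at hqq
    rw [if_pos h2, if_pos h4] at hqq
    exact rank_inj (I.ord_injective ρ) (mem_fulls.2 ⟨(hR q h1).1, h2⟩)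
      (mem_fulls.2 ⟨(hR q' h3).1, h4⟩) ((hR q h1).2.trans (hR q' h3).2.symm) hqq
  have hc2 : ({q ∈ R | ¬ slot ρ (history ρ A s) q = 0}).card ≤ k := by
    refine hcount _ (fun q hq => hR q (Finset.mem_filter.1 hq).1) fun q hq q' hq' hqq => ?_
    obtain ⟨h1, h2⟩ := Finset.mem_filter.1 hq
    obtain ⟨h3, h4⟩ := Finset.mem_filter.1 hq'
    unfold pos at hqq
    rw [if_neg h2, if_neg h4] at hqq
    exact hinv.inj q (hR q h1).1 q' (hR q' h3).1 h2 hqq ((hR q h1).2.trans (hR q' h3).2.symm)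
  have hcard : (R.card : ℝ) ≤ 2 * k := by
    have := Finset.card_filter_add_card_filter_not (s := R) fun q => slot ρ (history ρ A s) q = 0
    have h3 : R.card ≤ 2 * k := by omega
    exact_mod_cast h3
  have hkK : (k : ℝ) * ρ ^ j ≤ c * ∑ q ∈ O with I.release q ≤ s, I.weight q := by
    rw [← le_div_iff₀ hj]
    exact Nat.floor_le (div_nonneg (mul_nonneg (by positivity) hM0) hj.le)
  calc ∑ q ∈ R, I.weight q ≤ R.card • ρ ^ (j + 1) := by
        refine Finset.sum_le_card_nsmul _ _ _ fun q hq => ?_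
        have h1 := hR q hq
        rw [← h1.2]
        exact (row_spec hρ (A.mem_alive.1 h1.1).1).2.le
    _ = R.card * (ρ * ρ ^ j) := by rw [nsmul_eq_mul, zpow_add_one₀ (by linarith), mul_comm ρ]
    _ ≤ 2 * k * (ρ * ρ ^ j) := by gcongr
    _ = 2 * ρ * (k * ρ ^ j) := by ring
    _ ≤ 2 * ρ * (c * ∑ q ∈ S.alive t, I.weight q) := by
        refine mul_le_mul_of_nonneg_left (hkK.trans ?_) (by linarith)
        exact mul_le_mul_of_nonneg_left hM (by positivity)
    _ = _ := by ring

theorem card_rows_le (hρ : 1 < ρ) (I : Instance) (hne : I.jobs.Nonempty) :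
    ((I.jobs.image (I.row ρ)).card : ℝ) ≤ 2 + Real.logb ρ I.W := by
  have hW : 1 ≤ I.W := DensityBins.one_le_maxRatio I.weight_pos hne
  have hlog := Real.logb_nonneg hρ hW
  refine (card_le_of_spread _ (X := 1 + Real.logb ρ I.W) (by positivity)
    fun k hk k' hk' => ?_).trans (by linarith)
  obtain ⟨q, hq, rfl⟩ := Finset.mem_image.1 hk
  obtain ⟨q', hq', rfl⟩ := Finset.mem_image.1 hk'
  have h1 : I.weight q / I.weight q' ≤ I.W := DensityBins.le_maxRatio hq hq'
  have h2 := (Real.logb_le_logb hρ (div_pos (I.weight_pos q hq) (I.weight_pos q' hq'))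
    (by linarith)).2 h1
  rw [Real.logb_div (I.weight_pos q hq).ne' (I.weight_pos q' hq').ne'] at h2
  have h3 := Int.floor_le (Real.logb ρ (I.weight q))
  have h4 := Int.lt_floor_add_one (Real.logb ρ (I.weight q'))
  unfold Instance.row jobClass
  push_cast
  linarith

end
end Slots

theorem exists_competitive_W {ρ : ℝ} (hρ : 1 < ρ) :
    ∃ (A : SemiclairvoyantAlgorithm ρ) (C : ℝ), 0 < C ∧
      A.IsCompetitive fun I => C * (1 + Real.log I.W) := by
  obtain ⟨c, hc⟩ := exists_nat_ge ρ
  have hL : 0 < Real.log ρ := Real.log_pos hρ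
  have hcp : (0:ℝ) < c := by linarith
  refine ⟨(Slots.rule ρ).algorithm ρ, (2 + 1 / Real.log ρ) * (2 * ρ * c), by positivity,
    fun I S => ?_⟩
  rcases I.jobs.eq_empty_or_nonempty with he | hne
  · simp [Schedule.flowTime, he]
  · refine Schedule.flowTime_le_of_load_le S _ fun t _ => ?_
    refine (Slots.load_le hρ hc (Rule.algorithm_obeys _ ρ I) t).trans
      (mul_le_mul_of_nonneg_right ?_ (S.load_nonneg t))
    have hlog : 0 ≤ Real.log I.W :=
      Real.log_nonneg (DensityBins.one_le_maxRatio I.weight_pos hne)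
    have h1 := Slots.card_rows_le hρ I hne
    have h2 : Real.logb ρ I.W = 1 / Real.log ρ * Real.log I.W := by rw [Real.logb]; ring
    have h4 : 0 ≤ 1 / Real.log ρ := by positivity
    calc _ ≤ (2 + 1 / Real.log ρ) * (1 + Real.log I.W) * (2 * ρ * c) := by
          refine mul_le_mul_of_nonneg_right (h1.trans ?_) (by positivity)
          rw [h2]
          nlinarith
      _ = _ := by ring

end FlowTime

theorem mainTheorem7 (ρ : ℝ) (hρ : 1 < ρ) :
    (∃ (A : FlowTime.SemiclairvoyantAlgorithm ρ) (C : ℝ), 0 < C ∧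
      A.IsCompetitive fun I => C * (1 + Real.log I.P)) ∧
    (∃ (A : FlowTime.SemiclairvoyantAlgorithm ρ) (C : ℝ), 0 < C ∧
      A.IsCompetitive fun I => C * (1 + Real.log I.D)) ∧
    (∃ (A : FlowTime.SemiclairvoyantAlgorithm ρ) (C : ℝ), 0 < C ∧
      A.IsCompetitive fun I => C * (1 + Real.log I.W)) := by
  refine ⟨FlowTime.exists_competitive_P hρ, FlowTime.exists_competitive_D hρ,
    FlowTime.exists_competitive_W hρ⟩
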